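/- **Setting.** Let $(\Omega,\mathcal F,\mathbb P)$ be a probability space and $U_t=u_0+g(t)+M_t$, $t\ge 0$, with $u_0\ge 0$, $g$ deterministic, $g(0)=0$, and $M_t=\mathbb E[S_t]-S_t$, $M_0=0$ a.s. Here $S$ is an integrable, non-decreasing, càdlàg pure-jump process (each increment is the sum of the jumps) with independent increments and without fixed times of discontinuity, i.e. $\Delta S_t:=S_t-S_{t-}=0$ a.s. for each fixed $t$. Let $\mathcal F^M$ be the natural filtration of $M$. Fix $T>0$ with $\mathbb E[S_T^2]<\infty$, and a deterministic surcharge $h(t)$, which may depend on the law of the random variable $M^R_T$ introduced below (written $h_\rho(t)$ if this law is $\rho$). An *admissible strategy* consists of an initial capital $u_0^R\ge 0$, an $\mathcal F^M$-adapted, càdlàg, non-decreasing pure-jump process $S^R$ with $S^R_0=0$ and, almost surely, $0\le \Delta S^R_t\le\Delta S_t$ for all $t\in[0,T]$, and the $\mathcal F^M$-compensator $A^R$ of $S^R$. Its martingale part is $M^R=A^R-S^R$, and the surplus after reinsurance is $U^R_t=u^R_0+g(t)-h_{\mathscr L(M^R_T)}(t)+M^R_t$. For a law $\xi$ on $\mathbb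 R$ let $F_\xi$ be its distribution function and $Q_\xi(u)=\inf\{x: F_\xi(x)\ge u\}$, $u\in(0,1)$; write $F_{M_T},Q_{M_T}$ for those of the law of $M_T$. Let $\mathcal A$ be the set of square-integrable laws $\nu$ for which there is a non-decreasing $1$-Lipschitz $F:\mathbb R\to\mathbb R$ with $F(M_T)\sim\nu$. Let $C$ be any set of laws on $\mathbb R$ (the moment or risk constraints), and $\mathcal A_c=\mathcal A\cap C$. The *relaxed problem* is $$\inf_{\nu\in\mathcal A_c}\ \inf_{U^R\text{ admissible},\ U^R_T\sim\nu}\ \mathbb E\Big[\sum_{t\in[0,T]}|\Delta S^R_t-\Delta S_t|^2\Big].\tag{1}$$ Let $\mathcal Q$ be the set of $\tilde Q\in L^2(0,1)$, defined everywhere on $(0,1)$, with $\int_0^1\tilde Q(u)\,du=0$ and $0\le\tilde Q(x)-\tilde Q(y)\le Q_{M_T}(x)-Q_{M_T}(y)$ for all $0<y<x<1$. Let $\mathcal Q_c$ be the set of $\tilde Q\in\mathcal Q$ that satisfy the constraints in the following sense: for some $c\ge 0$, the law with quantile function $c+g(T)-h_\rho(T)+\tilde Q$ belongs to $C$, where $\rho$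 is the law with quantile function $\tilde Q$. The *quantile problem* is $$\inf_{\tilde Q\in\mathcal Q_c}\int_0^1|\tilde Q(u)-Q_{M_T}(u)|^2\,du.\tag{2}$$ **Theorem.** Assume that (2) has an optimizer. Then: 1. The infima (1) and (2) are equal. 2. For every optimizer of (1) there is an optimizer $\hat Q$ of (2) such that the martingale part of the former is $$\hat M^R_t=\mathbb E\big[\hat Q(F_{M_T}(M_T))\,\big|\,M_t\big]\quad\text{a.s., for all } t\in[0,T],\tag{3}$$ where $\hat Q(1):=\lim_{u\uparrow 1}\hat Q(u)$. 3. Conversely, for every optimizer $\hat Q$ of (2) there is an optimizer of (1) whose martingale part is given by (3). 4. The martingale part of the optimizers of (1) is unique (up to indistinguishability on $[0,T]$) if and only if the optimizer of (2) is unique (as a function on $(0,1)$). -/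

import Mathlib

open MeasureTheory ProbabilityTheory Filter Set
open scoped NNReal ENNReal Topology

noncomputable section

namespace Reinsurance

/-! ### Paths -/

/-- The jump `Δx_t = x_t - x_{t-}` of a path. At `t = 0` it is `0`, since `leftLim x 0 = x 0`. -/
def jump (x : ℝ≥0 → ℝ) (t : ℝ≥0) : ℝ := x t - Function.leftLim x t

/-- Right-continuous paths with left limits. -/
def IsCadlag (x : ℝ≥0 → ℝ) : Prop :=
  ∀ t, ContinuousWithinAt x (Ici t) t ∧ ∃ l, Tendsto x (𝓝[<] t) (𝓝 l)

/-- Non-decreasing càdlàg pure-jump paths: each increment `x_t - x_0` is the sum of the jumps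
on `[0, t]`. Infinitely many jumps on bounded intervals are allowed. -/
structure IsIncreasingPureJump (x : ℝ≥0 → ℝ) : Prop where
  mono : Monotone x
  cadlag : IsCadlag x
  hasSum_jump : ∀ t, HasSum (fun s : Iic t => jump x s) (x t - x 0)

/-! ### The surplus before reinsurance -/

/-- The surplus `U_t = u₀ + g(t) + M_t`, `M_t = 𝔼[S_t] - S_t`, where the cumulative claims `S` form
a non-decreasing pure-jump process with independent increments, without deterministic jump times. -/
structure SurplusModel {Ω : Type*} [MeasurableSpace Ω] (μ : Measure Ω) where
  /-- initial capital -/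
  u₀ : ℝ
  /-- gain in excess of the expected claims -/
  g : ℝ≥0 → ℝ
  /-- cumulative claims -/
  S : ℝ≥0 → Ω → ℝ
  u₀_nonneg : 0 ≤ u₀
  g_zero : g 0 = 0
  measurable_S : ∀ t, Measurable (S t)
  integrable_S : ∀ t, Integrable (S t) μ
  pureJump_S : ∀ ω, IsIncreasingPureJump (fun t => S t ω)
  indep_S : HasIndepIncrements S μ
  noFixedJump_S : ∀ t, ∀ᵐ ω ∂μ, jump (fun s => S s ω) t = 0
  start_S : ∀ᵐ ω ∂μ, (∫ ω', S 0 ω' ∂μ) - S 0 ω = 0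

namespace SurplusModel

variable {Ω : Type*} [MeasurableSpace Ω] {μ : Measure Ω}

/-- The martingale part `M_t = 𝔼[S_t] - S_t`. -/
def M (X : SurplusModel μ) (t : ℝ≥0) (ω : Ω) : ℝ := (∫ ω', X.S t ω' ∂μ) - X.S t ω

theorem measurable_M (X : SurplusModel μ) (t : ℝ≥0) : Measurable (X.M t) :=
  measurable_const.sub (X.measurable_S t)

/-- The surplus process before reinsurance. -/
def U (X : SurplusModel μ) (t : ℝ≥0) (ω : Ω) : ℝ := X.u₀ + X.g t + X.M t ω

/-- The natural filtration of `M`. -/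
def filtrationM (X : SurplusModel μ) : Filtration ℝ≥0 (inferInstance : MeasurableSpace Ω) :=
  Filtration.natural X.M (fun t => (X.measurable_M t).stronglyMeasurable)

/-- The law of `M_T`. -/
def lawM (X : SurplusModel μ) (T : ℝ≥0) : Measure ℝ := μ.map (X.M T)

end SurplusModel

/-! ### Reinsurance strategies -/

/-- `A` is the compensator of the increasing process `Z`: the predictable, non-decreasing,
right-continuous process starting at `0` for which `Z - A` is a martingale. -/
structure IsCompensator {Ω : Type*} {m : MeasurableSpace Ω} (ℱ : Filtration ℝ≥0 m) (μ : Measure Ω)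
    (Z A : ℝ≥0 → Ω → ℝ) : Prop where
  predictable : IsStronglyPredictable ℱ A
  start : ∀ᵐ ω ∂μ, A 0 ω = 0
  mono : ∀ᵐ ω ∂μ, Monotone (fun t => A t ω)
  cadlag : ∀ᵐ ω ∂μ, IsCadlag (fun t => A t ω)
  martingale : Martingale (fun t ω => Z t ω - A t ω) ℱ μ

/-- The data of a reinsurance strategy: the initial capital `u₀ᴿ` after reinsurance, the retained
claims `Sᴿ` and the process `Aᴿ`. -/
structure Strategy (Ω : Type*) where
  u₀R : ℝ
  SR : ℝ≥0 → Ω → ℝ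
  AR : ℝ≥0 → Ω → ℝ

namespace Strategy

variable {Ω : Type*}

/-- The martingale part `Mᴿ = Aᴿ - Sᴿ` of the surplus after reinsurance. -/
def MR (R : Strategy Ω) (t : ℝ≥0) (ω : Ω) : ℝ := R.AR t ω - R.SR t ω

variable [MeasurableSpace Ω] {μ : Measure Ω}

/-- The surplus after reinsurance, `Uᴿ_t = u₀ᴿ + gᴿ(t) + Mᴿ_t` with `gᴿ = g - h`. The deterministic
premium surcharge `h` may depend on the law of `Mᴿ_T`. -/
def UR (R : Strategy Ω) (X : SurplusModel μ) (h : Measure ℝ → ℝ≥0 → ℝ) (T : ℝ≥0)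
    (t : ℝ≥0) (ω : Ω) : ℝ :=
  R.u₀R + (X.g t - h (μ.map (R.MR T)) t) + R.MR t ω

/-- Admissible strategies for the time horizon `T`. -/
structure IsAdmissible (R : Strategy Ω) (X : SurplusModel μ) (T : ℝ≥0) : Prop where
  capital : 0 ≤ R.u₀R
  adapted : Adapted X.filtrationM R.SR
  pureJump : ∀ᵐ ω ∂μ, IsIncreasingPureJump (fun t => R.SR t ω)
  start : ∀ᵐ ω ∂μ, R.SR 0 ω = 0
  compensator : IsCompensator X.filtrationM μ R.SR R.AR
  jump_le : ∀ᵐ ω ∂μ, ∀ t ≤ T,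
    0 ≤ jump (fun s => R.SR s ω) t ∧ jump (fun s => R.SR s ω) t ≤ jump (fun s => X.S s ω) t

/-- The `L²`-size of the ceded risk, `𝔼[∑_{t ∈ [0,T]} |ΔSᴿ_t - ΔS_t|²]`. -/
def cost (R : Strategy Ω) (X : SurplusModel μ) (T : ℝ≥0) : ℝ≥0∞ :=
  ∫⁻ ω, ∑' t : Iic T,
    ENNReal.ofReal (|jump (fun s => R.SR s ω) t - jump (fun s => X.S s ω) t| ^ 2) ∂μ

end Strategy

/-! ### The relaxed problem -/

section Relaxed

variable {Ω : Type*} [MeasurableSpace Ω] {μ : Measure Ω}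

/-- The set `𝒜` of square-integrable laws that are the image of the law of `M_T` under a
non-decreasing 1-Lipschitz map. -/
def admissibleLaws (X : SurplusModel μ) (T : ℝ≥0) : Set (Measure ℝ) :=
  {ν | IsProbabilityMeasure ν ∧ MemLp id 2 ν ∧
    ∃ F : ℝ → ℝ, LipschitzWith 1 F ∧ Monotone F ∧ (X.lawM T).map F = ν}

/-- `𝒜_c`: the admissible laws that satisfy the constraints, a set `C` of laws. -/
def constrainedLaws (X : SurplusModel μ) (T : ℝ≥0) (C : Set (Measure ℝ)) : Set (Measure ℝ) :=
  admissibleLaws X T ∩ C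

/-- The strategies over which the inner infimum runs for a given terminal law `ν`. -/
def strategiesTo (X : SurplusModel μ) (h : Measure ℝ → ℝ≥0 → ℝ) (T : ℝ≥0) (ν : Measure ℝ) :
    Set (Strategy Ω) :=
  {R | R.IsAdmissible X T ∧ μ.map (R.UR X h T T) = ν}

/-- The value of the relaxed problem. -/
def relaxedValue (X : SurplusModel μ) (h : Measure ℝ → ℝ≥0 → ℝ) (T : ℝ≥0)
    (C : Set (Measure ℝ)) : ℝ≥0∞ :=
  ⨅ ν ∈ constrainedLaws X T C, ⨅ R ∈ strategiesTo X h T ν, R.cost X T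

/-- The optimizers of the relaxed problem. -/
def IsRelaxedOptimizer (X : SurplusModel μ) (h : Measure ℝ → ℝ≥0 → ℝ) (T : ℝ≥0)
    (C : Set (Measure ℝ)) (R : Strategy Ω) : Prop :=
  (∃ ν ∈ constrainedLaws X T C, R ∈ strategiesTo X h T ν) ∧ R.cost X T = relaxedValue X h T C

end Relaxed

/-! ### The quantile problem -/

/-- The quantile function `Q_ξ(u) = inf {x | u ≤ F_ξ(x)}`, to be used for `u ∈ (0,1)`. -/
def quantile (ξ : Measure ℝ) (u : ℝ) : ℝ := sInf {x : ℝ | u ≤ cdf ξ x}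

/-- The value at `u ∈ (0,1]` of a function given on `(0,1)`; at `u = 1` this is the left limit. -/
def evalLevel (Q : ℝ → ℝ) (u : ℝ) : ℝ := if u < 1 then Q u else Function.leftLim Q 1

/-- The law of `Q(V)` for `V` uniform on `(0,1)`. -/
def lawOfQuantile (Q : ℝ → ℝ) : Measure ℝ := (volume.restrict (Ioo (0 : ℝ) 1)).map Q

section Quantile

variable {Ω : Type*} [MeasurableSpace Ω] {μ : Measure Ω}

/-- The set `𝒬`; only the values on `(0,1)` matter. -/
structure IsAdmissibleQuantile (X : SurplusModel μ) (T : ℝ≥0) (Q : ℝ → ℝ) : Prop where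
  memLp : MemLp Q 2 (volume.restrict (Ioo (0 : ℝ) 1))
  mean_zero : ∫ u in Ioo (0 : ℝ) 1, Q u = 0
  increments : ∀ x y : ℝ, 0 < y → y < x → x < 1 →
    0 ≤ Q x - Q y ∧ Q x - Q y ≤ quantile (X.lawM T) x - quantile (X.lawM T) y

/-- The set `𝒬_c`: the constraints `C` on the law of `Uᴿ_T`, read on the quantile function `Q` of
`Mᴿ_T`. The quantile function of `Uᴿ_T` is `c + gᴿ(T) + Q` for an initial capital `c ≥ 0`. -/
def constrainedQuantiles (X : SurplusModel μ) (h : Measure ℝ → ℝ≥0 → ℝ) (T : ℝ≥0)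
    (C : Set (Measure ℝ)) : Set (ℝ → ℝ) :=
  {Q | IsAdmissibleQuantile X T Q ∧ ∃ c : ℝ, 0 ≤ c ∧
    lawOfQuantile (fun u => c + (X.g T - h (lawOfQuantile Q) T) + Q u) ∈ C}

/-- The objective `∫₀¹ |Q(u) - Q_{M_T}(u)|² du`. -/
def quantileCost (X : SurplusModel μ) (T : ℝ≥0) (Q : ℝ → ℝ) : ℝ :=
  ∫ u in Ioo (0 : ℝ) 1, |Q u - quantile (X.lawM T) u| ^ 2

/-- The optimizers of the quantile problem. -/
def IsQuantileOptimizer (X : SurplusModel μ) (h : Measure ℝ → ℝ≥0 → ℝ) (T : ℝ≥0)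
    (C : Set (Measure ℝ)) (Q : ℝ → ℝ) : Prop :=
  Q ∈ constrainedQuantiles X h T C ∧
    ∀ Q' ∈ constrainedQuantiles X h T C, quantileCost X T Q ≤ quantileCost X T Q'

/-- The process `N` on `[0,T]` is (a version of) `𝔼[Q(F_{M_T}(M_T)) | M_t]`, `t ∈ [0,T]`. -/
def IsBassMartingaleOf (X : SurplusModel μ) (T : ℝ≥0) (Q : ℝ → ℝ) (N : ℝ≥0 → Ω → ℝ) : Prop :=
  ∀ t ≤ T, N t =ᵐ[μ]
    μ[fun ω => evalLevel Q (cdf (X.lawM T) (X.M T ω)) |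
      MeasurableSpace.comap (X.M t) inferInstance]

end Quantile

end Reinsurance

end

noncomputable section

namespace Reinsurance

/-! ### Increasing pure-jump paths -/

/-! Both problems turn out to minimize `E|F(M_T) - M_T|²` over non-decreasing 1-Lipschitz `F`. Four
facts carry this.

Cost as terminal distance (`Strategy.IsAdmissible.cost_eq`). For a feasible strategy, `D = M - Mᴿ`
is a martingale on `[0,T]`, square-integrable and null at time 0. The claims `S` are compensated by
their mean, which is continuous because there are no fixed jump times. Since `Sᴿ` grows no faster
than `S`, its compensator cannot jump up to `T` either (`predictable_jump_eq_zero`). The quadratic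
variation of `D` is therefore the sum of its squared jumps `(ΔSᴿ - ΔS)²`, and the cost equals
`E[D_T²]`.

Optimal coupling (`monotone_coupling_optimal`). A feasible terminal law, shifted by the
deterministic part of the surplus, makes `Mᴿ_T` distributed like `F(M_T)`. Young's inequality for
the convex primitive of `F` and its conjugate shows that `F(M_T)` is the closest variable to `M_T`
with this law. The equality case shows that it is the only one. An optimal `Mᴿ` is then the
martingale closed by `F(M_T)`.

Attainment (`isAdmissible_valueStrategy`). By independence of increments, `E[F(M_T) | ℱ_t] = k(t,
S_t)`, where `k` is continuous and non-decreasing in time, non-increasing and 1-Lipschitz in space.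
A claim `ΔS` thus lowers this martingale by an amount between 0 and `ΔS`. These amounts are the
retained claims. What remains of `k(t, S_t)` is continuous, adapted and non-decreasing, so it is
their compensator.

Dictionary (`IsDominatedBy.exists_lipschitz`). The increment condition on `Q` says that `Q = F ∘
Q_{M_T}` on `(0,1)` for such an `F`; then `Q(F_{M_T}(M_T)) = F(M_T)` a.s., and the two objectives
agree. Left-continuity of `Q_{M_T}` makes `F(M_T)` determine `Q` everywhere on `(0,1)`.
Right-continuity of paths upgrades equality at each time to indistinguishability. Together these
give the uniqueness equivalence. -/

theorem nhdsLT_neBot_of_pos {t : ℝ≥0} (ht : 0 < t) : (𝓝[<] t).NeBot :=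
  nhdsLT_neBot_of_exists_lt ⟨0, ht⟩

theorem jump_zero (x : ℝ≥0 → ℝ) : jump x 0 = 0 := by
  have : IsBot (0 : ℝ≥0) := fun _ => zero_le
  simp [jump, leftLim_eq_of_isBot this]

theorem jump_nonneg {x : ℝ≥0 → ℝ} (hx : Monotone x) (t : ℝ≥0) : 0 ≤ jump x t :=
  sub_nonneg.2 (hx.leftLim_le le_rfl)

theorem IsCadlag.tendsto_leftLim {x : ℝ≥0 → ℝ} (hx : IsCadlag x) (t : ℝ≥0) :
    Tendsto x (𝓝[<] t) (𝓝 (Function.leftLim x t)) :=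
  tendsto_leftLim_of_tendsto (hx t).2

theorem IsCadlag.continuous_of_jump_eq_zero {x : ℝ≥0 → ℝ} (hx : IsCadlag x)
    (h : ∀ t, jump x t = 0) : Continuous x := by
  refine continuous_iff_continuousAt.2 fun t => ?_
  rw [continuousAt_iff_continuous_left'_right']
  refine ⟨?_, (hx t).1.mono Ioi_subset_Ici_self⟩
  have := hx.tendsto_leftLim t
  rwa [← sub_eq_zero.1 (h t)] at this

theorem leftLim_congr {x y : ℝ≥0 → ℝ} {t : ℝ≥0} (h : ∀ s ≤ t, x s = y s) :
    Function.leftLim x t = Function.leftLim y t := by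
  have hev : x =ᶠ[𝓝[<] t] y := by
    filter_upwards [self_mem_nhdsWithin] with s hs using h s (le_of_lt hs)
  by_cases hex : ∃ l, Tendsto x (𝓝[<] t) (𝓝 l)
  · rcases eq_or_neBot (𝓝[<] t) with h' | h'
    · simp [leftLim_eq_of_eq_bot _ h', h t le_rfl]
    · obtain ⟨l, hl⟩ := hex
      rw [leftLim_eq_of_tendsto hl, leftLim_eq_of_tendsto (hl.congr' hev)]
  -- Without a left limit, `Function.leftLim` defaults to the value at the point, on which the two
  -- paths agree.
  · have hey : ¬ ∃ l, Tendsto y (𝓝[<] t) (𝓝 l) := by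
      rintro ⟨l, hl⟩
      exact hex ⟨l, hl.congr' hev.symm⟩
    rw [leftLim_eq_of_not_tendsto _ hex, leftLim_eq_of_not_tendsto _ hey, h t le_rfl]

theorem jump_congr {x y : ℝ≥0 → ℝ} {t : ℝ≥0} (h : ∀ s ≤ t, x s = y s) : jump x t = jump y t := by
  rw [jump, jump, leftLim_congr h, h t le_rfl]

/-- A path stopped at time `T`. -/
def stopAt (x : ℝ≥0 → ℝ) (T t : ℝ≥0) : ℝ := x (min t T)

theorem jump_stopAt_of_le (x : ℝ≥0 → ℝ) {T t : ℝ≥0} (h : t ≤ T) :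
    jump (stopAt x T) t = jump x t :=
  jump_congr fun s hs => by simp [stopAt, min_eq_left (hs.trans h)]

theorem jump_stopAt_of_lt (x : ℝ≥0 → ℝ) {T t : ℝ≥0} (h : T < t) : jump (stopAt x T) t = 0 := by
  have : (𝓝[<] t).NeBot := nhdsLT_neBot_of_exists_lt ⟨T, h⟩
  have h1 : Tendsto (stopAt x T) (𝓝[<] t) (𝓝 (x T)) := by
    refine tendsto_const_nhds.congr' ?_
    filter_upwards [Ioo_mem_nhdsLT h] with s hs
    simp [stopAt, min_eq_right hs.1.le]
  rw [jump, leftLim_eq_of_tendsto h1]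
  simp [stopAt, min_eq_right h.le]

theorem jump_le_sub {x : ℝ≥0 → ℝ} (hx : Monotone x) {a b : ℝ≥0} (h : a < b) :
    jump x b ≤ x b - x a :=
  sub_le_sub_left (hx.le_leftLim h) _

theorem IsCadlag.stopAt {x : ℝ≥0 → ℝ} (hx : IsCadlag x) (T : ℝ≥0) : IsCadlag (stopAt x T) := by
  intro t
  constructor
  · have hm : MapsTo (fun s : ℝ≥0 => min s T) (Ici t) (Ici (min t T)) :=
      fun s hs => min_le_min_right T hs
    exact ((hx (min t T)).1).comp (f := fun s : ℝ≥0 => min s T)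
      (by fun_prop) hm
  · rcases le_or_gt t T with h | h
    · obtain ⟨l, hl⟩ := (hx t).2
      refine ⟨l, hl.congr' ?_⟩
      filter_upwards [self_mem_nhdsWithin] with s hs
      simp [Reinsurance.stopAt, min_eq_left ((le_of_lt hs).trans h)]
    · refine ⟨x T, tendsto_const_nhds.congr' ?_⟩
      filter_upwards [Ioo_mem_nhdsLT h] with s hs
      simp [Reinsurance.stopAt, min_eq_right hs.1.le]


/-- Time 0 carries no jump, so sums over `[0,t]` become sums over `(0,t]`, which subtract to sums
over `(a,b]`. -/
theorem hasSum_subtype_Iic_iff {f : ℝ≥0 → ℝ} (hf : f 0 = 0) {t : ℝ≥0} {c : ℝ} :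
    HasSum (fun s : Iic t => f s) c ↔ HasSum (indicator (Ioc 0 t) f) c := by
  have : indicator (Ioc 0 t) f = indicator (Iic t) f := by
    ext s
    rcases eq_or_ne s 0 with rfl | hs
    · simp [hf]
    · simp [indicator_apply, pos_iff_ne_zero.2 hs]
  rw [this, ← hasSum_subtype_iff_indicator]
  rfl

theorem indicator_Ioc_eq_sub (f : ℝ≥0 → ℝ) {a b : ℝ≥0} (hab : a ≤ b) :
    indicator (Ioc a b) f = fun s => indicator (Ioc 0 b) f s - indicator (Ioc 0 a) f s := by
  ext s
  simp only [indicator_apply, mem_Ioc]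
  by_cases h0 : 0 < s <;> by_cases h1 : s ≤ a
  · simp [h0, h1, h1.trans hab, not_lt.2 h1]
  · simp [h0, h1, not_le.1 h1]
  · simp [h0, h1, h1.trans hab, not_lt.2 h1]
  · exact absurd (pos_of_gt (not_le.1 h1)) h0

theorem IsIncreasingPureJump.hasSum_Ioc {x : ℝ≥0 → ℝ} (hx : IsIncreasingPureJump x) {a b : ℝ≥0}
    (hab : a ≤ b) : HasSum (indicator (Ioc a b) (jump x)) (x b - x a) := by
  have hb := (hasSum_subtype_Iic_iff (jump_zero x)).1 (hx.hasSum_jump b)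
  have ha := (hasSum_subtype_Iic_iff (jump_zero x)).1 (hx.hasSum_jump a)
  rw [← sub_sub_sub_cancel_right (x b) (x a) (x 0), indicator_Ioc_eq_sub (jump x) hab]
  exact hb.sub ha

theorem IsIncreasingPureJump.summable_Ioc {x : ℝ≥0 → ℝ} (hx : IsIncreasingPureJump x)
    (a b : ℝ≥0) : Summable (indicator (Ioc a b) (jump x)) := by
  rcases le_total a b with h | h
  · exact (hx.hasSum_Ioc h).summable
  · simp [h, summable_zero]

theorem tsum_Ioc_nonneg_le {x : ℝ≥0 → ℝ} (hx : IsIncreasingPureJump x) {j : ℝ≥0 → ℝ}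
    (hj : ∀ s, 0 ≤ j s ∧ j s ≤ jump x s) {a b : ℝ≥0} (hab : a ≤ b) :
    Summable (indicator (Ioc a b) j) ∧ 0 ≤ ∑' s, indicator (Ioc a b) j s ∧
      ∑' s, indicator (Ioc a b) j s ≤ x b - x a := by
  have h0 : ∀ s, 0 ≤ indicator (Ioc a b) j s := fun s => indicator_nonneg (fun s _ => (hj s).1) s
  have h1 : ∀ s, indicator (Ioc a b) j s ≤ indicator (Ioc a b) (jump x) s :=
    fun s => indicator_le_indicator (hj s).2
  have hs := Summable.of_nonneg_of_le h0 h1 (hx.summable_Ioc a b)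
  refine ⟨hs, tsum_nonneg h0, ?_⟩
  rw [← (hx.hasSum_Ioc hab).tsum_eq]
  exact hs.tsum_le_tsum h1 (hx.summable_Ioc a b)

/-- The pure-jump path with the jumps `j`. -/
def jumpSum (j : ℝ≥0 → ℝ) (t : ℝ≥0) : ℝ := ∑' s, indicator (Ioc 0 t) j s

section JumpSum

variable {x j : ℝ≥0 → ℝ}

theorem jumpSum_sub (hx : IsIncreasingPureJump x) (hj : ∀ s, 0 ≤ j s ∧ j s ≤ jump x s)
    {a b : ℝ≥0} (hab : a ≤ b) :
    jumpSum j b - jumpSum j a = ∑' s, indicator (Ioc a b) j s := by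
  have ha := (tsum_Ioc_nonneg_le hx hj (zero_le (a := a))).1
  have hb := (tsum_Ioc_nonneg_le hx hj (zero_le (a := b))).1
  rw [jumpSum, jumpSum, ← hb.tsum_sub ha, indicator_Ioc_eq_sub j hab]

theorem jumpSum_sub_mem (hx : IsIncreasingPureJump x) (hj : ∀ s, 0 ≤ j s ∧ j s ≤ jump x s)
    {a b : ℝ≥0} (hab : a ≤ b) :
    0 ≤ jumpSum j b - jumpSum j a ∧ jumpSum j b - jumpSum j a ≤ x b - x a := by
  rw [jumpSum_sub hx hj hab]
  exact (tsum_Ioc_nonneg_le hx hj hab).2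

theorem jumpSum_mono (hx : IsIncreasingPureJump x) (hj : ∀ s, 0 ≤ j s ∧ j s ≤ jump x s) :
    Monotone (jumpSum j) :=
  fun _ _ hab => sub_nonneg.1 (jumpSum_sub_mem hx hj hab).1

theorem jumpSum_zero (j : ℝ≥0 → ℝ) : jumpSum j 0 = 0 := by simp [jumpSum]

/-- After removing the jump at `t`, the increment over `(s,t]` is squeezed between 0 and the same
quantity for `x`, which vanishes as `s` increases to `t`. -/
theorem jumpSum_leftLim (hx : IsIncreasingPureJump x) (hj : ∀ s, 0 ≤ j s ∧ j s ≤ jump x s)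
    (t : ℝ≥0) : Tendsto (jumpSum j) (𝓝[<] t) (𝓝 (jumpSum j t - j t)) := by
  have key : ∀ s < t, 0 ≤ jumpSum j t - jumpSum j s - j t ∧
      jumpSum j t - jumpSum j s - j t ≤ x t - x s - jump x t := by
    intro s hs
    rw [jumpSum_sub hx hj hs.le, ← (hx.hasSum_Ioc hs.le).tsum_eq]
    have h1 := (tsum_Ioc_nonneg_le hx hj hs.le).1
    have h2 := hx.summable_Ioc s t
    rw [h1.tsum_eq_add_tsum_ite t, h2.tsum_eq_add_tsum_ite t]
    have ht' : t ∈ Ioc s t := ⟨hs, le_rfl⟩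
    have e1 : indicator (Ioc s t) j t = j t := indicator_of_mem ht' _
    have e2 : indicator (Ioc s t) (jump x) t = jump x t := indicator_of_mem ht' _
    rw [e1, e2, add_sub_cancel_left, add_sub_cancel_left]
    have n1 : ∀ r, 0 ≤ (if r = t then 0 else indicator (Ioc s t) j r) := fun r => by
      split_ifs
      · exact le_rfl
      · exact indicator_nonneg (fun s _ => (hj s).1) r
    have n2 : ∀ r, (if r = t then 0 else indicator (Ioc s t) j r) ≤
        (if r = t then 0 else indicator (Ioc s t) (jump x) r) := fun r => by
      split_ifs
      · exact le_rfl
      · exact indicator_le_indicator (hj r).2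
    have s2 : Summable fun r => (if r = t then 0 else indicator (Ioc s t) (jump x) r) := by
      refine h2.of_nonneg_of_le (fun r => (n1 r).trans (n2 r)) fun r => ?_
      split_ifs
      · exact indicator_nonneg (fun s _ => (hj s).1.trans (hj s).2) r
      · exact le_rfl
    exact ⟨tsum_nonneg n1, (s2.of_nonneg_of_le n1 n2).tsum_le_tsum n2 s2⟩
  have h1 : Tendsto (fun s => x t - x s - jump x t) (𝓝[<] t) (𝓝 0) := by
    have := ((hx.cadlag.tendsto_leftLim t).const_sub (x t)).sub_const (jump x t)
    simpa [jump] using this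
  have h2 : Tendsto (fun s => jumpSum j t - jumpSum j s - j t) (𝓝[<] t) (𝓝 0) := by
    refine squeeze_zero' ?_ ?_ h1
    · filter_upwards [self_mem_nhdsWithin] with s hs using (key s hs).1
    · filter_upwards [self_mem_nhdsWithin] with s hs using (key s hs).2
  have := h2.const_sub (jumpSum j t - j t)
  simpa using this

theorem jump_jumpSum (hx : IsIncreasingPureJump x) (hj : ∀ s, 0 ≤ j s ∧ j s ≤ jump x s)
    (t : ℝ≥0) : jump (jumpSum j) t = j t := by
  rcases eq_or_ne t 0 with rfl | ht
  · rw [jump_zero]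
    exact le_antisymm (hj 0).1 ((hj 0).2.trans_eq (jump_zero x))
  · have := nhdsLT_neBot_of_pos (pos_iff_ne_zero.2 ht)
    rw [jump, leftLim_eq_of_tendsto (jumpSum_leftLim hx hj t), sub_sub_cancel]

theorem jumpSum_right (hx : IsIncreasingPureJump x) (hj : ∀ s, 0 ≤ j s ∧ j s ≤ jump x s)
    (t : ℝ≥0) : ContinuousWithinAt (jumpSum j) (Ici t) t := by
  have h1 : Tendsto (fun s => x s - x t) (𝓝[≥] t) (𝓝 0) := by
    have : Tendsto x (𝓝[≥] t) (𝓝 (x t)) := (hx.cadlag t).1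
    simpa using this.sub_const (x t)
  have h2 : Tendsto (fun s => jumpSum j s - jumpSum j t) (𝓝[≥] t) (𝓝 0) := by
    refine squeeze_zero' ?_ ?_ h1
    · filter_upwards [self_mem_nhdsWithin] with s hs using (jumpSum_sub_mem hx hj hs).1
    · filter_upwards [self_mem_nhdsWithin] with s hs using (jumpSum_sub_mem hx hj hs).2
  have := h2.add_const (jumpSum j t)
  simpa [ContinuousWithinAt] using this

theorem isCadlag_of_monotone {x : ℝ≥0 → ℝ} (hx : Monotone x)
    (h : ∀ t, ContinuousWithinAt x (Ici t) t) : IsCadlag x :=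
  fun t => ⟨h t, _, hx.tendsto_leftLim t⟩

theorem jumpSum_isIncreasingPureJump (hx : IsIncreasingPureJump x)
    (hj : ∀ s, 0 ≤ j s ∧ j s ≤ jump x s) : IsIncreasingPureJump (jumpSum j) where
  mono := jumpSum_mono hx hj
  cadlag := isCadlag_of_monotone (jumpSum_mono hx hj) (jumpSum_right hx hj)
  hasSum_jump t := by
    rw [hasSum_subtype_Iic_iff (jump_zero _), jumpSum_zero, sub_zero]
    have : jump (jumpSum j) = j := funext (jump_jumpSum hx hj)
    rw [this]
    exact (tsum_Ioc_nonneg_le hx hj (zero_le (a := t))).1.hasSum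

end JumpSum

theorem IsIncreasingPureJump.stopAt {x : ℝ≥0 → ℝ} (hx : IsIncreasingPureJump x) (T : ℝ≥0) :
    IsIncreasingPureJump (stopAt x T) where
  mono _ _ h := hx.mono (min_le_min_right T h)
  cadlag := hx.cadlag.stopAt T
  hasSum_jump t := by
    rw [hasSum_subtype_Iic_iff (jump_zero _)]
    have := hx.hasSum_Ioc (zero_le (a := min t T))
    convert this using 1
    · ext s
      simp only [indicator_apply, mem_Ioc, le_min_iff]
      by_cases h : s ≤ T
      · simp [h, jump_stopAt_of_le x h]
      · simp [h, jump_stopAt_of_lt x (not_le.1 h)]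
    · simp [Reinsurance.stopAt]

/-- The Stieltjes measure of `f` has the jumps as atoms, and finitely many atoms in `(a,b]` weigh no
more than `(a,b]`. The path may also have a continuous part, hence only an inequality. -/
theorem le_sub_of_hasSum_jump {f : ℝ≥0 → ℝ} (hf : Monotone f)
    (hr : ∀ t, ContinuousWithinAt f (Ici t) t) {a b : ℝ≥0} (hab : a ≤ b) {c : ℝ}
    (hc : HasSum (indicator (Ioc a b) (jump f)) c) : c ≤ f b - f a := by
  refine hasSum_le_of_sum_le hc fun F => ?_
  let g : StieltjesFunction ℝ≥0 := ⟨f, hf, hr⟩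
  have h1 : ∑ s ∈ F, indicator (Ioc a b) (jump f) s = ∑ s ∈ F with s ∈ Ioc a b, jump f s := by
    simp only [Finset.sum_filter, indicator_apply]
  have h2 : ∑ s ∈ F with s ∈ Ioc a b, ENNReal.ofReal (jump f s) ≤ ENNReal.ofReal (f b - f a) := by
    have : ∀ s, ENNReal.ofReal (jump f s) = g.measure {s} := fun s => (g.measure_singleton s).symm
    simp_rw [this]
    rw [sum_measure_singleton, ← g.measure_Ioc a b]
    refine measure_mono fun s hs => ?_
    simp only [Finset.coe_filter, mem_ofPred_eq] at hs
    exact hs.2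
  rw [h1, ← ENNReal.ofReal_le_ofReal_iff (sub_nonneg.2 (hf hab)),
    ENNReal.ofReal_sum_of_nonneg fun s _ => jump_nonneg hf s]
  exact h2

/-! ### Limits along partitions -/

/-- The `i`-th point of the partition of `[0, t]` into `n + 1` intervals of equal length. -/
def grid (t : ℝ≥0) (n i : ℕ) : ℝ≥0 := t * i / (n + 1)

theorem grid_mono (t : ℝ≥0) (n : ℕ) : Monotone (grid t n) := fun i j h => by
  unfold grid
  gcongr

theorem grid_zero (t : ℝ≥0) (n : ℕ) : grid t n 0 = 0 := by simp [grid]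

theorem grid_last (t : ℝ≥0) (n : ℕ) : grid t n (n + 1) = t := by
  unfold grid
  push_cast
  exact mul_div_cancel_right₀ t (by positivity)

theorem grid_succ (t : ℝ≥0) (n i : ℕ) : grid t n (i + 1) = grid t n i + t / (n + 1) := by
  unfold grid
  push_cast
  ring

theorem grid_le (t : ℝ≥0) {n i : ℕ} (hi : i ≤ n + 1) : grid t n i ≤ t :=
  (grid_mono t n hi).trans_eq (grid_last t n)

theorem exists_mem_Ioc_grid {t s : ℝ≥0} (hs : s ∈ Ioc 0 t) (n : ℕ) :
    ∃ i ≤ n, s ∈ Ioc (grid t n i) (grid t n (i + 1)) := by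
  have hex : ∃ i, s ≤ grid t n i := ⟨n + 1, hs.2.trans_eq (grid_last t n).symm⟩
  classical
  have h1 := Nat.find_spec hex
  have h0 : Nat.find hex ≠ 0 := by
    intro h
    rw [h, grid_zero] at h1
    exact not_lt.2 h1 hs.1
  obtain ⟨i, hi⟩ := Nat.exists_eq_succ_of_ne_zero h0
  refine ⟨i, ?_, ?_, ?_⟩
  · have : Nat.find hex ≤ n + 1 := Nat.find_min' hex (hs.2.trans_eq (grid_last t n).symm)
    omega
  · exact not_le.1 (Nat.find_min hex (by omega))
  · rwa [hi] at h1

theorem tendsto_div_add_one (t : ℝ≥0) : Tendsto (fun n : ℕ => t / ((n : ℝ≥0) + 1)) atTop (𝓝 0) := by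
  have := (tendsto_one_div_add_atTop_nhds_zero_nat (𝕜 := ℝ)).const_mul (t : ℝ)
  rw [mul_zero] at this
  rw [← NNReal.tendsto_coe, NNReal.coe_zero]
  refine this.congr fun n => ?_
  push_cast
  ring

/-- Cells are half-open on the left: the left end stays strictly below `s` and picks up the left
limit of a càdlàg path, while the right end picks up its value. -/
theorem tendsto_grid_cell {t s : ℝ≥0} {i : ℕ → ℕ}
    (hi : ∀ n, s ∈ Ioc (grid t n (i n)) (grid t n (i n + 1))) :
    Tendsto (fun n => (grid t n (i n), grid t n (i n + 1))) atTop (𝓝[<] s ×ˢ 𝓝[≥] s) := by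
  have h0 := tendsto_div_add_one t
  have hl : Tendsto (fun n => grid t n (i n)) atTop (𝓝 s) := by
    refine tendsto_of_tendsto_of_tendsto_of_le_of_le (g := fun n : ℕ => s - t / ((n : ℝ≥0) + 1))
      ?_ tendsto_const_nhds (fun n => ?_) fun n => (hi n).1.le
    · simpa using (tendsto_const_nhds (x := s)).sub h0
    · rw [tsub_le_iff_right, ← grid_succ]
      exact (hi n).2
  have hr : Tendsto (fun n => grid t n (i n + 1)) atTop (𝓝 s) := by
    simp_rw [grid_succ]
    simpa using hl.add h0
  exact (tendsto_nhdsWithin_iff.2 ⟨hl, Eventually.of_forall fun n => (hi n).1⟩).prodMk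
    (tendsto_nhdsWithin_iff.2 ⟨hr, Eventually.of_forall fun n => (hi n).2⟩)

/-- Sums of a two-point function, dominated by the increments of a pure-jump path, along refining
partitions converge to the sum of the limits at the jumps. -/
theorem tendsto_sum_grid {y : ℝ≥0 → ℝ} (hy : IsIncreasingPureJump y) {t : ℝ≥0} {C : ℝ}
    {φ : ℝ≥0 → ℝ≥0 → ℝ} (hφ : ∀ l r, l ≤ r → r ≤ t → |φ l r| ≤ C * (y r - y l)) {b : ℝ≥0 → ℝ}
    (hb : ∀ s ∈ Ioc 0 t, Tendsto (fun p : ℝ≥0 × ℝ≥0 => φ p.1 p.2) (𝓝[<] s ×ˢ 𝓝[≥] s) (𝓝 (b s))) :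
    Tendsto (fun n : ℕ => ∑ i ∈ Finset.range (n + 1), φ (grid t n i) (grid t n (i + 1))) atTop
      (𝓝 (∑' s, indicator (Ioc 0 t) b s)) := by
  -- Each `φ` is spread over the jumps of `y` in its cell in proportion to their size. The grid sum
  -- becomes a series over times dominated by `C * jump y`, so dominated convergence for series
  -- applies. If the increment of `y` is zero, the bound forces `φ = 0` and the default value of the
  -- quotient is harmless.
  let c : ℕ → ℕ → ℝ := fun n i => φ (grid t n i) (grid t n (i + 1)) /
    (y (grid t n (i + 1)) - y (grid t n i))
  let g : ℕ → ℝ≥0 → ℝ := fun n s => ∑ i ∈ Finset.range (n + 1),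
    c n i * indicator (Ioc (grid t n i) (grid t n (i + 1))) (jump y) s
  have hstep : ∀ n i, grid t n i ≤ grid t n (i + 1) := fun n i => grid_mono t n (Nat.le_succ i)
  have hg : ∀ n, ∑' s, g n s = ∑ i ∈ Finset.range (n + 1), φ (grid t n i) (grid t n (i + 1)) := by
    intro n
    refine (hasSum_sum fun i hi => ?_).tsum_eq
    suffices h : φ (grid t n i) (grid t n (i + 1)) =
        c n i * (y (grid t n (i + 1)) - y (grid t n i)) by
      rw [h]
      exact (hy.hasSum_Ioc (hstep n i)).mul_left (c n i)
    simp only [c]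
    by_cases h0 : y (grid t n (i + 1)) - y (grid t n i) = 0
    · have h1 := hφ _ _ (hstep n i) (grid_le t (by have := Finset.mem_range.1 hi; omega))
      rw [h0, mul_zero] at h1
      rw [abs_nonpos_iff.1 h1]
      simp
    · field_simp
  have hval : ∀ n i s, i ≤ n → s ∈ Ioc (grid t n i) (grid t n (i + 1)) →
      g n s = c n i * jump y s := by
    intro n i s hi hs
    simp only [g]
    rw [Finset.sum_eq_single i, indicator_of_mem hs]
    · intro k _ hk
      have hd := (grid_mono t n).pairwise_disjoint_on_Ioc_succ hk
      rw [indicator_of_notMem, mul_zero]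
      exact fun h => disjoint_left.1 hd h hs
    · intro h
      exact absurd (Finset.mem_range.2 (by omega)) h
  have hout : ∀ n s, s ∉ Ioc 0 t → g n s = 0 := by
    intro n s hs
    refine Finset.sum_eq_zero fun i hi => ?_
    rw [indicator_of_notMem, mul_zero]
    intro h
    exact hs ⟨pos_of_gt h.1, h.2.trans (grid_le t (by have := Finset.mem_range.1 hi; omega))⟩
  simp_rw [← hg]
  refine tendsto_tsum_of_dominated_convergence
    (bound := fun s => C * indicator (Ioc 0 t) (jump y) s)
    ((hy.summable_Ioc 0 t).mul_left C) ?_ ?_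
  · intro s
    by_cases hs : s ∈ Ioc 0 t
    · choose i hi hmem using exists_mem_Ioc_grid hs
      have hlim := tendsto_grid_cell hmem
      have h1 := (hb s hs).comp hlim
      have h2 : Tendsto (fun n => y (grid t n (i n + 1)) - y (grid t n (i n))) atTop
          (𝓝 (jump y s)) := by
        have hl := (hy.cadlag.tendsto_leftLim s).comp (tendsto_fst.comp hlim)
        have hr := ((hy.cadlag s).1.tendsto).comp (tendsto_snd.comp hlim)
        exact hr.sub hl
      rw [indicator_of_mem hs]
      have h3 : ∀ n, g n s = c n (i n) * jump y s := fun n => hval n _ s (hi n) (hmem n)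
      simp_rw [h3]
      -- The ratio need not converge where `y` has no jump, but there the bound on `φ` forces `b s =
      -- 0`.
      by_cases hj : jump y s = 0
      · have hb0 : b s = 0 := by
          refine tendsto_nhds_unique h1 ?_
          refine squeeze_zero_norm (a := fun n => C * (y (grid t n (i n + 1)) - y (grid t n (i n))))
            (fun n => ?_) ?_
          · exact hφ _ _ (hstep n _) (grid_le t (by have := hi n; omega))
          · simpa [hj] using h2.const_mul C
        simp [hj, hb0]
      · have := (h1.div h2 hj).mul_const (jump y s)
        rwa [div_mul_cancel₀ _ hj] at this
    · simp_rw [hout _ s hs, indicator_of_notMem hs]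
      exact tendsto_const_nhds
  · refine Eventually.of_forall fun n s => ?_
    by_cases hs : s ∈ Ioc 0 t
    · obtain ⟨i, hi, hmem⟩ := exists_mem_Ioc_grid hs n
      rw [hval n i s hi hmem, indicator_of_mem hs, norm_mul, Real.norm_eq_abs, Real.norm_eq_abs,
        abs_of_nonneg (jump_nonneg hy.mono s)]
      have h1 := hφ _ _ (hstep n i) (grid_le t (by omega : i + 1 ≤ n + 1))
      have h0 := sub_nonneg.2 (hy.mono (hstep n i))
      have hj := jump_nonneg hy.mono s
      rcases h0.eq_or_lt with h | h
      · have : jump y s = 0 := le_antisymm (by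
          have := jump_le_sub hy.mono hmem.1
          have := hy.mono hmem.2
          linarith) hj
        simp [this]
      · refine mul_le_mul_of_nonneg_right ?_ hj
        rw [abs_div, abs_of_pos h, div_le_iff₀ h]
        exact h1
    · rw [hout n s hs, indicator_of_notMem hs]
      simp


/-! ### The Doob–Meyer decomposition of a function of a pure-jump path -/

/-- Continuous functions `k t y`, non-decreasing in time, non-increasing and 1-Lipschitz in
space. -/
structure IsValueFunction (k : ℝ≥0 → ℝ → ℝ) : Prop where
  mono : ∀ y, Monotone fun t => k t y
  continuous : ∀ y, Continuous fun t => k t y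
  space : ∀ t y y', y ≤ y' → 0 ≤ k t y - k t y' ∧ k t y - k t y' ≤ y' - y

/-- The decrease of `k` caused by the jump of `y` at time `s`. -/
def valueJump (k : ℝ≥0 → ℝ → ℝ) (y : ℝ≥0 → ℝ) (s : ℝ≥0) : ℝ :=
  k s (Function.leftLim y s) - k s (y s)

/-- The continuous part of `t ↦ k t (y t) - k 0 (y 0)`. -/
def valueDrift (k : ℝ≥0 → ℝ → ℝ) (y : ℝ≥0 → ℝ) (t : ℝ≥0) : ℝ :=
  k t (y t) - k 0 (y 0) + jumpSum (valueJump k y) t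

namespace IsValueFunction

variable {k : ℝ≥0 → ℝ → ℝ} (hk : IsValueFunction k) {y : ℝ≥0 → ℝ}

include hk in
theorem abs_sub_le (t : ℝ≥0) (a b : ℝ) : |k t a - k t b| ≤ |a - b| := by
  rcases le_total a b with h | h
  · rw [abs_of_nonneg (hk.space t a b h).1, abs_sub_comm, abs_of_nonneg (sub_nonneg.2 h)]
    exact (hk.space t a b h).2
  · rw [abs_sub_comm, abs_of_nonneg (hk.space t b a h).1, abs_of_nonneg (sub_nonneg.2 h)]
    exact (hk.space t b a h).2

include hk in
-- Joint continuity: the Lipschitz bound in space is uniform in time, so continuity in time at the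
-- fixed point `a` suffices.
theorem tendsto {α : Type*} {l : Filter α} {τ : α → ℝ≥0} {η : α → ℝ} {t : ℝ≥0} {a : ℝ}
    (hτ : Tendsto τ l (𝓝 t)) (hη : Tendsto η l (𝓝 a)) :
    Tendsto (fun n => k (τ n) (η n)) l (𝓝 (k t a)) := by
  have h1 : Tendsto (fun n => k (τ n) a) l (𝓝 (k t a)) := ((hk.continuous a).tendsto t).comp hτ
  have h2 : Tendsto (fun n => k (τ n) (η n) - k (τ n) a) l (𝓝 0) := by
    refine squeeze_zero_norm (fun n => hk.abs_sub_le (τ n) (η n) a) ?_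
    simpa using (hη.sub_const a).abs
  simpa using h2.add h1

include hk in
theorem valueJump_mem (hy : IsIncreasingPureJump y) (s : ℝ≥0) :
    0 ≤ valueJump k y s ∧ valueJump k y s ≤ jump y s :=
  hk.space s _ _ (hy.mono.leftLim_le le_rfl)

include hk in
theorem isIncreasingPureJump (hy : IsIncreasingPureJump y) :
    IsIncreasingPureJump (jumpSum (valueJump k y)) :=
  jumpSum_isIncreasingPureJump hy (hk.valueJump_mem hy)

include hk in
-- As `k` is continuous in time, `k t (y t)` jumps only with `y`, by `-valueJump k y t`, and the
-- added jump sum cancels exactly this.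
theorem continuous_valueDrift (hy : IsIncreasingPureJump y) : Continuous (valueDrift k y) := by
  refine continuous_iff_continuousAt.2 fun t => ?_
  rw [continuousAt_iff_continuous_left'_right']
  constructor
  · have h1 : Tendsto (fun s => k s (y s)) (𝓝[<] t) (𝓝 (k t (Function.leftLim y t))) :=
      hk.tendsto nhdsWithin_le_nhds (hy.cadlag.tendsto_leftLim t)
    have h2 := jumpSum_leftLim hy (hk.valueJump_mem hy) t
    have := (h1.sub_const (k 0 (y 0))).add h2
    rwa [show k t (Function.leftLim y t) - k 0 (y 0) +
      (jumpSum (valueJump k y) t - valueJump k y t) = valueDrift k y t by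
        simp only [valueDrift, valueJump]; ring] at this
  · have h1 : Tendsto (fun s => k s (y s)) (𝓝[>] t) (𝓝 (k t (y t))) :=
      hk.tendsto nhdsWithin_le_nhds ((hy.cadlag t).1.mono Ioi_subset_Ici_self)
    have h2 := (jumpSum_right hy (hk.valueJump_mem hy) t).mono Ioi_subset_Ici_self
    exact (h1.sub_const (k 0 (y 0))).add h2

include hk in
-- Adding `y` gives a monotone path `f`, because `k` decreases in space at most at rate 1. The drift
-- is continuous, so `f` has the jumps of `y`, and these already sum to the whole increment of the
-- pure-jump path `y`. Hence `f` grows at least as much as `y`, and the drift cannot decrease.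
theorem monotone_valueDrift (hy : IsIncreasingPureJump y) : Monotone (valueDrift k y) := by
  intro a b hab
  have hcont := hk.continuous_valueDrift hy
  let f : ℝ≥0 → ℝ := fun t => valueDrift k y t + y t
  have hf : Monotone f := by
    intro a b hab
    have h1 := hk.mono (y b) hab
    have h2 := (hk.space a _ _ (hy.mono hab)).2
    have h3 := jumpSum_mono hy (hk.valueJump_mem hy) hab
    simp only [f, valueDrift] at *
    linarith
  have hr : ∀ t, ContinuousWithinAt f (Ici t) t := fun t =>
    hcont.continuousWithinAt.add (hy.cadlag t).1
  have hj : jump f = jump y := by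
    ext t
    rcases eq_or_ne t 0 with rfl | ht
    · rw [jump_zero, jump_zero]
    · have := nhdsLT_neBot_of_pos (pos_iff_ne_zero.2 ht)
      have h1 : Tendsto f (𝓝[<] t) (𝓝 (valueDrift k y t + Function.leftLim y t)) :=
        (hcont.continuousWithinAt.tendsto).add (hy.cadlag.tendsto_leftLim t)
      rw [jump, leftLim_eq_of_tendsto h1, jump]
      simp [f]
  have := le_sub_of_hasSum_jump hf hr hab (c := y b - y a) (by rw [hj]; exact hy.hasSum_Ioc hab)
  simp only [f] at this
  linarith

include hk in
-- Writes the jump sum as a limit of functions of `y` at finitely many times up to `t`; this is how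
-- the retained claims are shown to be adapted.
theorem tendsto_jumpSum (hy : IsIncreasingPureJump y) (t : ℝ≥0) :
    Tendsto (fun n : ℕ => ∑ i ∈ Finset.range (n + 1), (k (grid t n (i + 1)) (y (grid t n i)) -
      k (grid t n (i + 1)) (y (grid t n (i + 1))))) atTop (𝓝 (jumpSum (valueJump k y) t)) := by
  refine tendsto_sum_grid (C := 1) (φ := fun l r => k r (y l) - k r (y r)) hy
    (fun l r hlr _ => ?_) fun s _ => ?_
  · have := hk.space r _ _ (hy.mono hlr)
    rw [abs_of_nonneg this.1, one_mul]
    exact this.2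
  · have hr : Tendsto (fun p : ℝ≥0 × ℝ≥0 => p.2) (𝓝[<] s ×ˢ 𝓝[≥] s) (𝓝 s) :=
      tendsto_snd.mono_right nhdsWithin_le_nhds
    exact (hk.tendsto hr ((hy.cadlag.tendsto_leftLim s).comp tendsto_fst)).sub
      (hk.tendsto hr ((hy.cadlag s).1.tendsto.comp tendsto_snd))

end IsValueFunction

/-! ### Quadratic variation -/

theorem sum_grid_sub (p : ℝ≥0 → ℝ) (t : ℝ≥0) (n : ℕ) :
    ∑ i ∈ Finset.range (n + 1), (p (grid t n (i + 1)) - p (grid t n i)) = p t - p 0 := by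
  rw [Finset.sum_range_sub (fun i => p (grid t n i)), grid_zero, grid_last]

/-- A bound independent of the partition, which serves as the dominating function for the quadratic
sums. Each square is at most its own increment of `v` times the total increment. -/
theorem sum_sq_grid_le {v : ℝ≥0 → ℝ} (hv : Monotone v) {t : ℝ≥0} {ψ : ℝ≥0 → ℝ≥0 → ℝ}
    (hψ : ∀ l r, l ≤ r → r ≤ t → |ψ l r| ≤ v r - v l) (n : ℕ) :
    ∑ i ∈ Finset.range (n + 1), ψ (grid t n i) (grid t n (i + 1)) ^ 2 ≤ (v t - v 0) ^ 2 := by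
  rw [sq (v t - v 0), ← sum_grid_sub v t n, Finset.sum_mul]
  rw [sum_grid_sub v t n]
  refine Finset.sum_le_sum fun i hi => ?_
  have hi' : i + 1 ≤ n + 1 := by have := Finset.mem_range.1 hi; omega
  have hs : grid t n i ≤ grid t n (i + 1) := grid_mono t n (Nat.le_succ i)
  have h1 := hψ _ _ hs (grid_le t hi')
  have h2 : v (grid t n (i + 1)) - v (grid t n i) ≤ v t - v 0 :=
    sub_le_sub (hv (grid_le t hi')) (hv zero_le)
  rw [← sq_abs, sq]
  exact mul_le_mul h1 (h1.trans h2) (abs_nonneg _) ((abs_nonneg _).trans h1)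

/-- By uniform continuity, one factor of each square is uniformly small, while the other factors sum
to at most the increment of `v`. -/
theorem tendsto_sum_sq_continuous {c v : ℝ≥0 → ℝ} (hc : Continuous c) {t : ℝ≥0}
    (hcv : ∀ l r, l ≤ r → r ≤ t → |c r - c l| ≤ v r - v l) :
    Tendsto (fun n : ℕ => ∑ i ∈ Finset.range (n + 1),
      (c (grid t n (i + 1)) - c (grid t n i)) ^ 2) atTop (𝓝 0) := by
  have hV : 0 ≤ v t - v 0 := (abs_nonneg _).trans (hcv 0 t zero_le le_rfl)
  have huc := isCompact_Icc.uniformContinuousOn_of_continuous (hc.continuousOn (s := Icc 0 t))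
  rw [Metric.uniformContinuousOn_iff] at huc
  rw [Metric.tendsto_atTop]
  intro ε hε
  obtain ⟨δ, hδ, H⟩ := huc (ε / (v t - v 0 + 1)) (by positivity)
  have h0 := tendsto_div_add_one t
  rw [← NNReal.tendsto_coe, NNReal.coe_zero] at h0
  obtain ⟨N, hN⟩ := eventually_atTop.1 (h0.eventually_lt_const hδ)
  refine ⟨N, fun n hn => ?_⟩
  rw [Real.dist_0_eq_abs, abs_of_nonneg (Finset.sum_nonneg fun i _ => sq_nonneg _)]
  calc ∑ i ∈ Finset.range (n + 1), (c (grid t n (i + 1)) - c (grid t n i)) ^ 2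
      ≤ ∑ i ∈ Finset.range (n + 1), ε / (v t - v 0 + 1) *
          (v (grid t n (i + 1)) - v (grid t n i)) := by
        refine Finset.sum_le_sum fun i hi => ?_
        have hi' : i + 1 ≤ n + 1 := by have := Finset.mem_range.1 hi; omega
        have hs : grid t n i ≤ grid t n (i + 1) := grid_mono t n (Nat.le_succ i)
        have h1 := hcv _ _ hs (grid_le t hi')
        have h2 : |c (grid t n (i + 1)) - c (grid t n i)| < ε / (v t - v 0 + 1) := by
          refine H _ ⟨zero_le, grid_le t hi'⟩ _ ⟨zero_le, hs.trans (grid_le t hi')⟩ ?_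
          rw [grid_succ, NNReal.dist_eq]
          push_cast
          rw [add_sub_cancel_left, abs_of_nonneg (by positivity)]
          simpa using hN n hn
        rw [← sq_abs, sq]
        exact mul_le_mul h2.le h1 (abs_nonneg _) (by positivity)
    _ = ε * ((v t - v 0) / (v t - v 0 + 1)) := by
        rw [← Finset.mul_sum, sum_grid_sub]
        ring
    _ < ε * 1 := by
        refine mul_lt_mul_of_pos_left ?_ hε
        rw [div_lt_one (by positivity)]
        linarith
    _ = ε := mul_one ε

section QuadraticVariation

variable {y w p q : ℝ≥0 → ℝ} {T : ℝ≥0}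

/-- Both increments are sums of jumps, so they compare jump by jump. -/
theorem sub_mem_of_jump_le (hy : IsIncreasingPureJump y) (hw : IsIncreasingPureJump w)
    (hj : ∀ s ≤ T, jump w s ≤ jump y s) {l r : ℝ≥0} (hlr : l ≤ r) (hr : r ≤ T) :
    0 ≤ (y r - w r) - (y l - w l) ∧ (y r - w r) - (y l - w l) ≤ y r - y l := by
  have h1 : w r - w l ≤ y r - y l := by
    refine hasSum_le (fun s => ?_) (hw.hasSum_Ioc hlr) (hy.hasSum_Ioc hlr)
    by_cases hs : s ∈ Ioc l r
    · simpa [indicator_of_mem hs] using hj s (hs.2.trans hr)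
    · simp [indicator_of_notMem hs]
  have h2 := hw.mono hlr
  constructor <;> linarith

theorem abs_increment_le (hy : IsIncreasingPureJump y) (hw : IsIncreasingPureJump w)
    (hj : ∀ s ≤ T, jump w s ≤ jump y s) (hp : Monotone p) (hq : Monotone q)
    {l r : ℝ≥0} (hlr : l ≤ r) (hr : r ≤ T) :
    |((p r - y r) - (q r - w r)) - ((p l - y l) - (q l - w l))| ≤
      (y r + p r + q r) - (y l + p l + q l) := by
  have h1 := sub_mem_of_jump_le hy hw hj hlr hr
  have h2 := hp hlr
  have h3 := hq hlr
  rw [abs_le]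
  constructor <;> linarith [h1.1, h1.2]

/-- The quadratic variation of `(p - y) - (q - w)`, with `y`, `w` pure-jump and `p`, `q` continuous,
is the sum of its squared jumps. -/
theorem tendsto_sum_sq (hy : IsIncreasingPureJump y) (hw : IsIncreasingPureJump w)
    (hj : ∀ s ≤ T, jump w s ≤ jump y s) (hp : Monotone p) (hq : Monotone q)
    (hpc : Continuous p) (hqc : Continuous q) :
    Tendsto (fun n : ℕ => ∑ i ∈ Finset.range (n + 1),
      (((p (grid T n (i + 1)) - y (grid T n (i + 1))) -
          (q (grid T n (i + 1)) - w (grid T n (i + 1)))) -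
        ((p (grid T n i) - y (grid T n i)) - (q (grid T n i) - w (grid T n i)))) ^ 2) atTop
      (𝓝 (∑' s, indicator (Ioc 0 T) (fun s => (jump w s - jump y s) ^ 2) s)) := by
  let z : ℝ≥0 → ℝ := fun t => y t - w t
  let c : ℝ≥0 → ℝ := fun t => p t - q t
  have hc : Continuous c := hpc.sub hqc
  have hcv : ∀ l r, l ≤ r → |c r - c l| ≤ (p r + q r) - (p l + q l) := by
    intro l r hlr
    have h2 := hp hlr
    have h3 := hq hlr
    simp only [c]
    rw [abs_le]
    constructor <;> linarith
  -- The squared increment is `(Δz)² - 2 Δz Δc + (Δc)²`. The first two terms contain the factor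
  -- `Δz`, dominated by `Δy`, so the grid limit applies to them; the squares of the continuous part
  -- `c` vanish in the limit.
  have h1 := tendsto_sum_grid (b := fun s => (jump w s - jump y s) ^ 2) (t := T)
    (φ := fun l r => (z r - z l) ^ 2 - 2 * (z r - z l) * (c r - c l))
    (C := (y T - y 0) + 2 * ((p T + q T) - (p 0 + q 0))) hy ?_ ?_
  · have h2 := h1.add (tendsto_sum_sq_continuous (v := fun t => p t + q t) (t := T) hc
      fun l r hlr _ => hcv l r hlr)
    rw [add_zero] at h2
    refine h2.congr fun n => ?_
    rw [← Finset.sum_add_distrib]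
    refine Finset.sum_congr rfl fun i _ => ?_
    simp only [z, c]
    ring
  · intro l r hlr hr
    have hz := sub_mem_of_jump_le hy hw hj hlr hr
    have hc1 := hcv l r hlr
    have hpq : (p r + q r) - (p l + q l) ≤ (p T + q T) - (p 0 + q 0) := by
      linarith [hp hr, hq hr, hp (zero_le (a := l)), hq (zero_le (a := l))]
    have hyy : y r - y l ≤ y T - y 0 := by
      linarith [hy.mono hr, hy.mono (zero_le (a := l))]
    have e : (z r - z l) ^ 2 - 2 * (z r - z l) * (c r - c l) =
        ((z r - z l) - 2 * (c r - c l)) * (z r - z l) := by ring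
    rw [e, abs_mul, abs_of_nonneg hz.1]
    refine mul_le_mul ?_ hz.2 hz.1 (by linarith [abs_nonneg (c r - c l), hz.1, hz.2])
    have hz1 : |z r - z l| ≤ y r - y l := by rw [abs_of_nonneg hz.1]; exact hz.2
    calc |(z r - z l) - 2 * (c r - c l)| ≤ |z r - z l| + |2 * (c r - c l)| := abs_sub _ _
      _ ≤ _ := by
        rw [abs_mul, abs_two]
        linarith
  · intro s _
    have hl : Tendsto (fun p : ℝ≥0 × ℝ≥0 => p.1) (𝓝[<] s ×ˢ 𝓝[≥] s) (𝓝[<] s) := tendsto_fst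
    have hr : Tendsto (fun p : ℝ≥0 × ℝ≥0 => p.2) (𝓝[<] s ×ˢ 𝓝[≥] s) (𝓝[≥] s) := tendsto_snd
    have hz : Tendsto (fun p : ℝ≥0 × ℝ≥0 => z p.2 - z p.1) (𝓝[<] s ×ˢ 𝓝[≥] s)
        (𝓝 (jump y s - jump w s)) := by
      have a1 := ((hy.cadlag s).1.tendsto.comp hr).sub ((hw.cadlag s).1.tendsto.comp hr)
      have a2 := ((hy.cadlag.tendsto_leftLim s).comp hl).sub ((hw.cadlag.tendsto_leftLim s).comp hl)
      have := a1.sub a2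
      rw [sub_sub_sub_comm] at this
      exact this
    have hcc : Tendsto (fun p : ℝ≥0 × ℝ≥0 => c p.2 - c p.1) (𝓝[<] s ×ˢ 𝓝[≥] s) (𝓝 0) := by
      have a1 := (hc.tendsto s).comp (hr.mono_right nhdsWithin_le_nhds)
      have a2 := (hc.tendsto s).comp (hl.mono_right nhdsWithin_le_nhds)
      simpa using a1.sub a2
    have := (hz.pow 2).sub ((hz.const_mul 2).mul hcc)
    rw [mul_zero, sub_zero] at this
    rw [← neg_sub (jump y s), neg_sq]
    exact this

theorem sum_sq_le (hy : IsIncreasingPureJump y) (hw : IsIncreasingPureJump w)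
    (hj : ∀ s ≤ T, jump w s ≤ jump y s) (hp : Monotone p) (hq : Monotone q) (n : ℕ) :
    ∑ i ∈ Finset.range (n + 1),
      (((p (grid T n (i + 1)) - y (grid T n (i + 1))) -
          (q (grid T n (i + 1)) - w (grid T n (i + 1)))) -
        ((p (grid T n i) - y (grid T n i)) - (q (grid T n i) - w (grid T n i)))) ^ 2 ≤
      ((y T + p T + q T) - (y 0 + p 0 + q 0)) ^ 2 :=
  sum_sq_grid_le (v := fun t => y t + p t + q t) ((hy.mono.add hp).add hq)
    (ψ := fun l r => ((p r - y r) - (q r - w r)) - ((p l - y l) - (q l - w l)))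
    (fun _ _ hlr hr => abs_increment_le hy hw hj hp hq hlr hr) n

theorem tsum_ofReal_sq_jump (hy : IsIncreasingPureJump y) (hw : IsIncreasingPureJump w)
    (hj : ∀ s ≤ T, jump w s ≤ jump y s) :
    ∑' t : Iic T, ENNReal.ofReal (|jump w t - jump y t| ^ 2) =
      ENNReal.ofReal (∑' s, indicator (Ioc 0 T) (fun s => (jump w s - jump y s) ^ 2) s) := by
  have hs : Summable (indicator (Ioc 0 T) fun s => (jump w s - jump y s) ^ 2) := by
    refine Summable.of_nonneg_of_le (fun s => indicator_nonneg (fun _ _ => sq_nonneg _) s)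
      (fun s => ?_) ((hy.summable_Ioc 0 T).mul_left (y T - y 0))
    by_cases hs : s ∈ Ioc 0 T
    · rw [indicator_of_mem hs, indicator_of_mem hs]
      have h1 := jump_nonneg hw.mono s
      have h2 := hj s hs.2
      have h3 : jump y s ≤ y T - y 0 :=
        (jump_le_sub hy.mono hs.1).trans (sub_le_sub_right (hy.mono hs.2) _)
      nlinarith
    · simp [indicator_of_notMem hs]
  rw [ENNReal.ofReal_tsum_of_nonneg (fun s => indicator_nonneg (fun _ _ => sq_nonneg _) s) hs]
  rw [tsum_subtype (Iic T) fun s => ENNReal.ofReal (|jump w s - jump y s| ^ 2)]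
  refine tsum_congr fun s => ?_
  rcases eq_or_ne s 0 with rfl | h0
  · simp [jump_zero]
  · by_cases h1 : s ≤ T
    · have : s ∈ Ioc 0 T := ⟨pos_iff_ne_zero.2 h0, h1⟩
      rw [indicator_of_mem this, indicator_of_mem (show s ∈ Iic T from h1), sq_abs]
    · simp [h1]

end QuadraticVariation


/-! ### The measure of an increasing path -/

/-- Non-decreasing right-continuous paths. -/
def IsIncreasingPath (x : ℝ≥0 → ℝ) : Prop :=
  Monotone x ∧ ∀ t, ContinuousWithinAt x (Ici t) t

open Classical in
/-- The measure with distribution function `x` stopped at `T`. -/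
def pathMeasure (T : ℝ≥0) (x : ℝ≥0 → ℝ) : Measure ℝ≥0 :=
  if h : IsIncreasingPath (stopAt x T) then (StieltjesFunction.mk (stopAt x T) h.1 h.2).measure
  else 0

theorem IsIncreasingPath.stopAt {x : ℝ≥0 → ℝ} (hx : IsIncreasingPath x) (T : ℝ≥0) :
    IsIncreasingPath (stopAt x T) :=
  ⟨fun _ _ h => hx.1 (min_le_min_right T h),
    fun t => ((isCadlag_of_monotone hx.1 hx.2).stopAt T t).1⟩

theorem IsIncreasingPureJump.isIncreasingPath {x : ℝ≥0 → ℝ} (hx : IsIncreasingPureJump x) :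
    IsIncreasingPath x :=
  ⟨hx.mono, fun t => (hx.cadlag t).1⟩

section PathMeasure

variable {T : ℝ≥0} {x : ℝ≥0 → ℝ}

theorem tendsto_stopAt_atTop (T : ℝ≥0) (x : ℝ≥0 → ℝ) : Tendsto (stopAt x T) atTop (𝓝 (x T)) := by
  refine tendsto_const_nhds.congr' ?_
  filter_upwards [eventually_ge_atTop T] with t ht
  simp [stopAt, min_eq_right ht]

theorem pathMeasure_univ (hx : IsIncreasingPath (stopAt x T)) :
    pathMeasure T x univ = ENNReal.ofReal (x T - x 0) := by
  rw [pathMeasure, dif_pos hx]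
  refine (StieltjesFunction.mk (stopAt x T) hx.1 hx.2).measure_univ (l := x 0) ?_
    (tendsto_stopAt_atTop T x)
  rw [atBot_eq_pure_of_isBot (fun _ => zero_le : IsBot (0 : ℝ≥0))]
  simpa [stopAt] using tendsto_pure_nhds (stopAt x T) 0

theorem pathMeasure_Ioi (hx : IsIncreasingPath (stopAt x T)) (s : ℝ≥0) :
    pathMeasure T x (Ioi s) = ENNReal.ofReal (x T - x (min s T)) := by
  rw [pathMeasure, dif_pos hx]
  exact (StieltjesFunction.mk (stopAt x T) hx.1 hx.2).measure_Ioi (tendsto_stopAt_atTop T x) s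

theorem pathMeasure_singleton (hx : IsIncreasingPath (stopAt x T)) (s : ℝ≥0) :
    pathMeasure T x {s} = ENNReal.ofReal (jump (stopAt x T) s) := by
  rw [pathMeasure, dif_pos hx]
  exact (StieltjesFunction.mk (stopAt x T) hx.1 hx.2).measure_singleton s

instance isFiniteMeasure_pathMeasure (T : ℝ≥0) (x : ℝ≥0 → ℝ) :
    IsFiniteMeasure (pathMeasure T x) := by
  by_cases hx : IsIncreasingPath (stopAt x T)
  · exact ⟨by rw [pathMeasure_univ hx]; exact ENNReal.ofReal_lt_top⟩
  · rw [pathMeasure, dif_neg hx]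
    infer_instance

theorem pathMeasure_zero (T : ℝ≥0) (x : ℝ≥0 → ℝ) : pathMeasure T x {0} = 0 := by
  by_cases hx : IsIncreasingPath (stopAt x T)
  · rw [pathMeasure_singleton hx, jump_zero, ENNReal.ofReal_zero]
  · rw [pathMeasure, dif_neg hx]
    rfl

/-- The Stieltjes measure is additive, and `y` is `x` plus an increasing path. -/
theorem pathMeasure_le {y : ℝ≥0 → ℝ} (hx : IsIncreasingPath (stopAt x T))
    (hyx : IsIncreasingPath (stopAt (fun t => y t - x t) T)) :
    pathMeasure T x ≤ pathMeasure T y := by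
  have e : stopAt y T = fun t => stopAt x T t + stopAt (fun t => y t - x t) T t := by
    ext t
    simp [stopAt]
  have hy : IsIncreasingPath (stopAt y T) := by
    rw [e]
    exact ⟨hx.1.add hyx.1, fun t => (hx.2 t).add (hyx.2 t)⟩
  rw [pathMeasure, pathMeasure, dif_pos hx, dif_pos hy]
  have : StieltjesFunction.mk (stopAt y T) hy.1 hy.2 =
      StieltjesFunction.mk (stopAt x T) hx.1 hx.2 +
        StieltjesFunction.mk (stopAt (fun t => y t - x t) T) hyx.1 hyx.2 :=
    StieltjesFunction.ext fun t => congrFun e t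
  rw [this, StieltjesFunction.measure_add]
  exact Measure.le_add_right le_rfl

theorem pathMeasure_countable {y : ℝ≥0 → ℝ} (hy : Continuous y) {s : Set ℝ≥0}
    (hs : s.Countable) : pathMeasure T y s = 0 := by
  by_cases hx : IsIncreasingPath (stopAt y T)
  · have : Continuous (stopAt y T) := hy.comp (continuous_id.min continuous_const)
    refine (measure_null_iff_singleton hs).2 fun t _ => ?_
    rw [pathMeasure_singleton hx, jump, this.continuousWithinAt.leftLim_eq, sub_self,
      ENNReal.ofReal_zero]
  · rw [pathMeasure, dif_neg hx]
    rfl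

end PathMeasure

/-! ### Integrals of predictable sets -/

section Predictable

variable {Ω : Type*} {m : MeasurableSpace Ω} {μ : Measure Ω} {ℱ : Filtration ℝ≥0 m}

theorem predictable_le_prod (ℱ : Filtration ℝ≥0 m) :
    ℱ.predictable ≤ (inferInstance : MeasurableSpace (ℝ≥0 × Ω)) :=
  measurableSpace_le_predictable_of_measurableSet
    (fun _ hA => (measurableSet_singleton _).prod (ℱ.le _ _ hA))
    (fun _ _ hA => measurableSet_Ioi.prod (ℱ.le _ _ hA))

theorem isPiSystem_predictable (ℱ : Filtration ℝ≥0 m) :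
    IsPiSystem ({s | ∃ A, MeasurableSet[ℱ ⊥] A ∧ s = ({⊥} : Set ℝ≥0) ×ˢ A} ∪
      {s | ∃ i A, MeasurableSet[ℱ i] A ∧ s = Set.Ioi i ×ˢ A}) := by
  rintro _ (⟨A, hA, rfl⟩ | ⟨i, A, hA, rfl⟩) _ (⟨B, hB, rfl⟩ | ⟨j, B, hB, rfl⟩) hne
  · exact Or.inl ⟨A ∩ B, hA.inter hB, by rw [prod_inter_prod, inter_self]⟩
  · obtain ⟨p, hp⟩ := hne
    have h1 : p.1 = ⊥ := hp.1.1
    have h2 : j < p.1 := hp.2.1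
    rw [h1] at h2
    exact absurd h2 not_lt_bot
  · obtain ⟨p, hp⟩ := hne
    have h1 : p.1 = ⊥ := hp.2.1
    have h2 : i < p.1 := hp.1.1
    rw [h1] at h2
    exact absurd h2 not_lt_bot
  · refine Or.inr ⟨max i j, A ∩ B, ?_, by rw [prod_inter_prod, Ioi_inter_Ioi]⟩
    exact (ℱ.mono (le_max_left i j) _ hA).inter (ℱ.mono (le_max_right i j) _ hB)

/-- Two random measures on the time axis whose integrals over the sets `(s, ∞) × F`, `F ∈ ℱ s`,
coincide have the same integral over every predictable set. -/
theorem lintegral_predictable_eq [IsFiniteMeasure μ] {K L : Ω → Measure ℝ≥0}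
    [∀ ω, IsFiniteMeasure (K ω)] [∀ ω, IsFiniteMeasure (L ω)]
    (hK0 : ∀ ω, K ω {0} = 0) (hL0 : ∀ ω, L ω {0} = 0)
    (hKm : ∀ s, AEMeasurable (fun ω => K ω (Ioi s)) μ)
    (hLm : ∀ s, AEMeasurable (fun ω => L ω (Ioi s)) μ)
    (hfin : ∫⁻ ω, K ω (Ioi 0) ∂μ ≠ ∞)
    (h : ∀ s F, MeasurableSet[ℱ s] F →
      ∫⁻ ω in F, K ω (Ioi s) ∂μ = ∫⁻ ω in F, L ω (Ioi s) ∂μ)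
    {H : Set (ℝ≥0 × Ω)} (hH : MeasurableSet[ℱ.predictable] H) :
    AEMeasurable (fun ω => K ω ((fun t => (t, ω)) ⁻¹' H)) μ ∧
      ∫⁻ ω, K ω ((fun t => (t, ω)) ⁻¹' H) ∂μ = ∫⁻ ω, L ω ((fun t => (t, ω)) ⁻¹' H) ∂μ := by
  have huniv : ∀ (J : Measure ℝ≥0), J {0} = 0 → J univ = J (Ioi 0) := by
    intro J hJ
    have : (univ : Set ℝ≥0) = {0} ∪ Ioi 0 := by
      ext t
      simp
    rw [this]
    refine le_antisymm ((measure_union_le _ _).trans_eq (by rw [hJ, zero_add]))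
      (measure_mono subset_union_right)
  have hsec : ∀ {H : Set (ℝ≥0 × Ω)}, MeasurableSet[ℱ.predictable] H → ∀ ω,
      MeasurableSet ((fun t : ℝ≥0 => (t, ω)) ⁻¹' H) := fun hH ω =>
    measurable_prodMk_right (predictable_le_prod ℱ _ hH)
  -- Measurability for `L` is carried along because the complement and union steps split the
  -- integrals of both families.
  suffices H3 : AEMeasurable (fun ω => K ω ((fun t => (t, ω)) ⁻¹' H)) μ ∧
      AEMeasurable (fun ω => L ω ((fun t => (t, ω)) ⁻¹' H)) μ ∧
      ∫⁻ ω, K ω ((fun t => (t, ω)) ⁻¹' H) ∂μ = ∫⁻ ω, L ω ((fun t => (t, ω)) ⁻¹' H) ∂μ from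
    ⟨H3.1, H3.2.2⟩
  have huK : ∫⁻ ω, K ω univ ∂μ = ∫⁻ ω, L ω univ ∂μ := by
    have := h 0 univ MeasurableSet.univ
    simpa only [huniv _ (hK0 _), huniv _ (hL0 _), Measure.restrict_univ] using this
  have hKu : AEMeasurable (fun ω => K ω univ) μ := by
    simpa only [huniv _ (hK0 _)] using hKm 0
  have hLu : AEMeasurable (fun ω => L ω univ) μ := by
    simpa only [huniv _ (hL0 _)] using hLm 0
  have hKfin : ∫⁻ ω, K ω univ ∂μ ≠ ∞ := by simpa only [huniv _ (hK0 _)] using hfin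
  have hLfin : ∫⁻ ω, L ω univ ∂μ ≠ ∞ := huK ▸ hKfin
  induction H, hH using MeasurableSpace.induction_on_inter (m := ℱ.predictable) rfl
    (isPiSystem_predictable ℱ) with
  | empty => simp
  | basic t ht =>
    have hind : ∀ (J : Ω → Measure ℝ≥0) (i : ℝ≥0) (A : Set Ω),
        (fun ω => J ω ((fun t => (t, ω)) ⁻¹' (Ioi i ×ˢ A))) =
          A.indicator fun ω => J ω (Ioi i) := by
      intro J i A
      ext ω
      by_cases hω : ω ∈ A
      · rw [indicator_of_mem hω, mk_preimage_prod_left hω]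
      · rw [indicator_of_notMem hω, mk_preimage_prod_left_eq_empty hω, measure_empty]
    rcases ht with ⟨A, hA, rfl⟩ | ⟨i, A, hA, rfl⟩
    · have hz : ∀ J : Measure ℝ≥0, J {0} = 0 → ∀ ω,
          J ((fun t => (t, ω)) ⁻¹' (({⊥} : Set ℝ≥0) ×ˢ A)) = 0 := by
        intro J hJ ω
        refine measure_mono_null (fun t ht => ?_) hJ
        exact ht.1
      simp only [hz _ (hK0 _), hz _ (hL0 _)]
      exact ⟨aemeasurable_const, aemeasurable_const, trivial⟩
    · have hA' := ℱ.le i _ hA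
      rw [hind K, hind L]
      refine ⟨(hKm i).indicator hA', (hLm i).indicator hA', ?_⟩
      rw [lintegral_indicator hA', lintegral_indicator hA']
      exact h i A hA
  | compl t ht ih =>
    have hc : ∀ (J : Measure ℝ≥0) [IsFiniteMeasure J] (ω : Ω),
        J ((fun s => (s, ω)) ⁻¹' tᶜ) = J univ - J ((fun s => (s, ω)) ⁻¹' t) := fun J _ ω => by
      rw [preimage_compl, measure_compl (hsec ht ω) (measure_ne_top _ _)]
    simp only [hc]
    have hle : ∀ (J : Ω → Measure ℝ≥0), ∫⁻ ω, J ω ((fun s => (s, ω)) ⁻¹' t) ∂μ ≤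
        ∫⁻ ω, J ω univ ∂μ := fun J => lintegral_mono fun ω => measure_mono (subset_univ _)
    refine ⟨hKu.sub ih.1, hLu.sub ih.2.1, ?_⟩
    rw [lintegral_sub' ih.1 ((hle K).trans_lt hKfin.lt_top).ne
        (Eventually.of_forall fun ω => measure_mono (subset_univ _)),
      lintegral_sub' ih.2.1 ((hle L).trans_lt hLfin.lt_top).ne
        (Eventually.of_forall fun ω => measure_mono (subset_univ _)), huK, ih.2.2]
  | iUnion f hd hf ih =>
    have hc : ∀ (J : Measure ℝ≥0) (ω : Ω),
        J ((fun s => (s, ω)) ⁻¹' ⋃ i, f i) = ∑' i, J ((fun s => (s, ω)) ⁻¹' f i) := fun J ω => by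
      rw [preimage_iUnion, measure_iUnion (fun i j hij => (hd hij).preimage _)
        fun i => hsec (hf i) ω]
    simp only [hc]
    refine ⟨AEMeasurable.tsum fun i => (ih i).1,
      AEMeasurable.tsum fun i => (ih i).2.1, ?_⟩
    rw [lintegral_tsum fun i => (ih i).1, lintegral_tsum fun i => (ih i).2.1]
    exact tsum_congr fun i => (ih i).2.2

/-- The path measure of `(s,∞)` is the increment from `min s T` to `T`. Hence `h`, the set-integral
form of the martingale property of `Z - B`, supplies the hypothesis of `lintegral_predictable_eq`.
-/
theorem lintegral_pathMeasure_eq [IsFiniteMeasure μ] {T : ℝ≥0} {Z B : ℝ≥0 → Ω → ℝ}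
    (hZ : ∀ᵐ ω ∂μ, IsIncreasingPath (stopAt (fun t => Z t ω) T))
    (hB : ∀ᵐ ω ∂μ, IsIncreasingPath (stopAt (fun t => B t ω) T))
    (hZi : ∀ t ≤ T, Integrable (Z t) μ) (hBi : ∀ t ≤ T, Integrable (B t) μ)
    (h : ∀ s ≤ T, ∀ F, MeasurableSet[ℱ s] F →
      ∫ ω in F, (Z T ω - Z s ω) ∂μ = ∫ ω in F, (B T ω - B s ω) ∂μ)
    {H : Set (ℝ≥0 × Ω)} (hH : MeasurableSet[ℱ.predictable] H) :
    AEMeasurable (fun ω => pathMeasure T (fun t => Z t ω) ((fun t => (t, ω)) ⁻¹' H)) μ ∧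
      ∫⁻ ω, pathMeasure T (fun t => Z t ω) ((fun t => (t, ω)) ⁻¹' H) ∂μ =
        ∫⁻ ω, pathMeasure T (fun t => B t ω) ((fun t => (t, ω)) ⁻¹' H) ∂μ := by
  have hval : ∀ {Y : ℝ≥0 → Ω → ℝ}, (∀ᵐ ω ∂μ, IsIncreasingPath (stopAt (fun t => Y t ω) T)) →
      ∀ s, (fun ω => pathMeasure T (fun t => Y t ω) (Ioi s)) =ᵐ[μ]
        fun ω => ENNReal.ofReal (Y T ω - Y (min s T) ω) := by
    intro Y hY s
    filter_upwards [hY] with ω hω using pathMeasure_Ioi hω s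
  have hm : ∀ {Y : ℝ≥0 → Ω → ℝ}, (∀ᵐ ω ∂μ, IsIncreasingPath (stopAt (fun t => Y t ω) T)) →
      (∀ t ≤ T, Integrable (Y t) μ) →
      ∀ s, AEMeasurable (fun ω => pathMeasure T (fun t => Y t ω) (Ioi s)) μ := by
    intro Y hY hYi s
    refine AEMeasurable.congr ?_ (hval hY s).symm
    exact ((hYi T le_rfl).aemeasurable.sub (hYi _ (min_le_right s T)).aemeasurable).ennreal_ofReal
  have hint : ∀ {Y : ℝ≥0 → Ω → ℝ}, (∀ᵐ ω ∂μ, IsIncreasingPath (stopAt (fun t => Y t ω) T)) →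
      (∀ t ≤ T, Integrable (Y t) μ) → ∀ s F,
      ∫⁻ ω in F, pathMeasure T (fun t => Y t ω) (Ioi s) ∂μ =
        ENNReal.ofReal (∫ ω in F, (Y T ω - Y (min s T) ω) ∂μ) := by
    intro Y hY hYi s F
    rw [lintegral_congr_ae (ae_restrict_of_ae (hval hY s)),
      ofReal_integral_eq_lintegral_ofReal]
    · exact ((hYi T le_rfl).sub (hYi _ (min_le_right s T))).integrableOn
    · refine ae_restrict_of_ae ?_
      filter_upwards [hY] with ω hω
      have := hω.1 (min_le_right s T)
      simp only [stopAt, min_self, min_assoc] at this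
      exact sub_nonneg.2 this
  refine lintegral_predictable_eq (ℱ := ℱ) (fun _ => pathMeasure_zero _ _)
    (fun _ => pathMeasure_zero _ _) (hm hZ hZi) (hm hB hBi) ?_ ?_ hH
  · have := hint hZ hZi 0 univ
    rw [Measure.restrict_univ] at this
    rw [this]
    exact ENNReal.ofReal_ne_top
  · intro s F hF
    rw [hint hZ hZi, hint hB hBi]
    rcases le_total s T with hs | hs
    · rw [min_eq_left hs, h s hs F hF]
    · simp [min_eq_right hs]

/-! ### Left-continuous approximation -/

/-- The largest multiple of `1 / (n + 1)` that is smaller than `t`, for `t > 0`. -/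
def leftGrid (n : ℕ) (t : ℝ≥0) : ℝ≥0 := ((⌈t * (n + 1)⌉₊ - 1 : ℕ) : ℝ≥0) / (n + 1)

theorem leftGrid_lt {t : ℝ≥0} (ht : 0 < t) (n : ℕ) : leftGrid n t < t := by
  rw [leftGrid, div_lt_iff₀ (by positivity)]
  have h1 : 0 < ⌈t * (n + 1)⌉₊ := Nat.ceil_pos.2 (by positivity)
  exact Nat.lt_ceil.1 (Nat.sub_lt h1 one_pos)

theorem le_leftGrid_add (n : ℕ) (t : ℝ≥0) : t ≤ leftGrid n t + 1 / (n + 1) := by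
  rw [leftGrid, ← add_div, le_div_iff₀ (by positivity)]
  refine (Nat.le_ceil _).trans ?_
  norm_cast
  omega

theorem tendsto_leftGrid {t : ℝ≥0} (ht : 0 < t) :
    Tendsto (fun n => leftGrid n t) atTop (𝓝[<] t) := by
  refine tendsto_nhdsWithin_iff.2 ⟨?_, Eventually.of_forall (leftGrid_lt ht)⟩
  refine tendsto_of_tendsto_of_tendsto_of_le_of_le
    (g := fun n : ℕ => t - 1 / ((n : ℝ≥0) + 1)) ?_ tendsto_const_nhds
    (fun n => tsub_le_iff_right.2 (le_leftGrid_add n t)) fun n => (leftGrid_lt ht n).le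
  simpa using (tendsto_const_nhds (x := t)).sub (tendsto_div_add_one 1)

/-- On each cell `(i/(n+1), (i+1)/(n+1)]` the process is frozen at the left end, so every preimage
is a countable union of predictable rectangles. -/
theorem measurable_leftGrid {A : ℝ≥0 → Ω → ℝ} (hA : ∀ t, Measurable[ℱ t] (A t)) (n : ℕ) :
    Measurable[ℱ.predictable] fun p : ℝ≥0 × Ω => A (leftGrid n p.1) p.2 := by
  intro s hs
  have e : (fun p : ℝ≥0 × Ω => A (leftGrid n p.1) p.2) ⁻¹' s =
      ({⊥} ×ˢ (A 0 ⁻¹' s)) ∪ ⋃ i : ℕ, Ioc ((i : ℝ≥0) / (n + 1)) ((i + 1 : ℝ≥0) / (n + 1)) ×ˢ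
        (A ((i : ℝ≥0) / (n + 1)) ⁻¹' s) := by
    -- The truncated subtraction `0 - 1 = 0` makes the formula correct at time 0.
    have h0 : leftGrid n 0 = 0 := by simp [leftGrid]
    have hcell : ∀ (i : ℕ) (t : ℝ≥0), t ∈ Ioc ((i : ℝ≥0) / (n + 1)) ((i + 1 : ℝ≥0) / (n + 1)) →
        leftGrid n t = (i : ℝ≥0) / (n + 1) := by
      intro i t ht
      have h1 : (i : ℝ≥0) < t * (n + 1) := (div_lt_iff₀ (by positivity)).1 ht.1
      have h2 : t * (n + 1) ≤ ((i + 1 : ℕ) : ℝ≥0) := by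
        push_cast
        exact (le_div_iff₀ (by positivity)).1 ht.2
      have h3 : ⌈t * ((n : ℝ≥0) + 1)⌉₊ = i + 1 :=
        le_antisymm (Nat.ceil_le.2 h2) (Nat.lt_ceil.2 h1)
      rw [leftGrid, h3, Nat.add_sub_cancel]
    ext ⟨t, ω⟩
    simp only [mem_preimage, mem_union, mem_prod, mem_singleton_iff, mem_iUnion]
    constructor
    · intro h
      rcases eq_or_ne t 0 with rfl | ht
      · rw [h0] at h
        exact Or.inl ⟨rfl, h⟩
      · have ht' := pos_iff_ne_zero.2 ht
        refine Or.inr ⟨⌈t * (n + 1)⌉₊ - 1, ⟨leftGrid_lt ht' n, ?_⟩, h⟩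
        have := le_leftGrid_add n t
        rwa [leftGrid, ← add_div] at this
    · rintro (⟨ht, h⟩ | ⟨i, ht, h⟩)
      · have : t = 0 := ht
        rwa [this, h0]
      · rwa [hcell i t ht]
  rw [e]
  refine MeasurableSet.union (measurableSet_predictable_singleton_bot_prod (hA 0 hs))
    (MeasurableSet.iUnion fun i => measurableSet_predictable_Ioc_prod _ _ (hA _ hs))

/-- Adapted continuous processes are predictable. -/
theorem isStronglyPredictable_of_continuous {A : ℝ≥0 → Ω → ℝ} (hA : ∀ t, Measurable[ℱ t] (A t))
    (hc : ∀ ω, Continuous fun t => A t ω) : IsStronglyPredictable ℱ A := by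
  have : Measurable[ℱ.predictable] (Function.uncurry A) := by
    refine @measurable_of_tendsto_metrizable _ _ ℱ.predictable _ _ _ _ _ _
      (measurable_leftGrid hA) (tendsto_pi_nhds.2 fun p => ?_)
    rcases eq_or_ne p.1 0 with h | h
    · have : ∀ n, leftGrid n p.1 = p.1 := fun n => by simp [leftGrid, h]
      simp only [this]
      exact tendsto_const_nhds
    · exact ((hc p.2).tendsto p.1).comp
        ((tendsto_leftGrid (pos_iff_ne_zero.2 h)).mono_right nhdsWithin_le_nhds)
  exact this.stronglyMeasurable

/-- The compensator of a process dominated by one with a continuous deterministic compensator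
has no jumps. -/
theorem predictable_jump_eq_zero [IsFiniteMeasure μ] {T : ℝ≥0} {Z A Y : ℝ≥0 → Ω → ℝ}
    {c : ℝ≥0 → ℝ} (hApred : IsStronglyPredictable ℱ A)
    (hA : ∀ᵐ ω ∂μ, IsIncreasingPath fun t => A t ω)
    (hZ : ∀ᵐ ω ∂μ, IsIncreasingPath fun t => Z t ω)
    (hY : ∀ᵐ ω ∂μ, IsIncreasingPath fun t => Y t ω)
    (hZY : ∀ᵐ ω ∂μ, ∀ s t, s ≤ t → t ≤ T → Z t ω - Z s ω ≤ Y t ω - Y s ω)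
    (hc : Continuous c) (hcm : Monotone c)
    (hAi : ∀ t ≤ T, Integrable (A t) μ) (hZi : ∀ t ≤ T, Integrable (Z t) μ)
    (hYi : ∀ t ≤ T, Integrable (Y t) μ)
    (hZA : ∀ s ≤ T, ∀ F, MeasurableSet[ℱ s] F →
      ∫ ω in F, (Z T ω - Z s ω) ∂μ = ∫ ω in F, (A T ω - A s ω) ∂μ)
    (hYc : ∀ s ≤ T, ∀ F, MeasurableSet[ℱ s] F →
      ∫ ω in F, (Y T ω - Y s ω) ∂μ = ∫ _ in F, (c T - c s) ∂μ) :
    ∀ᵐ ω ∂μ, ∀ t ≤ T, jump (fun s => A s ω) t = 0 := by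
  have hAadapted : ∀ t, Measurable[ℱ t] (A t) := fun t =>
    (hApred.stronglyAdapted t).measurable
  -- For almost every `ω`, at positive times this is the set of jumps of `A`, because `leftGrid n t`
  -- increases to the left limit; being expressed through the frozen processes, it is predictable.
  let H : Set (ℝ≥0 × Ω) := {p | Tendsto (fun n => A (leftGrid n p.1) p.2) atTop (𝓝 (A p.1 p.2))}ᶜ
  have hH : MeasurableSet[ℱ.predictable] H := by
    refine MeasurableSet.compl ?_
    have hgrid := measurable_leftGrid hAadapted
    have hAm : Measurable[ℱ.predictable] (Function.uncurry A) := hApred.measurable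
    let : MeasurableSpace (ℝ≥0 × Ω) := ℱ.predictable
    exact measurableSet_tendsto_fun hgrid hAm
  have hstopAt : ∀ {X : ℝ≥0 → Ω → ℝ}, (∀ᵐ ω ∂μ, IsIncreasingPath fun t => X t ω) →
      ∀ᵐ ω ∂μ, IsIncreasingPath (stopAt (fun t => X t ω) T) := fun h => by
    filter_upwards [h] with ω hω using hω.stopAt T
  have hcpath : IsIncreasingPath c := ⟨hcm, fun t => hc.continuousWithinAt⟩
  have hmem : ∀ ω, IsIncreasingPath (fun t => A t ω) → ∀ t, 0 < t →
      (t ∈ (fun t => (t, ω)) ⁻¹' H ↔ Function.leftLim (fun t => A t ω) t ≠ A t ω) := by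
    intro ω hω t ht
    have hlim : Tendsto (fun n => A (leftGrid n t) ω) atTop
        (𝓝 (Function.leftLim (fun t => A t ω) t)) :=
      (hω.1.tendsto_leftLim t).comp (tendsto_leftGrid ht)
    refine not_congr ⟨fun h => tendsto_nhds_unique hlim h, fun h => ?_⟩
    change Tendsto (fun n => A (leftGrid n t) ω) atTop (𝓝 (A t ω))
    rwa [h] at hlim
  obtain ⟨hmeas, hAZ⟩ := lintegral_pathMeasure_eq (ℱ := ℱ) (hstopAt hA) (hstopAt hZ) hAi hZi
    (fun s hs F hF => (hZA s hs F hF).symm) hH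
  -- On predictable sets the expected mass of `A` equals that of `Z`, is at most that of `Y`, and
  -- the latter equals that of `c`. The sections of `H` are almost surely countable, and the
  -- continuous `c` gives them no mass.
  have key : ∫⁻ ω, pathMeasure T (fun t => A t ω) ((fun t => (t, ω)) ⁻¹' H) ∂μ = 0 := by
    rw [hAZ, ← nonpos_iff_eq_zero]
    calc ∫⁻ ω, pathMeasure T (fun t => Z t ω) ((fun t => (t, ω)) ⁻¹' H) ∂μ
        ≤ ∫⁻ ω, pathMeasure T (fun t => Y t ω) ((fun t => (t, ω)) ⁻¹' H) ∂μ := by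
          refine lintegral_mono_ae ?_
          filter_upwards [hZ, hY, hZY] with ω h1 h2 h3
          refine pathMeasure_le (h1.stopAt T) ⟨fun s t hst => ?_, fun t => ?_⟩ _
          · have := h3 _ _ (min_le_min_right T hst) (min_le_right t T)
            simp only [stopAt]
            linarith
          · exact ((h2.stopAt T).2 t).sub ((h1.stopAt T).2 t)
      _ = ∫⁻ ω, pathMeasure T c ((fun t => (t, ω)) ⁻¹' H) ∂μ :=
          (lintegral_pathMeasure_eq (ℱ := ℱ) (B := fun t _ => c t) (hstopAt hY)
            (Eventually.of_forall fun _ => hcpath.stopAt T) hYi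
            (fun t _ => integrable_const _) hYc hH).2
      _ = 0 := by
          rw [← lintegral_zero (μ := μ)]
          refine lintegral_congr_ae ?_
          filter_upwards [hA] with ω hω
          refine pathMeasure_countable hc (Countable.mono (fun t ht => ?_)
            (((StieltjesFunction.mk _ hω.1 hω.2).countable_leftLim_ne).union
              (countable_singleton 0)))
          rcases eq_or_ne t 0 with h0 | h0
          · exact Or.inr h0
          · exact Or.inl ((hmem ω hω t (pos_iff_ne_zero.2 h0)).1 ht)
      _ ≤ 0 := le_rfl
  rw [lintegral_eq_zero_iff' hmeas] at key
  filter_upwards [key, hA] with ω h0 hω t htT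
  by_contra hne
  have ht : 0 < t := by
    rcases eq_or_ne t 0 with rfl | h
    · exact absurd (jump_zero _) hne
    · exact pos_iff_ne_zero.2 h
  have h1 : t ∈ (fun t => (t, ω)) ⁻¹' H :=
    (hmem ω hω t ht).2 fun h => hne (by rw [jump, h, sub_self])
  have h2 : pathMeasure T (fun t => A t ω) {t} = 0 :=
    measure_mono_null (singleton_subset_iff.2 h1) h0
  rw [pathMeasure_singleton (hω.stopAt T), jump_stopAt_of_le _ htT, ENNReal.ofReal_eq_zero] at h2
  exact hne (le_antisymm h2 (jump_nonneg hω.1 t))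

end Predictable


/-! ### Conditional expectations given independent variables -/

section Conditional

variable {Ω : Type*} {G m : MeasurableSpace Ω} {μ : Measure Ω} [IsProbabilityMeasure μ]

/-- Fubini's theorem, since the joint law of `V` and `W` is the product of their laws. -/
theorem integral_comp_of_indepFun {β : Type*} [MeasurableSpace β] {V : Ω → β} {W : Ω → ℝ}
    (hV : Measurable V) (hW : Measurable W) (hind : IndepFun V W μ) {f : β → ℝ → ℝ}
    (hf : Measurable (Function.uncurry f)) (hint : Integrable (fun ω => f (V ω) (W ω)) μ) :
    Integrable (fun ω => ∫ ω', f (V ω) (W ω') ∂μ) μ ∧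
      ∫ ω, f (V ω) (W ω) ∂μ = ∫ ω, ∫ ω', f (V ω) (W ω') ∂μ ∂μ := by
  have hVW : Measurable fun ω => (V ω, W ω) := hV.prodMk hW
  have hprod := (indepFun_iff_map_prod_eq_prod_map_map hV.aemeasurable hW.aemeasurable).1 hind
  have : IsProbabilityMeasure (μ.map W) := Measure.isProbabilityMeasure_map hW.aemeasurable
  have : IsProbabilityMeasure (μ.map V) := Measure.isProbabilityMeasure_map hV.aemeasurable
  have hi : Integrable (Function.uncurry f) ((μ.map V).prod (μ.map W)) := by
    rw [← hprod, integrable_map_measure hf.aestronglyMeasurable hVW.aemeasurable]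
    exact hint
  have hinner : ∀ v, ∫ w, Function.uncurry f (v, w) ∂(μ.map W) = ∫ ω', f v (W ω') ∂μ := fun v =>
    integral_map hW.aemeasurable (hf.comp measurable_prodMk_left).aestronglyMeasurable
  have hi1 := hi.integral_prod_left
  have hi2 := integral_prod _ hi
  simp only [hinner] at hi1 hi2
  refine ⟨hi1.comp_measurable hV, ?_⟩
  rw [← integral_map hV.aemeasurable hi1.aestronglyMeasurable
    (f := fun v => ∫ ω', f v (W ω') ∂μ), ← hi2, ← hprod,
    integral_map hVW.aemeasurable hf.aestronglyMeasurable]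
  rfl

theorem condExp_comp_of_indep (hG : G ≤ m) {V W : Ω → ℝ}
    (hV : Measurable[G] V) (hW : Measurable W)
    (hind : Indep G (MeasurableSpace.comap W inferInstance) μ) {f : ℝ → ℝ → ℝ}
    (hf : Measurable (Function.uncurry f)) (hint : Integrable (fun ω => f (V ω) (W ω)) μ) :
    (fun ω => ∫ ω', f (V ω) (W ω') ∂μ) =ᵐ[μ] μ[fun ω => f (V ω) (W ω) | G] := by
  have hindV : ∀ {β : Type} [MeasurableSpace β] {Y : Ω → β}, Measurable[G] Y → IndepFun Y W μ := by
    intro β _ Y hY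
    rw [IndepFun_iff_Indep]
    exact indep_of_indep_of_le_left hind hY.comap_le
  have hVm : Measurable V := hV.mono hG le_rfl
  refine ae_eq_condExp_of_forall_setIntegral_eq hG hint (fun s _ _ => ?_) (fun s hs _ => ?_) ?_
  · exact (integral_comp_of_indepFun hVm hW (hindV hV) hf hint).1.integrableOn
  -- Adjoining the indicator of `s` to `V` keeps `G`-measurability, hence independence from `W`, and
  -- turns the integral over `s` into a full expectation.
  · let Y : Ω → ℝ × ℝ := fun ω => (s.indicator (fun _ => 1) ω, V ω)
    have hY : Measurable[G] Y := by
      have h1 : Measurable[G] fun _ : Ω => (1 : ℝ) := measurable_const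
      exact Measurable.prodMk (Measurable.indicator h1 hs) hV
    have hmul : ∀ (F : Ω → ℝ), s.indicator F = fun ω => s.indicator (fun _ => 1) ω * F ω := by
      intro F
      ext ω
      by_cases h : ω ∈ s <;> simp [h]
    have h2 := (integral_comp_of_indepFun (hY.mono hG le_rfl) hW (hindV hY)
      (f := fun p w => p.1 * f p.2 w) ?_ ?_).2
    · rw [← integral_indicator (hG s hs), ← integral_indicator (hG s hs),
        hmul (fun ω => ∫ ω', f (V ω) (W ω') ∂μ),
        hmul fun ω => f (V ω) (W ω), h2]
      simp only [Y, integral_const_mul]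
    · exact (measurable_fst.comp measurable_fst).mul
        (hf.comp ((measurable_snd.comp measurable_fst).prodMk measurable_snd))
    · have := hint.indicator (hG s hs)
      rwa [hmul] at this
  · have h1 : StronglyMeasurable fun v => ∫ w, f v w ∂(μ.map W) := by
      have : IsProbabilityMeasure (μ.map W) := Measure.isProbabilityMeasure_map hW.aemeasurable
      exact hf.stronglyMeasurable.integral_prod_right
    have h2 : (fun ω => ∫ ω', f (V ω) (W ω') ∂μ) = fun ω => ∫ w, f (V ω) w ∂(μ.map W) := by
      ext ω
      exact (integral_map hW.aemeasurable
        (hf.comp measurable_prodMk_left).aestronglyMeasurable).symm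
    rw [h2]
    exact (h1.comp_measurable hV).aestronglyMeasurable

end Conditional

/-- Orders finitely many observation times from 0 onwards, so that the values of a process there are
partial sums of independent increments. -/
theorem exists_monotone_enumeration (I : Finset ℝ≥0) :
    ∃ (τ : ℕ → ℝ≥0) (n : ℕ), Monotone τ ∧ τ 0 = 0 ∧ (∀ x ∈ I, ∃ i ≤ n, τ i = x) ∧
      ∀ i, τ i = 0 ∨ τ i ∈ I := by
  classical
  induction I using Finset.induction_on_max with
  | empty => exact ⟨fun _ => 0, 0, monotone_const, rfl, by simp, by simp⟩
  | insert a s ha ih =>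
    obtain ⟨τ, n, hm, h0, hs, hI⟩ := ih
    have hle : ∀ i, τ i ≤ a := fun i => by
      rcases hI i with h | h
      · rw [h]
        exact zero_le
      · exact (ha _ h).le
    refine ⟨fun i => if i ≤ n then τ i else a, n + 1, fun i j hij => ?_, by simp [h0], ?_, ?_⟩
    · simp only
      split_ifs with h1 h2
      · exact hm hij
      · exact hle i
      · omega
      · exact le_rfl
    · intro x hx
      rcases Finset.mem_insert.1 hx with rfl | hx
      · exact ⟨n + 1, le_rfl, by simp⟩
      · obtain ⟨i, hi, rfl⟩ := hs x hx
        exact ⟨i, by omega, by simp [hi]⟩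
    · intro i
      simp only
      split_ifs
      · exact (hI i).imp_right (Finset.mem_insert_of_mem)
      · exact Or.inr (Finset.mem_insert_self _ _)

/-! ### The claims process: independence from the past and the martingale property. -/

namespace SurplusModel

variable {Ω : Type*} [MeasurableSpace Ω] {μ : Measure Ω}
  (X : SurplusModel μ)

/-- The expected cumulative claims. -/
def meanS (t : ℝ≥0) : ℝ := ∫ ω, X.S t ω ∂μ

theorem M_eq (t : ℝ≥0) (ω : Ω) : X.M t ω = X.meanS t - X.S t ω := rfl

theorem S_eq (t : ℝ≥0) (ω : Ω) : X.S t ω = X.meanS t - X.M t ω := by rw [M_eq]; ring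

theorem mono_S (ω : Ω) {s t : ℝ≥0} (h : s ≤ t) : X.S s ω ≤ X.S t ω := (X.pureJump_S ω).mono h

theorem S_zero : ∀ᵐ ω ∂μ, X.S 0 ω = X.meanS 0 := by
  filter_upwards [X.start_S] with ω h
  rw [meanS]
  linarith

theorem abs_S_le (ω : Ω) {s t : ℝ≥0} (h : s ≤ t) : ‖X.S s ω‖ ≤ |X.S 0 ω| + |X.S t ω| := by
  rw [Real.norm_eq_abs, abs_le]
  have h1 := X.mono_S ω h
  have h2 := X.mono_S ω (zero_le (a := s))
  constructor
  · linarith [neg_abs_le (X.S 0 ω), abs_nonneg (X.S t ω)]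
  · linarith [le_abs_self (X.S t ω), abs_nonneg (X.S 0 ω)]

theorem meanS_mono : Monotone X.meanS := fun s t h =>
  integral_mono (X.integrable_S s) (X.integrable_S t) fun ω => X.mono_S ω h

theorem measurable_M_filtration (t : ℝ≥0) : Measurable[X.filtrationM t] (X.M t) :=
  (Filtration.stronglyAdapted_natural (fun t => (X.measurable_M t).stronglyMeasurable) t).measurable

theorem measurable_S_filtration (t : ℝ≥0) : Measurable[X.filtrationM t] (X.S t) := by
  have : X.S t = fun ω => X.meanS t - X.M t ω := funext (X.S_eq t)
  rw [this]
  exact (X.measurable_M_filtration t).const_sub _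

theorem comap_M_le (t : ℝ≥0) :
    MeasurableSpace.comap (X.M t) inferInstance ≤ X.filtrationM t :=
  (X.measurable_M_filtration t).comap_le

theorem measurable_S_comap (t : ℝ≥0) :
    Measurable[MeasurableSpace.comap (X.M t) inferInstance] (X.S t) := by
  have : X.S t = fun ω => X.meanS t - X.M t ω := funext (X.S_eq t)
  rw [this]
  exact (comap_measurable (X.M t)).const_sub _

/-- Dominated convergence. The limit from the left needs the absence of fixed jump times, the limit
from the right only càdlàg paths. -/
theorem continuous_meanS : Continuous X.meanS := by
  have hb : ∀ t, Integrable (fun ω => |X.S 0 ω| + |X.S t ω|) μ := fun t =>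
    (X.integrable_S 0).abs.add (X.integrable_S t).abs
  refine continuous_iff_continuousAt.2 fun t => ?_
  rw [continuousAt_iff_continuous_left'_right']
  constructor
  · refine tendsto_integral_filter_of_dominated_convergence _
      (Eventually.of_forall fun s => (X.measurable_S s).aestronglyMeasurable) ?_ (hb t) ?_
    · filter_upwards [self_mem_nhdsWithin] with s hs
      exact Eventually.of_forall fun ω => X.abs_S_le ω (le_of_lt hs)
    · filter_upwards [X.noFixedJump_S t] with ω hω
      have := (X.pureJump_S ω).cadlag.tendsto_leftLim t
      rwa [← sub_eq_zero.1 hω] at this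
  · refine tendsto_integral_filter_of_dominated_convergence _
      (Eventually.of_forall fun s => (X.measurable_S s).aestronglyMeasurable) ?_ (hb (t + 1)) ?_
    · filter_upwards [Ioo_mem_nhdsGT (lt_add_one t)] with s hs
      exact Eventually.of_forall fun ω => X.abs_S_le ω hs.2.le
    · exact Eventually.of_forall fun ω =>
        ((X.pureJump_S ω).cadlag t).1.mono Ioi_subset_Ici_self

variable [IsProbabilityMeasure μ]

/-- Finitely many past times suffice. As `S 0` is a.s. constant, the values of `M` there are
functions of increments up to `s`, which are independent of the next increment. -/
theorem indepFun_past {s t : ℝ≥0} (hst : s ≤ t) :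
    IndepFun (fun ω (j : Iic s) => X.M j ω) (fun ω => X.S t ω - X.S s ω) μ := by
  classical
  refine IndepFun.process_indepFun (fun j => X.measurable_M j)
    ((X.measurable_S t).sub (X.measurable_S s)) fun I => ?_
  obtain ⟨τ, n, hm, h0, hs, hI⟩ := exists_monotone_enumeration (I.image Subtype.val)
  have hle : ∀ i, τ i ≤ s := fun i => by
    rcases hI i with h | h
    · rw [h]
      exact zero_le
    · obtain ⟨j, _, hj⟩ := Finset.mem_image.1 h
      rw [← hj]
      exact j.2
  -- The past times, then `s`, then `t` forever: the increment of index `n + 1` is `S t - S s`, and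
  -- those of index at most `n` lie before `s`.
  let σ : ℕ → ℝ≥0 := fun i => if i ≤ n then τ i else if i = n + 1 then s else t
  have hσ : Monotone σ := by
    refine monotone_nat_of_le_succ fun i => ?_
    simp only [σ]
    split_ifs
    · exact hm (Nat.le_succ i)
    · exact hle i
    · exact (hle i).trans hst
    · omega
    · omega
    · exact hst
    · omega
    · omega
    · exact le_rfl
  have hind := X.indep_S.nat hσ
  have hmeas : ∀ i, Measurable fun ω => X.S (σ (i + 1)) ω - X.S (σ i) ω := fun i =>
    (X.measurable_S _).sub (X.measurable_S _)
  have hfin := hind.indepFun_finset (Finset.range (n + 1)) {n + 1} (by simp) hmeas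
  have hex : ∀ j : I, ∃ i ≤ n, τ i = (j : Iic s) := fun j =>
    hs _ (Finset.mem_image_of_mem _ j.2)
  choose idx hidx hτ using hex
  let g : ((Finset.range (n + 1)) → ℝ) → (I → ℝ) := fun v j =>
    X.meanS (j : Iic s) - (X.meanS 0 + ∑ i : Fin (idx j), v ⟨i, by
      have := hidx j
      have := i.2
      exact Finset.mem_range.2 (by omega)⟩)
  have hg : Measurable g := by
    refine measurable_pi_lambda _ fun j => ?_
    exact measurable_const.sub (measurable_const.add
      (Finset.measurable_sum _ fun i _ => measurable_pi_apply _))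
  have hcomp := hfin.comp hg (measurable_pi_apply (⟨n + 1, by simp⟩ : ({n + 1} : Finset ℕ)))
  refine hcomp.congr ?_ ?_
  · filter_upwards [X.S_zero] with ω hω
    ext j
    simp only [g, Function.comp_apply]
    rw [Fin.sum_univ_eq_sum_range (fun i => X.S (σ (i + 1)) ω - X.S (σ i) ω) (idx j),
      Finset.sum_range_sub (fun i => X.S (σ i) ω), M_eq]
    have e0 : σ 0 = 0 := by simp [σ, h0]
    have e1 : σ (idx j) = (j : Iic s) := by simp [σ, hidx j, hτ j]
    rw [e0, e1, hω]
    ring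
  · refine Eventually.of_forall fun ω => ?_
    simp [σ]

theorem indep_filtration {s t : ℝ≥0} (hst : s ≤ t) :
    Indep (X.filtrationM s)
      (MeasurableSpace.comap (fun ω => X.S t ω - X.S s ω) inferInstance) μ := by
  have := (X.indepFun_past hst)
  rw [IndepFun_iff_Indep] at this
  rw [filtrationM, Filtration.natural_eq_comap]
  exact this

theorem integrable_M (t : ℝ≥0) : Integrable (X.M t) μ :=
  (integrable_const _).sub (X.integrable_S t)

theorem martingale_M : Martingale X.M X.filtrationM μ := by
  refine ⟨fun t => (X.measurable_M_filtration t).stronglyMeasurable, fun s t hst => ?_⟩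
  have h1 : μ[fun ω => X.S t ω - X.S s ω | X.filtrationM s] =ᵐ[μ]
      fun _ => X.meanS t - X.meanS s := by
    have hm : Measurable fun ω => X.S t ω - X.S s ω := (X.measurable_S t).sub (X.measurable_S s)
    have := condExp_indep_eq hm.comap_le (X.filtrationM.le s)
      (comap_measurable _).stronglyMeasurable (X.indep_filtration hst).symm
    rw [integral_sub (X.integrable_S t) (X.integrable_S s)] at this
    exact this
  have e : X.M t = X.M s + ((fun _ => X.meanS t - X.meanS s) -
      fun ω => X.S t ω - X.S s ω) := by
    ext ω
    simp only [M_eq, Pi.add_apply, Pi.sub_apply]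
    ring
  have hd : Integrable (fun ω => X.S t ω - X.S s ω) μ := (X.integrable_S t).sub (X.integrable_S s)
  have h2 := condExp_add (X.integrable_M s)
    ((integrable_const (X.meanS t - X.meanS s)).sub hd) (X.filtrationM s)
  have h3 := condExp_sub (integrable_const (μ := μ) (X.meanS t - X.meanS s)) hd (X.filtrationM s)
  have h4 : μ[X.M s | X.filtrationM s] = X.M s := condExp_of_stronglyMeasurable
    (X.filtrationM.le s) (X.measurable_M_filtration s).stronglyMeasurable (X.integrable_M s)
  have h5 : μ[fun _ : Ω => X.meanS t - X.meanS s | X.filtrationM s] =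
    fun _ => X.meanS t - X.meanS s := condExp_const (X.filtrationM.le s) _
  rw [e]
  filter_upwards [h1, h2, h3] with ω a1 a2 a3
  rw [a2, Pi.add_apply, a3, Pi.sub_apply, h4, h5, a1, sub_self, add_zero]

theorem setIntegral_S_sub {s t : ℝ≥0} (hst : s ≤ t) {F : Set Ω}
    (hF : MeasurableSet[X.filtrationM s] F) :
    ∫ ω in F, (X.S t ω - X.S s ω) ∂μ = ∫ _ in F, (X.meanS t - X.meanS s) ∂μ := by
  have h := X.martingale_M.setIntegral_eq hst hF
  have h1 : ∫ ω in F, X.M s ω ∂μ = ∫ ω in F, X.M t ω ∂μ - (∫ _ in F, (X.meanS t - X.meanS s) ∂μ -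
      ∫ ω in F, (X.S t ω - X.S s ω) ∂μ) := by
    have hd : Integrable (fun ω => X.S t ω - X.S s ω) μ := (X.integrable_S t).sub (X.integrable_S s)
    rw [← integral_sub (integrable_const _) hd.integrableOn,
      ← integral_sub (X.integrable_M t).integrableOn]
    · refine integral_congr_ae (Eventually.of_forall fun ω => ?_)
      simp only [M_eq]
      ring
    · exact (integrable_const _).sub hd.integrableOn
  linarith

/-! ### Functions of the terminal value -/

/-- `𝔼[F(M_T) | S_t = y]`. -/
def valueFunction (T : ℝ≥0) (F : ℝ → ℝ) (t : ℝ≥0) (y : ℝ) : ℝ :=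
  ∫ ω, F (X.meanS T - y - (X.S T ω - X.S (min t T) ω)) ∂μ

variable {F : ℝ → ℝ} (hF : LipschitzWith 1 F) (hFm : Monotone F)

include hF in
omit [IsProbabilityMeasure μ] in
theorem integrable_comp_lipschitz [IsFiniteMeasure μ] {V : Ω → ℝ} (hV : Integrable V μ) :
    Integrable (fun ω => F (V ω)) μ := by
  have h : Integrable (fun ω => |F 0| + |V ω|) μ := (integrable_const _).add hV.abs
  refine h.mono' (hF.continuous.comp_aestronglyMeasurable hV.aestronglyMeasurable)
    (Eventually.of_forall fun ω => ?_)
  have := hF.dist_le_mul (V ω) 0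
  rw [Real.dist_eq, Real.dist_eq, sub_zero, NNReal.coe_one, one_mul] at this
  rw [Real.norm_eq_abs]
  calc |F (V ω)| = |F 0 + (F (V ω) - F 0)| := by rw [add_sub_cancel]
    _ ≤ |F 0| + |F (V ω) - F 0| := abs_add_le _ _
    _ ≤ _ := by gcongr

include hF in
theorem integrable_value (T t : ℝ≥0) (y : ℝ) :
    Integrable (fun ω => F (X.meanS T - y - (X.S T ω - X.S (min t T) ω))) μ :=
  integrable_comp_lipschitz hF ((integrable_const _).sub
    ((X.integrable_S T).sub (X.integrable_S _)))

include hF hFm in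
-- An increment of `F` lies between 0 and that of its argument, and this survives the expectation.
-- In time, the bound is an increment of the continuous function `meanS`.
theorem isValueFunction (T : ℝ≥0) : IsValueFunction (X.valueFunction T F) := by
  have hsub : ∀ {a b : ℝ}, a ≤ b → 0 ≤ F b - F a ∧ F b - F a ≤ b - a := by
    intro a b hab
    refine ⟨sub_nonneg.2 (hFm hab), ?_⟩
    have := hF.dist_le_mul b a
    rw [Real.dist_eq, Real.dist_eq, NNReal.coe_one, one_mul,
      abs_of_nonneg (sub_nonneg.2 hab)] at this
    exact (le_abs_self _).trans this
  have htime : ∀ y {s t : ℝ≥0}, s ≤ t → 0 ≤ X.valueFunction T F t y - X.valueFunction T F s y ∧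
      X.valueFunction T F t y - X.valueFunction T F s y ≤
        X.meanS (min t T) - X.meanS (min s T) := by
    intro y s t hst
    have hle : ∀ ω, X.meanS T - y - (X.S T ω - X.S (min s T) ω) ≤
        X.meanS T - y - (X.S T ω - X.S (min t T) ω) := fun ω => by
      have := X.mono_S ω (min_le_min_right T hst)
      linarith
    rw [valueFunction, valueFunction, ← integral_sub (X.integrable_value hF T t y)
      (X.integrable_value hF T s y)]
    refine ⟨integral_nonneg fun ω => (hsub (hle ω)).1, ?_⟩
    have e : X.meanS (min t T) - X.meanS (min s T) =
        ∫ ω, (X.S (min t T) ω - X.S (min s T) ω) ∂μ :=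
      (integral_sub (X.integrable_S _) (X.integrable_S _)).symm
    rw [e]
    refine integral_mono ((X.integrable_value hF T t y).sub (X.integrable_value hF T s y))
      ((X.integrable_S _).sub (X.integrable_S _)) fun ω => ?_
    have := (hsub (hle ω)).2
    simp only
    linarith
  refine ⟨fun y s t hst => sub_nonneg.1 (htime y hst).1, fun y => ?_, fun t y y' hy => ?_⟩
  · have habs : ∀ s t, |X.valueFunction T F t y - X.valueFunction T F s y| ≤
        |X.meanS (min t T) - X.meanS (min s T)| := by
      intro s t
      rcases le_total s t with h | h
      · rw [abs_of_nonneg (htime y h).1]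
        exact (htime y h).2.trans (le_abs_self _)
      · rw [abs_sub_comm, abs_of_nonneg (htime y h).1, abs_sub_comm (X.meanS _)]
        exact (htime y h).2.trans (le_abs_self _)
    have hc : Continuous fun t => X.meanS (min t T) :=
      X.continuous_meanS.comp (continuous_id.min continuous_const)
    refine continuous_iff_continuousAt.2 fun s => ?_
    have h1 : Tendsto (fun t => |X.meanS (min t T) - X.meanS (min s T)|) (𝓝 s) (𝓝 0) := by
      have := ((hc.tendsto s).sub_const (X.meanS (min s T))).abs
      simpa using this
    have h2 : Tendsto (fun t => X.valueFunction T F t y - X.valueFunction T F s y) (𝓝 s) (𝓝 0) :=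
      squeeze_zero_norm (fun t => habs s t) h1
    have := h2.add_const (X.valueFunction T F s y)
    simpa [ContinuousAt] using this
  · have hle : ∀ ω, X.meanS T - y' - (X.S T ω - X.S (min t T) ω) ≤
        X.meanS T - y - (X.S T ω - X.S (min t T) ω) := fun ω => by linarith
    rw [valueFunction, valueFunction, ← integral_sub (X.integrable_value hF T t y)
      (X.integrable_value hF T t y')]
    refine ⟨integral_nonneg fun ω => (hsub (hle ω)).1, ?_⟩
    have : ∫ _, (y' - y) ∂μ = y' - y := by simp
    rw [← this]
    refine integral_mono ((X.integrable_value hF T t y).sub (X.integrable_value hF T t y'))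
      (integrable_const _) fun ω => ?_
    have := (hsub (hle ω)).2
    simp only
    linarith

/-- `M_T` is a function of `S_t` and of the later increment, which is independent of `ℱ_t`. Leaving
`G` free covers both `ℱ_t` and the σ-algebra of `M_t`, so the two conditional expectations coincide.
-/
theorem condExp_terminal {Ω : Type*} {G : MeasurableSpace Ω} [MeasurableSpace Ω] {μ : Measure Ω}
    [IsProbabilityMeasure μ] (X : SurplusModel μ) {F : ℝ → ℝ} (hF : LipschitzWith 1 F)
    {T t : ℝ≥0} (ht : t ≤ T)
    (hG : G ≤ X.filtrationM t) (hSG : Measurable[G] (X.S t)) :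
    (fun ω => X.valueFunction T F t (X.S t ω)) =ᵐ[μ] μ[fun ω => F (X.M T ω) | G] := by
  have e : (fun ω => F (X.M T ω)) =
      fun ω => F (X.meanS T - X.S t ω - (X.S T ω - X.S t ω)) := by
    ext ω
    rw [M_eq]
    ring_nf
  have h := condExp_comp_of_indep (μ := μ) (hG.trans (X.filtrationM.le t)) hSG
    ((X.measurable_S T).sub (X.measurable_S t))
    (indep_of_indep_of_le_left (X.indep_filtration ht) hG)
    (f := fun v w => F (X.meanS T - v - w))
    (hF.continuous.measurable.comp ((measurable_const.sub measurable_fst).sub measurable_snd)) ?_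
  · rw [e]
    refine EventuallyEq.trans (Eventually.of_forall fun ω => ?_) h
    simp only [valueFunction, min_eq_left ht, Pi.sub_apply]
  · have := integrable_comp_lipschitz hF (X.integrable_M T)
    rwa [e] at this

end SurplusModel


/-! ### Square-integrable martingales -/

section MartingaleL2

variable {Ω : Type*} {m : MeasurableSpace Ω} {μ : Measure Ω} [IsFiniteMeasure μ]
  {ℱ : Filtration ℝ≥0 m} {D : ℝ≥0 → Ω → ℝ} {T : ℝ≥0}

omit [IsFiniteMeasure μ] in
theorem memLp_of_martingale (hD : Martingale D ℱ μ) (hT : MemLp (D T) 2 μ) {t : ℝ≥0}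
    (ht : t ≤ T) : MemLp (D t) 2 μ :=
  (MemLp.condExp one_le_two hT).ae_eq (hD.condExp_ae_eq ht)

/-- Conditioning at time `s` gives `E[D_s D_t] = E[D_s²]`. -/
theorem integral_sq_increment (hD : Martingale D ℱ μ) (hT : MemLp (D T) 2 μ) {s t : ℝ≥0}
    (hst : s ≤ t) (ht : t ≤ T) :
    ∫ ω, (D t ω - D s ω) ^ 2 ∂μ = ∫ ω, D t ω ^ 2 ∂μ - ∫ ω, D s ω ^ 2 ∂μ := by
  have h2t := memLp_of_martingale hD hT ht
  have h2s := memLp_of_martingale hD hT (hst.trans ht)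
  have hprod : Integrable (D s * D t) μ := h2s.integrable_mul h2t
  have hcross : ∫ ω, D s ω * D t ω ∂μ = ∫ ω, D s ω ^ 2 ∂μ := by
    have h1 := condExp_mul_of_stronglyMeasurable_left (hD.stronglyMeasurable s) hprod
      (hD.integrable t)
    have h2 := integral_condExp (ℱ.le s) (μ := μ) (f := D s * D t)
    rw [integral_congr_ae h1] at h2
    have h3 : ∫ ω, D s ω * D t ω ∂μ = ∫ ω, (D s * D t) ω ∂μ := rfl
    rw [h3, ← h2]
    refine integral_congr_ae ?_
    filter_upwards [hD.condExp_ae_eq hst] with ω hω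
    rw [Pi.mul_apply, hω, sq]
  have e : ∀ ω, (D t ω - D s ω) ^ 2 = D t ω ^ 2 + D s ω ^ 2 - 2 * (D s ω * D t ω) := fun ω => by
    ring
  have i1 : Integrable (fun ω => D t ω ^ 2) μ := h2t.integrable_sq
  have i2 : Integrable (fun ω => D s ω ^ 2) μ := h2s.integrable_sq
  have i3 : Integrable (fun ω => 2 * (D s ω * D t ω)) μ := hprod.const_mul 2
  simp_rw [e]
  have i12 : Integrable (fun ω => D t ω ^ 2 + D s ω ^ 2) μ := i1.add i2
  rw [integral_sub i12 i3, integral_add i1 i2, integral_const_mul, hcross]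
  ring

theorem integral_sum_sq_grid (hD : Martingale D ℱ μ) (hT : MemLp (D T) 2 μ) (n : ℕ) :
    ∫ ω, ∑ i ∈ Finset.range (n + 1), (D (grid T n (i + 1)) ω - D (grid T n i) ω) ^ 2 ∂μ =
      ∫ ω, D T ω ^ 2 ∂μ - ∫ ω, D 0 ω ^ 2 ∂μ := by
  have hle : ∀ i ∈ Finset.range (n + 1), grid T n (i + 1) ≤ T := fun i hi =>
    grid_le T (by have := Finset.mem_range.1 hi; omega)
  have hstep : ∀ i, grid T n i ≤ grid T n (i + 1) := fun i => grid_mono T n (Nat.le_succ i)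
  rw [integral_finsetSum]
  · rw [← sum_grid_sub (fun t => ∫ ω, D t ω ^ 2 ∂μ) T n]
    exact Finset.sum_congr rfl fun i hi => integral_sq_increment hD hT (hstep i) (hle i hi)
  · intro i hi
    exact ((memLp_of_martingale hD hT (hle i hi)).sub
      (memLp_of_martingale hD hT ((hstep i).trans (hle i hi)))).integrable_sq

end MartingaleL2

/-! ### The cost of a strategy -/

namespace Strategy

variable {Ω : Type*} [MeasurableSpace Ω] {μ : Measure Ω} [IsProbabilityMeasure μ]
  {X : SurplusModel μ} {T : ℝ≥0} {R : Strategy Ω}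

omit [IsProbabilityMeasure μ] in
theorem IsAdmissible.martingale_MR (hR : R.IsAdmissible X T) :
    Martingale R.MR X.filtrationM μ := by
  have := hR.compensator.martingale.neg
  refine (congrArg (fun f => Martingale f X.filtrationM μ) ?_).mp this
  ext t ω
  simp [MR]

omit [IsProbabilityMeasure μ] in
theorem IsAdmissible.MR_zero (hR : R.IsAdmissible X T) : ∀ᵐ ω ∂μ, R.MR 0 ω = 0 := by
  filter_upwards [hR.start, hR.compensator.start] with ω h1 h2
  rw [MR, h1, h2, sub_zero]

theorem IsAdmissible.integral_MR (hR : R.IsAdmissible X T) (t : ℝ≥0) :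
    ∫ ω, R.MR t ω ∂μ = 0 := by
  have h := hR.martingale_MR.setIntegral_eq (zero_le (a := t)) MeasurableSet.univ
  rw [setIntegral_univ, setIntegral_univ] at h
  rw [← h, integral_congr_ae hR.MR_zero, integral_zero]

omit [IsProbabilityMeasure μ] in
theorem IsAdmissible.measurable_MR (hR : R.IsAdmissible X T) (t : ℝ≥0) : Measurable (R.MR t) :=
  ((hR.martingale_MR.stronglyMeasurable t).measurable).mono (X.filtrationM.le t) le_rfl

omit [IsProbabilityMeasure μ] in
theorem IsAdmissible.measurable_SR (hR : R.IsAdmissible X T) (t : ℝ≥0) : Measurable (R.SR t) :=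
  (hR.adapted t).mono (X.filtrationM.le t) le_rfl

omit [IsProbabilityMeasure μ] in
theorem IsAdmissible.SR_mem (hR : R.IsAdmissible X T) :
    ∀ᵐ ω ∂μ, ∀ t ≤ T, 0 ≤ R.SR t ω ∧ R.SR t ω ≤ X.S t ω - X.S 0 ω := by
  filter_upwards [hR.pureJump, hR.start, hR.jump_le] with ω h1 h2 h3 t ht
  have := sub_mem_of_jump_le (X.pureJump_S ω) h1 (fun s hs => (h3 s hs).2) (zero_le (a := t)) ht
  have h4 := h1.mono (zero_le (a := t))
  simp only [h2] at this h4
  exact ⟨h4, by linarith [this.1]⟩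

omit [IsProbabilityMeasure μ] in
theorem IsAdmissible.integrable_SR (hR : R.IsAdmissible X T) {t : ℝ≥0} (ht : t ≤ T) :
    Integrable (R.SR t) μ := by
  refine ((X.integrable_S t).sub (X.integrable_S 0)).mono'
    (hR.measurable_SR t).aestronglyMeasurable ?_
  filter_upwards [hR.SR_mem] with ω hω
  rw [Real.norm_eq_abs, abs_of_nonneg (hω t ht).1]
  exact (hω t ht).2

omit [MeasurableSpace Ω] in
theorem AR_eq (R : Strategy Ω) (t : ℝ≥0) : R.AR t = fun ω => R.MR t ω + R.SR t ω := by
  ext ω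
  simp [MR]

omit [IsProbabilityMeasure μ] in
theorem IsAdmissible.integrable_AR (hR : R.IsAdmissible X T) {t : ℝ≥0} (ht : t ≤ T) :
    Integrable (R.AR t) μ := by
  rw [AR_eq]
  exact (hR.martingale_MR.integrable t).add (hR.integrable_SR ht)

/-- The compensator of the retained claims has no jumps up to time `T`. -/
theorem IsAdmissible.jump_AR (hR : R.IsAdmissible X T) :
    ∀ᵐ ω ∂μ, ∀ t ≤ T, jump (fun s => R.AR s ω) t = 0 := by
  refine predictable_jump_eq_zero (Z := R.SR) (Y := X.S) (c := X.meanS) (ℱ := X.filtrationM)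
    hR.compensator.predictable ?_ ?_
    (Eventually.of_forall fun ω => (X.pureJump_S ω).isIncreasingPath) ?_ X.continuous_meanS
    X.meanS_mono (fun t ht => hR.integrable_AR ht) (fun t ht => hR.integrable_SR ht)
    (fun t _ => X.integrable_S t) ?_ fun s hs F hF => X.setIntegral_S_sub hs hF
  · filter_upwards [hR.compensator.mono, hR.compensator.cadlag] with ω h1 h2
    exact ⟨h1, fun t => (h2 t).1⟩
  · filter_upwards [hR.pureJump] with ω h using h.isIncreasingPath
  · filter_upwards [hR.pureJump, hR.jump_le] with ω h1 h3 s t hst ht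
    have := sub_mem_of_jump_le (X.pureJump_S ω) h1 (fun s hs => (h3 s hs).2) hst ht
    linarith [this.1]
  · intro s hs F hF
    have h := hR.martingale_MR.setIntegral_eq hs hF
    simp only [MR] at h
    have i : ∀ t ≤ T, IntegrableOn (R.AR t) F μ := fun t ht => (hR.integrable_AR ht).integrableOn
    have j : ∀ t ≤ T, IntegrableOn (R.SR t) F μ := fun t ht => (hR.integrable_SR ht).integrableOn
    rw [integral_sub (i s hs) (j s hs), integral_sub (i T le_rfl) (j T le_rfl)] at h
    rw [integral_sub (i T le_rfl) (i s hs), integral_sub (j T le_rfl) (j s hs)]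
    linarith

theorem memLp_S_zero (X : SurplusModel μ) : MemLp (X.S 0) 2 μ :=
  (memLp_const (X.meanS 0)).ae_eq (by filter_upwards [X.S_zero] with ω h using h.symm)

theorem memLp_M (X : SurplusModel μ) (hL2 : MemLp (X.S T) 2 μ) : MemLp (X.M T) 2 μ :=
  (memLp_const (X.meanS T)).sub hL2

theorem IsAdmissible.memLp_SR (hR : R.IsAdmissible X T) (hL2 : MemLp (X.S T) 2 μ) :
    MemLp (R.SR T) 2 μ := by
  refine (hL2.sub (memLp_S_zero X)).mono (hR.measurable_SR T).aestronglyMeasurable ?_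
  filter_upwards [hR.SR_mem] with ω hω
  have := hω T le_rfl
  rw [Real.norm_eq_abs, Real.norm_eq_abs, abs_of_nonneg this.1]
  exact this.2.trans (le_abs_self _)

/-- The cost of a strategy is the squared `L²`-distance of the terminal martingale parts. -/
theorem IsAdmissible.cost_eq (hR : R.IsAdmissible X T) (hL2 : MemLp (X.S T) 2 μ)
    (hMR : MemLp (R.MR T) 2 μ) :
    R.cost X T = ENNReal.ofReal (∫ ω, (R.MR T ω - X.M T ω) ^ 2 ∂μ) := by
  let D : ℝ≥0 → Ω → ℝ := fun t ω => X.M t ω - R.MR t ω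
  have hD : Martingale D X.filtrationM μ := X.martingale_M.sub hR.martingale_MR
  have hDT : MemLp (D T) 2 μ := (memLp_M X hL2).sub hMR
  let J : Ω → ℝ := fun ω => ∑' s, indicator (Ioc 0 T)
    (fun s => (jump (fun s => R.SR s ω) s - jump (fun s => X.S s ω) s) ^ 2) s
  -- The quadratic sums along the grids have the same expectation `E[D_T²]` for every `n`. Pathwise
  -- they tend to the sum `J` of squared jumps and stay below the integrable `B`.
  let V : ℕ → Ω → ℝ := fun n ω => ∑ i ∈ Finset.range (n + 1),
    (D (grid T n (i + 1)) ω - D (grid T n i) ω) ^ 2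
  let B : Ω → ℝ := fun ω => ((X.S T ω + X.meanS T + R.AR T ω) -
    (X.S 0 ω + X.meanS 0 + R.AR 0 ω)) ^ 2
  have hgood : ∀ᵐ ω ∂μ, (∀ n, 0 ≤ V n ω ∧ V n ω ≤ B ω) ∧
      Tendsto (fun n => V n ω) atTop (𝓝 (J ω)) := by
    filter_upwards [hR.pureJump, hR.jump_le, hR.compensator.mono, hR.compensator.cadlag,
      hR.jump_AR] with ω h1 h2 h3 h4 h5
    -- The compensator is known to be continuous only up to `T`; stopping it there makes it
    -- continuous on the whole time axis.
    let q : ℝ≥0 → ℝ := stopAt (fun t => R.AR t ω) T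
    have hqm : Monotone q := fun s t hst => h3 (min_le_min_right T hst)
    have hqc : Continuous q := by
      refine (h4.stopAt T).continuous_of_jump_eq_zero fun t => ?_
      rcases le_or_gt t T with h | h
      · rw [jump_stopAt_of_le _ h, h5 t h]
      · exact jump_stopAt_of_lt _ h
    have hq : ∀ t ≤ T, q t = R.AR t ω := fun t ht => by simp [q, stopAt, min_eq_left ht]
    have hj : ∀ s ≤ T, jump (fun s => R.SR s ω) s ≤ jump (fun s => X.S s ω) s :=
      fun s hs => (h2 s hs).2
    have hV : ∀ n, V n ω = ∑ i ∈ Finset.range (n + 1),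
      (((X.meanS (grid T n (i + 1)) - X.S (grid T n (i + 1)) ω) -
          (q (grid T n (i + 1)) - R.SR (grid T n (i + 1)) ω)) -
        ((X.meanS (grid T n i) - X.S (grid T n i) ω) - (q (grid T n i) - R.SR (grid T n i) ω))) ^ 2 := by
      intro n
      refine Finset.sum_congr rfl fun i hi => ?_
      have hi' := Finset.mem_range.1 hi
      rw [hq _ (grid_le T (by omega)), hq _ (grid_le T (by omega))]
      rfl
    constructor
    · refine fun n => ⟨Finset.sum_nonneg fun i _ => sq_nonneg _, ?_⟩
      rw [hV n]
      have := sum_sq_le (p := X.meanS) (q := q) (X.pureJump_S ω) h1 hj X.meanS_mono hqm n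
      rwa [hq T le_rfl, hq 0 zero_le] at this
    · have := tendsto_sum_sq (y := fun s => X.S s ω) (w := fun s => R.SR s ω)
        (p := X.meanS) (q := q)
        (X.pureJump_S ω) h1 hj X.meanS_mono hqm X.continuous_meanS hqc
      exact this.congr fun n => (hV n).symm
  have hDm : ∀ t, AEStronglyMeasurable (D t) μ := fun t =>
    ((X.measurable_M t).sub (hR.measurable_MR t)).aestronglyMeasurable
  have hVm : ∀ n, AEStronglyMeasurable (V n) μ := fun n =>
    Finset.aestronglyMeasurable_fun_sum _ fun i _ => ((hDm _).sub (hDm _)).pow 2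
  have hBi : Integrable B μ := by
    have hA : MemLp (R.AR T) 2 μ := by
      rw [AR_eq]
      exact hMR.add (hR.memLp_SR hL2)
    have hA0 : MemLp (R.AR 0) 2 μ :=
      (memLp_const (0 : ℝ)).ae_eq (by filter_upwards [hR.compensator.start] with ω h using h.symm)
    exact (((hL2.add (memLp_const (X.meanS T))).add hA).sub
      (((memLp_S_zero X).add (memLp_const (X.meanS 0))).add hA0)).integrable_sq
  have hJlim : Tendsto (fun n => ∫ ω, V n ω ∂μ) atTop (𝓝 (∫ ω, J ω ∂μ)) := by
    refine tendsto_integral_of_dominated_convergence B hVm hBi (fun n => ?_) ?_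
    · filter_upwards [hgood] with ω hω
      rw [Real.norm_eq_abs, abs_of_nonneg (hω.1 n).1]
      exact (hω.1 n).2
    · filter_upwards [hgood] with ω hω using hω.2
  have hconst : ∀ n, ∫ ω, V n ω ∂μ = ∫ ω, D T ω ^ 2 ∂μ := by
    intro n
    have h0 : ∫ ω, D 0 ω ^ 2 ∂μ = 0 := by
      rw [← integral_zero Ω ℝ (μ := μ)]
      refine integral_congr_ae ?_
      filter_upwards [hR.MR_zero, X.S_zero] with ω a1 a2
      simp [D, a1, a2, X.M_eq]
    have := integral_sum_sq_grid hD hDT n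
    rw [h0, sub_zero] at this
    exact this
  simp_rw [hconst] at hJlim
  have hJ : ∫ ω, J ω ∂μ = ∫ ω, D T ω ^ 2 ∂μ := tendsto_nhds_unique hJlim tendsto_const_nhds
  have hJm : AEStronglyMeasurable J μ :=
    aestronglyMeasurable_of_tendsto_ae atTop hVm (by filter_upwards [hgood] with ω hω using hω.2)
  have hJ0 : ∀ᵐ ω ∂μ, 0 ≤ J ω ∧ J ω ≤ B ω := by
    filter_upwards [hgood] with ω hω
    exact ⟨ge_of_tendsto' hω.2 fun n => (hω.1 n).1, le_of_tendsto' hω.2 fun n => (hω.1 n).2⟩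
  have hJi : Integrable J μ := by
    refine hBi.mono' hJm ?_
    filter_upwards [hJ0] with ω hω
    rw [Real.norm_eq_abs, abs_of_nonneg hω.1]
    exact hω.2
  have e : ∫ ω, (R.MR T ω - X.M T ω) ^ 2 ∂μ = ∫ ω, J ω ∂μ := by
    rw [hJ]
    refine integral_congr_ae (Eventually.of_forall fun ω => ?_)
    simp only [D]
    ring
  rw [e, ofReal_integral_eq_lintegral_ofReal hJi (by filter_upwards [hJ0] with ω hω using hω.1)]
  refine lintegral_congr_ae ?_
  filter_upwards [hR.pureJump, hR.jump_le] with ω h1 h2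
  exact tsum_ofReal_sq_jump (X.pureJump_S ω) h1 fun s hs => (h2 s hs).2

end Strategy


/-! ### Optimality of monotone couplings -/

section Transport

variable {F : ℝ → ℝ} (hF : Continuous F) (hFm : Monotone F)

/-- The convex primitive of a monotone function. -/
def potential (F : ℝ → ℝ) (x : ℝ) : ℝ := ∫ t in (0 : ℝ)..x, F t

/-- The convex conjugate of the primitive. -/
def conjugatePotential (F : ℝ → ℝ) (y : ℝ) : ℝ := ⨆ q : ℚ, ((q : ℝ) * y - potential F q)

include hF in
theorem hasDerivAt_potential (x : ℝ) : HasDerivAt (potential F) (F x) x :=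
  (hF.integral_hasStrictDerivAt 0 x).hasDerivAt

include hF in
theorem continuous_potential : Continuous (potential F) :=
  continuous_iff_continuousAt.2 fun x => (hasDerivAt_potential hF x).continuousAt

include hF hFm in
-- The primitive of a non-decreasing function is convex, with slope `F x` at `x`.
theorem potential_tangent (x z : ℝ) : potential F x + F x * (z - x) ≤ potential F z := by
  have hi : ∀ a b, IntervalIntegrable F volume a b := fun a b => hF.intervalIntegrable a b
  have e : potential F z - potential F x = ∫ t in x..z, F t :=
    intervalIntegral.integral_interval_sub_left (hi 0 z) (hi 0 x)
  have h : F x * (z - x) ≤ ∫ t in x..z, F t := by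
    rcases le_total x z with hxz | hxz
    · have := intervalIntegral.integral_mono_on hxz (intervalIntegrable_const (c := F x)) (hi x z)
        fun t ht => hFm ht.1
      rw [intervalIntegral.integral_const, smul_eq_mul] at this
      linarith
    · have := intervalIntegral.integral_mono_on hxz (hi z x) (intervalIntegrable_const (c := F x))
        fun t ht => hFm ht.2
      rw [intervalIntegral.integral_const, smul_eq_mul] at this
      rw [intervalIntegral.integral_symm]
      linarith
  linarith

/-- Taking the supremum over rationals only makes this a countable supremum of measurable functions.
-/
theorem measurable_conjugatePotential : Measurable (conjugatePotential F) :=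
  Measurable.iSup fun _ => (measurable_id.const_mul _).sub_const _

include hF hFm in
-- Density of the rationals extends the bound to real `z`. For `y` in the range of `F` the tangent
-- inequality bounds the supremum; elsewhere it may be unbounded and `⨆` only a default value.
theorem le_conjugatePotential {y : ℝ} (hy : y ∈ range F) (z : ℝ) :
    z * y - potential F z ≤ conjugatePotential F y := by
  obtain ⟨x, rfl⟩ := hy
  have hb : BddAbove (range fun q : ℚ => (q : ℝ) * F x - potential F q) := by
    refine ⟨x * F x - potential F x, ?_⟩
    rintro _ ⟨q, rfl⟩
    have := potential_tangent hF hFm x q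
    simp only
    linarith
  have hc : IsClosed {z : ℝ | z * F x - potential F z ≤ conjugatePotential F (F x)} :=
    isClosed_le ((continuous_id.mul continuous_const).sub (continuous_potential hF))
      continuous_const
  exact Rat.denseRange_cast.induction_on z hc fun q => le_ciSup hb q

include hF hFm in
theorem conjugatePotential_apply (x : ℝ) :
    conjugatePotential F (F x) = x * F x - potential F x := by
  refine le_antisymm (ciSup_le fun q => ?_) (le_conjugatePotential hF hFm (mem_range_self x) x)
  have := potential_tangent hF hFm x q
  linarith

include hF hFm in
-- Equality in Young's inequality makes `x` a minimum of `z ↦ potential F z - z * y`, whose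
-- derivative `F x - y` must vanish.
theorem eq_of_conjugatePotential_eq {x y : ℝ} (hy : y ∈ range F)
    (h : potential F x + conjugatePotential F y = x * y) : y = F x := by
  have hmin : IsLocalMin (fun z => potential F z - z * y) x :=
    Eventually.of_forall fun z => by
      have := le_conjugatePotential hF hFm hy z
      simp only
      linarith
  have hd : HasDerivAt (fun z => potential F z - z * y) (F x - 1 * y) x :=
    (hasDerivAt_potential hF x).sub ((hasDerivAt_id x).mul_const y)
  have := hmin.hasDerivAt_eq_zero hd
  linarith

variable {Ω : Type*} [MeasurableSpace Ω] {μ : Measure Ω} [IsProbabilityMeasure μ] {V Y : Ω → ℝ}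

include hF hFm in
-- The tangents at `0` and at `V` enclose the potential between `F 0 * V` and `V * F V`.
theorem integrable_potential (hV : MemLp V 2 μ) (hFV : MemLp (fun ω => F (V ω)) 2 μ) :
    Integrable (fun ω => potential F (V ω)) μ := by
  have h1 : Integrable (fun ω => |F 0 * V ω| + |V ω * F (V ω)|) μ :=
    (((hV.integrable one_le_two).const_mul (F 0)).abs).add (hV.integrable_mul hFV).abs
  refine h1.mono' ((continuous_potential hF).comp_aestronglyMeasurable hV.1)
    (Eventually.of_forall fun ω => ?_)
  have a1 := potential_tangent hF hFm 0 (V ω)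
  have a2 := potential_tangent hF hFm (V ω) 0
  have a0 : potential F 0 = 0 := intervalIntegral.integral_same
  rw [a0] at a1 a2
  rw [Real.norm_eq_abs, abs_le]
  constructor
  · linarith [neg_abs_le (F 0 * V ω), abs_nonneg (V ω * F (V ω))]
  · linarith [le_abs_self (V ω * F (V ω)), abs_nonneg (F 0 * V ω)]

include hF hFm in
/-- Among all random variables with the law of `F(V)`, `F` non-decreasing, the variable `F(V)`
itself is the unique one that is closest to `V` in `L²`. -/
theorem monotone_coupling_optimal (hV : MemLp V 2 μ) (hY : MemLp Y 2 μ)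
    (hFV : MemLp (fun ω => F (V ω)) 2 μ) (hlaw : μ.map Y = μ.map fun ω => F (V ω)) :
    ∫ ω, (F (V ω) - V ω) ^ 2 ∂μ ≤ ∫ ω, (Y ω - V ω) ^ 2 ∂μ ∧
      (∫ ω, (Y ω - V ω) ^ 2 ∂μ ≤ ∫ ω, (F (V ω) - V ω) ^ 2 ∂μ → Y =ᵐ[μ] fun ω => F (V ω)) := by
  have hYm := hY.1.aemeasurable
  have hFVm := hFV.1.aemeasurable
  have hrange : MeasurableSet (range F) := by
    have : OrdConnected (range F) := (isPreconnected_range hF).ordConnected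
    exact this.measurableSet
  -- `Y` inherits from its law that it lives on the interval `range F`, where the conjugate obeys
  -- Young's inequality.
  have hYr : ∀ᵐ ω ∂μ, Y ω ∈ range F := by
    have h1 : ∀ᵐ y ∂(μ.map fun ω => F (V ω)), y ∈ range F :=
      (ae_map_iff hFVm hrange).2 (Eventually.of_forall fun ω => mem_range_self _)
    rw [← hlaw] at h1
    exact (ae_map_iff hYm hrange).1 h1
  have htransfer : ∀ {G : ℝ → ℝ}, Measurable G →
      ∫ ω, G (Y ω) ∂μ = ∫ ω, G (F (V ω)) ∂μ := fun {G} hG => by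
    rw [← integral_map hYm hG.aestronglyMeasurable, hlaw,
      integral_map hFVm hG.aestronglyMeasurable]
  have hint : ∀ {G : ℝ → ℝ}, Measurable G → Integrable (fun ω => G (F (V ω))) μ →
      Integrable (fun ω => G (Y ω)) μ := fun {G} hG h => by
    have h1 := (integrable_map_measure (f := fun ω => F (V ω)) hG.aestronglyMeasurable hFVm).2 h
    rw [← hlaw] at h1
    exact (integrable_map_measure hG.aestronglyMeasurable hYm).1 h1
  have iφ := integrable_potential hF hFm hV hFV
  have iVF : Integrable (fun ω => V ω * F (V ω)) μ := hV.integrable_mul hFV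
  have iVY : Integrable (fun ω => V ω * Y ω) μ := hV.integrable_mul hY
  have iGF : Integrable (fun ω => conjugatePotential F (F (V ω))) μ := by
    simp_rw [conjugatePotential_apply hF hFm]
    exact iVF.sub iφ
  have iG := hint measurable_conjugatePotential iGF
  have hyoung : ∀ᵐ ω ∂μ, 0 ≤ potential F (V ω) + conjugatePotential F (Y ω) - V ω * Y ω := by
    filter_upwards [hYr] with ω hω
    have := le_conjugatePotential hF hFm hω (V ω)
    linarith
  have igap : Integrable
      (fun ω => potential F (V ω) + conjugatePotential F (Y ω) - V ω * Y ω) μ :=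
    (iφ.add iG).sub iVY
  -- The conjugate term depends on the law of `Y` only, so the expected Young gap is half the
  -- difference of the two squared distances.
  have hgap : ∫ ω, (potential F (V ω) + conjugatePotential F (Y ω) - V ω * Y ω) ∂μ =
      ∫ ω, V ω * F (V ω) ∂μ - ∫ ω, V ω * Y ω ∂μ := by
    have iφG : Integrable (fun ω => potential F (V ω) + conjugatePotential F (Y ω)) μ := iφ.add iG
    rw [integral_sub iφG iVY, integral_add iφ iG, htransfer measurable_conjugatePotential]
    simp_rw [conjugatePotential_apply hF hFm]
    rw [integral_sub iVF iφ]
    ring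
  have hsq : ∫ ω, Y ω ^ 2 ∂μ = ∫ ω, F (V ω) ^ 2 ∂μ :=
    htransfer (G := fun x => x ^ 2) (measurable_id.pow_const 2)
  have hexp : ∀ {Z : Ω → ℝ}, MemLp Z 2 μ → ∫ ω, (Z ω - V ω) ^ 2 ∂μ =
      ∫ ω, Z ω ^ 2 ∂μ + ∫ ω, V ω ^ 2 ∂μ - 2 * ∫ ω, V ω * Z ω ∂μ := fun {Z} hZ => by
    have i1 : Integrable (fun ω => Z ω ^ 2) μ := hZ.integrable_sq
    have i2 : Integrable (fun ω => V ω ^ 2) μ := hV.integrable_sq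
    have i3 : Integrable (fun ω => V ω * Z ω) μ := hV.integrable_mul hZ
    have i12 : Integrable (fun ω => Z ω ^ 2 + V ω ^ 2) μ := i1.add i2
    rw [← integral_const_mul, ← integral_add i1 i2, ← integral_sub i12 (i3.const_mul 2)]
    refine integral_congr_ae (Eventually.of_forall fun ω => ?_)
    simp only
    ring
  rw [hexp hY, hexp hFV, hsq]
  refine ⟨?_, fun h => ?_⟩
  · have := integral_nonneg_of_ae hyoung
    rw [hgap] at this
    linarith
  · have h0 : ∫ ω, (potential F (V ω) + conjugatePotential F (Y ω) - V ω * Y ω) ∂μ = 0 := by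
      refine le_antisymm ?_ (integral_nonneg_of_ae hyoung)
      rw [hgap]
      linarith
    have h1 := (integral_eq_zero_iff_of_nonneg_ae hyoung igap).1 h0
    filter_upwards [h1, hYr] with ω a1 a2
    refine eq_of_conjugatePotential_eq hF hFm a2 ?_
    rw [Pi.zero_apply] at a1
    linarith

end Transport

/-! ### Quantile functions -/

section QuantileFunction

variable (P : Measure ℝ) [IsProbabilityMeasure P]

omit [IsProbabilityMeasure P] in
theorem quantile_le_iff {u : ℝ} (hu : u ∈ Ioo (0 : ℝ) 1) (x : ℝ) :
    quantile P u ≤ x ↔ u ≤ cdf P x := by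
  have hbdd : BddBelow {x : ℝ | u ≤ cdf P x} := by
    obtain ⟨a, ha⟩ := ((tendsto_cdf_atBot P).eventually_lt_const hu.1).exists_forall_of_atBot
    refine ⟨a, fun y hy => ?_⟩
    by_contra h
    exact absurd (ha y (not_le.1 h).le) (not_lt.2 hy)
  have hne : {x : ℝ | u ≤ cdf P x}.Nonempty := by
    obtain ⟨a, ha⟩ := ((tendsto_cdf_atTop P).eventually_const_lt hu.2).exists
    exact ⟨a, le_of_lt ha⟩
  refine ⟨fun h => ?_, fun h => csInf_le hbdd h⟩
  refine le_trans ?_ (monotone_cdf P h)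
  refine ge_of_tendsto (x := 𝓝[>] (quantile P u)) (f := cdf P) ?_ ?_
  · exact ((cdf P).right_continuous _).mono Ioi_subset_Ici_self
  · filter_upwards [self_mem_nhdsWithin] with y hy
    obtain ⟨z, hz, hzy⟩ := exists_lt_of_csInf_lt hne hy
    exact le_trans hz (monotone_cdf P hzy.le)

omit [IsProbabilityMeasure P] in
theorem le_cdf_quantile {u : ℝ} (hu : u ∈ Ioo (0 : ℝ) 1) : u ≤ cdf P (quantile P u) :=
  (quantile_le_iff P hu _).1 le_rfl

omit [IsProbabilityMeasure P] in
theorem quantile_mono {u v : ℝ} (hu : u ∈ Ioo (0 : ℝ) 1) (hv : v ∈ Ioo (0 : ℝ) 1) (huv : u ≤ v) :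
    quantile P u ≤ quantile P v :=
  (quantile_le_iff P hu _).2 (huv.trans (le_cdf_quantile P hv))

omit [IsProbabilityMeasure P] in
theorem monotoneOn_quantile : MonotoneOn (quantile P) (Ioo 0 1) :=
  fun _ hu _ hv huv => quantile_mono P hu hv huv

omit [IsProbabilityMeasure P] in
theorem aemeasurable_quantile : AEMeasurable (quantile P) (volume.restrict (Ioo (0 : ℝ) 1)) :=
  aemeasurable_restrict_of_monotoneOn measurableSet_Ioo (monotoneOn_quantile P)

instance isProbabilityMeasure_uniform :
    IsProbabilityMeasure (volume.restrict (Ioo (0 : ℝ) 1)) :=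
  ⟨by simp⟩

theorem lawOfQuantile_quantile : lawOfQuantile (quantile P) = P := by
  have hm := aemeasurable_quantile P
  have : IsProbabilityMeasure (lawOfQuantile (quantile P)) := Measure.isProbabilityMeasure_map hm
  refine Measure.ext_of_Iic _ _ fun x => ?_
  rw [lawOfQuantile, Measure.map_apply_of_aemeasurable hm measurableSet_Iic,
    Measure.restrict_apply' measurableSet_Ioo]
  have h01 : cdf P x ∈ Icc (0 : ℝ) 1 := ⟨cdf_nonneg P x, cdf_le_one P x⟩
  have e : quantile P ⁻¹' Iic x ∩ Ioo 0 1 = Iic (cdf P x) ∩ Ioo 0 1 := by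
    ext u
    simp only [mem_inter_iff, mem_preimage, mem_Iic]
    exact and_congr_left fun hu => quantile_le_iff P hu x
  have h1 : volume (Iic (cdf P x) ∩ Ioo (0 : ℝ) 1) = ENNReal.ofReal (cdf P x) := by
    refine le_antisymm ?_ ?_
    · calc volume (Iic (cdf P x) ∩ Ioo (0 : ℝ) 1) ≤ volume (Ioc 0 (cdf P x)) :=
            measure_mono fun u hu => ⟨hu.2.1, hu.1⟩
        _ = _ := by rw [Real.volume_Ioc, sub_zero]
    · calc ENNReal.ofReal (cdf P x) = volume (Ioo 0 (cdf P x)) := by rw [Real.volume_Ioo, sub_zero]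
        _ ≤ _ := measure_mono fun u hu => (⟨hu.2.le, hu.1, hu.2.trans_le h01.2⟩ :
            u ∈ Iic (cdf P x) ∩ Ioo 0 1)
  rw [e, h1, ofReal_cdf]

theorem ae_exists_quantile : ∀ᵐ x ∂P, ∃ u ∈ Ioo (0 : ℝ) 1, quantile P u = x := by
  have hm := aemeasurable_quantile P
  have hmeas : MeasurableSet (quantile P '' Ioo 0 1) :=
    measurableSet_Ioo.image_of_monotoneOn (monotoneOn_quantile P)
  have h : ∀ᵐ x ∂(lawOfQuantile (quantile P)), x ∈ quantile P '' Ioo 0 1 :=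
    (ae_map_iff hm hmeas).2 (by
      filter_upwards [ae_restrict_mem measurableSet_Ioo] with u hu using mem_image_of_mem _ hu)
  rwa [lawOfQuantile_quantile] at h

omit [IsProbabilityMeasure P] in
-- If `a < quantile P u`, then `cdf P a < u`, and levels between these two have quantiles above `a`.
theorem tendsto_quantile_left {u : ℝ} (hu : u ∈ Ioo (0 : ℝ) 1) :
    Tendsto (quantile P) (𝓝[<] u) (𝓝 (quantile P u)) := by
  have hnear : ∀ᶠ v in 𝓝[<] u, v ∈ Ioo (0 : ℝ) 1 ∧ v < u := by
    filter_upwards [Ioo_mem_nhdsLT hu.1] with v hv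
    exact ⟨⟨hv.1, hv.2.trans hu.2⟩, hv.2⟩
  refine tendsto_order.2 ⟨fun a ha => ?_, fun a ha => ?_⟩
  · have hlt : cdf P a < u := not_le.1 fun h => not_le.2 ha ((quantile_le_iff P hu a).2 h)
    filter_upwards [hnear, Ioo_mem_nhdsLT hlt] with v hv hv'
    exact not_le.1 fun h => not_le.2 hv'.1 ((quantile_le_iff P hv.1 a).1 h)
  · filter_upwards [hnear] with v hv
    exact (quantile_mono P hv.1 hu hv.2.le).trans_lt ha

/-- `Q` increases on `(0,1)`, but not faster than the quantile function of `P`. -/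
def IsDominatedBy (P : Measure ℝ) (Q : ℝ → ℝ) : Prop :=
  ∀ x y : ℝ, 0 < y → y < x → x < 1 → 0 ≤ Q x - Q y ∧ Q x - Q y ≤ quantile P x - quantile P y

variable {P}

omit [IsProbabilityMeasure P] in
-- At an atom of `P` the level `cdf P (quantile P u)` may exceed `u`. Between the two levels the
-- quantile function is constant, hence so is `Q`; if the upper level is 1, the left limit in
-- `evalLevel` takes the same value.
theorem IsDominatedBy.evalLevel_cdf {Q : ℝ → ℝ} (hQ : IsDominatedBy P Q) {u : ℝ}
    (hu : u ∈ Ioo (0 : ℝ) 1) : evalLevel Q (cdf P (quantile P u)) = Q u := by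
  have hle := le_cdf_quantile P hu
  have key : ∀ w, u ≤ w → w < 1 → w ≤ cdf P (quantile P u) → Q w = Q u := by
    intro w huw hw1 hw
    rcases huw.eq_or_lt with rfl | h
    · rfl
    · have h1 := hQ w u hu.1 h hw1
      have h2 : quantile P w ≤ quantile P u := (quantile_le_iff P ⟨hu.1.trans h, hw1⟩ _).2 hw
      linarith [h1.1, h1.2]
  rw [evalLevel]
  split_ifs with h
  · exact key _ hle h le_rfl
  · refine leftLim_eq_of_tendsto (tendsto_const_nhds.congr' ?_)
    filter_upwards [Ioo_mem_nhdsLT hu.2] with w hw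
    exact (key w hw.1.le hw.2 (hw.2.le.trans (not_lt.1 h))).symm

omit [IsProbabilityMeasure P] in
theorem isDominatedBy_comp {F : ℝ → ℝ} (hF : LipschitzWith 1 F) (hFm : Monotone F) :
    IsDominatedBy P fun u => F (quantile P u) := by
  intro x y h0 hyx h1
  have hq := quantile_mono P ⟨h0, hyx.trans h1⟩ ⟨h0.trans hyx, h1⟩ hyx.le
  refine ⟨sub_nonneg.2 (hFm hq), ?_⟩
  have := hF.dist_le_mul (quantile P x) (quantile P y)
  rw [Real.dist_eq, Real.dist_eq, NNReal.coe_one, one_mul, abs_of_nonneg (sub_nonneg.2 hq)] at this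
  exact (le_abs_self _).trans this

omit [IsProbabilityMeasure P] in
theorem IsDominatedBy.exists_lipschitz {Q : ℝ → ℝ} (hQ : IsDominatedBy P Q) :
    ∃ F : ℝ → ℝ, LipschitzWith 1 F ∧ Monotone F ∧ ∀ u ∈ Ioo (0 : ℝ) 1, Q u = F (quantile P u) := by
  let q := quantile P
  have hQ' : ∀ u ∈ Ioo (0 : ℝ) 1, ∀ v ∈ Ioo (0 : ℝ) 1, Q u - Q v ≤ max (q u - q v) 0 := by
    intro u hu v hv
    rcases lt_trichotomy u v with h | rfl | h
    · exact (by linarith [(hQ v u hu.1 h hv.2).1] : Q u - Q v ≤ 0).trans (le_max_right _ _)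
    · simp
    · exact (hQ u v hv.1 h hu.2).2.trans (le_max_left _ _)
  -- McShane's extension, with the positive part in place of the distance: the infimum over `u` is
  -- then both 1-Lipschitz and non-decreasing.
  let G : ℝ → Ioo (0 : ℝ) 1 → ℝ := fun x u => Q u + max (x - q u) 0
  have hhalf : (1 / 2 : ℝ) ∈ Ioo (0 : ℝ) 1 := by constructor <;> norm_num
  have : Nonempty (Ioo (0 : ℝ) 1) := ⟨⟨1 / 2, hhalf⟩⟩
  have hb : ∀ x, BddBelow (range (G x)) := by
    intro x
    refine ⟨Q (1 / 2) - max (q (1 / 2) - x) 0, ?_⟩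
    rintro _ ⟨u, rfl⟩
    have h1 := hQ' (1 / 2) hhalf u u.2
    have h2 : max (q (1 / 2) - q u) 0 ≤ max (q (1 / 2) - x) 0 + max (x - q u) 0 := by
      refine max_le ?_ (by positivity)
      linarith [le_max_left (q (1 / 2) - x) 0, le_max_left (x - q u) 0]
    simp only [G]
    linarith
  have hGm : ∀ u, Monotone fun x => G x u := fun u x y hxy => by
    simp only [G]
    gcongr
  have hmono : Monotone fun x => ⨅ u, G x u := fun x y hxy =>
    ciInf_mono (hb x) fun u => hGm u hxy
  have hadd : ∀ x d, 0 ≤ d → (⨅ u, G (x + d) u) ≤ (⨅ u, G x u) + d := by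
    intro x d hd
    rw [← sub_le_iff_le_add]
    refine le_ciInf fun u => ?_
    rw [sub_le_iff_le_add]
    refine (ciInf_le (hb (x + d)) u).trans ?_
    simp only [G]
    rw [add_assoc]
    gcongr
    refine max_le ?_ (by positivity)
    linarith [le_max_left (x - q u) 0]
  refine ⟨fun x => ⨅ u, G x u, ?_, hmono, fun u hu => ?_⟩
  · refine LipschitzWith.of_le_add_mul 1 fun x y => ?_
    rw [NNReal.coe_one, one_mul]
    rcases le_total x y with h | h
    · linarith [hmono h, dist_nonneg (x := x) (y := y)]
    · have := hadd y (x - y) (sub_nonneg.2 h)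
      rw [add_sub_cancel] at this
      rw [Real.dist_eq, abs_of_nonneg (sub_nonneg.2 h)]
      exact this
  · refine le_antisymm (le_ciInf fun v => ?_) ?_
    · have := hQ' u hu v v.2
      simp only [G]
      linarith
    · refine (ciInf_le (hb _) ⟨u, hu⟩).trans ?_
      simp [G, q]

section Composition

variable {Q F : ℝ → ℝ} (hF : Continuous F) (hQF : ∀ u ∈ Ioo (0 : ℝ) 1, Q u = F (quantile P u))

include hQF in
omit [IsProbabilityMeasure P] in
theorem ae_eq_comp_quantile :
    Q =ᵐ[volume.restrict (Ioo (0 : ℝ) 1)] fun u => F (quantile P u) := by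
  filter_upwards [ae_restrict_mem measurableSet_Ioo] with u hu using hQF u hu

include hF hQF in
theorem lawOfQuantile_comp : lawOfQuantile Q = P.map F := by
  rw [lawOfQuantile, Measure.map_congr (ae_eq_comp_quantile hQF)]
  conv_rhs => rw [← lawOfQuantile_quantile P]
  rw [lawOfQuantile, AEMeasurable.map_map_of_aemeasurable hF.measurable.aemeasurable
    (aemeasurable_quantile P)]
  rfl

include hF hQF in
theorem memLp_comp_iff :
    MemLp Q 2 (volume.restrict (Ioo (0 : ℝ) 1)) ↔ MemLp F 2 P := by
  conv_rhs => rw [← lawOfQuantile_quantile P]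
  rw [memLp_congr_ae (ae_eq_comp_quantile hQF), lawOfQuantile,
    memLp_map_measure_iff hF.aestronglyMeasurable (aemeasurable_quantile P)]
  rfl

theorem integral_comp_quantile {G : ℝ → ℝ} (hG : Continuous G) :
    ∫ u in Ioo (0 : ℝ) 1, G (quantile P u) = ∫ x, G x ∂P := by
  conv_rhs => rw [← lawOfQuantile_quantile P]
  rw [lawOfQuantile, integral_map (aemeasurable_quantile P) hG.aestronglyMeasurable]

theorem ae_evalLevel_eq (hQ : IsDominatedBy P Q)
    (hQF : ∀ u ∈ Ioo (0 : ℝ) 1, Q u = F (quantile P u)) :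
    ∀ᵐ x ∂P, evalLevel Q (cdf P x) = F x := by
  filter_upwards [ae_exists_quantile P] with x hx
  obtain ⟨u, hu, rfl⟩ := hx
  rw [hQ.evalLevel_cdf hu, hQF u hu]

omit hF in
-- A difference at `u` would persist, by left-continuity of the quantile function, on an interval
-- ending at `u`, which has positive measure.
theorem eq_quantile_of_ae_eq {F' : ℝ → ℝ} (hF : Continuous F) (hF' : Continuous F')
    (h : F =ᵐ[P] F') {u : ℝ} (hu : u ∈ Ioo (0 : ℝ) 1) : F (quantile P u) = F' (quantile P u) := by
  have h1 : ∀ᵐ v ∂(volume.restrict (Ioo (0 : ℝ) 1)), F (quantile P v) = F' (quantile P v) := by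
    rw [← lawOfQuantile_quantile P] at h
    exact ae_of_ae_map (aemeasurable_quantile P) h
  by_contra hne
  have hq := tendsto_quantile_left P hu
  have hev : ∀ᶠ v in 𝓝[<] u, F (quantile P v) - F' (quantile P v) ≠ 0 :=
    (((hF.tendsto _).comp hq).sub ((hF'.tendsto _).comp hq)).eventually_ne (sub_ne_zero.2 hne)
  obtain ⟨a, ha, hsub⟩ := (mem_nhdsLT_iff_exists_mem_Ico_Ioo_subset hu.1).1 hev
  rw [ae_restrict_iff' measurableSet_Ioo] at h1
  have h2 : volume (Ioo a u) = 0 := by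
    refine measure_mono_null
      (t := {v | ¬(v ∈ Ioo (0 : ℝ) 1 → F (quantile P v) = F' (quantile P v))})
      (fun v hv hv' => hsub hv (sub_eq_zero.2 (hv' ⟨ha.1.trans_lt hv.1, hv.2.trans hu.2⟩))) h1
  rw [Real.volume_Ioo, ENNReal.ofReal_eq_zero] at h2
  linarith [ha.2]

end Composition

end QuantileFunction


theorem IsValueFunction.continuous_space {k : ℝ≥0 → ℝ → ℝ} (hk : IsValueFunction k) (t : ℝ≥0) :
    Continuous (k t) :=
  (LipschitzWith.of_dist_le_mul (K := 1) fun a b => by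
    rw [NNReal.coe_one, one_mul]
    exact hk.abs_sub_le t a b).continuous

/-! ### The strategy generated by a monotone Lipschitz function of the terminal value. -/

section Bass

variable {Ω : Type*} [MeasurableSpace Ω] {μ : Measure Ω} [IsProbabilityMeasure μ]
  (X : SurplusModel μ) {F : ℝ → ℝ} (hF : LipschitzWith 1 F) (hFm : Monotone F) (T : ℝ≥0) (c : ℝ)

instance : IsProbabilityMeasure (X.lawM T) :=
  Measure.isProbabilityMeasure_map (X.measurable_M T).aemeasurable

/-- The strategy whose martingale part is `𝔼[F(M_T) | ℱ_t]`: each claim is retained up to the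
amount by which it changes this conditional expectation. -/
def valueStrategy (F : ℝ → ℝ) : Strategy Ω where
  u₀R := c
  SR t ω := stopAt (jumpSum (valueJump (X.valueFunction T F) fun s => X.S s ω)) T t
  AR t ω := stopAt (valueDrift (X.valueFunction T F) fun s => X.S s ω) T t

omit [IsProbabilityMeasure μ] in
-- The jump sum enters the compensator and the retained claims alike and cancels.
theorem MR_valueStrategy (t : ℝ≥0) (ω : Ω) : (valueStrategy X T c F).MR t ω =
    X.valueFunction T F (min t T) (X.S (min t T) ω) - X.valueFunction T F 0 (X.S 0 ω) := by
  simp only [Strategy.MR, valueStrategy, stopAt, valueDrift]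
  ring

omit [IsProbabilityMeasure μ] in
theorem valueFunction_zero (h0 : ∫ ω, F (X.M T ω) ∂μ = 0) :
    ∀ᵐ ω ∂μ, X.valueFunction T F 0 (X.S 0 ω) = 0 := by
  filter_upwards [X.S_zero] with ω hω
  rw [← h0, hω, SurplusModel.valueFunction]
  refine integral_congr_ae ?_
  filter_upwards [X.S_zero] with ω' hω'
  rw [min_eq_left (zero_le (a := T)), hω', X.M_eq]
  ring_nf

omit [IsProbabilityMeasure μ] in
theorem MR_valueStrategy_ae (h0 : ∫ ω, F (X.M T ω) ∂μ = 0) (t : ℝ≥0) :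
    (valueStrategy X T c F).MR t =ᵐ[μ]
      fun ω => X.valueFunction T F (min t T) (X.S (min t T) ω) := by
  filter_upwards [valueFunction_zero X T h0] with ω hω
  rw [MR_valueStrategy, hω, sub_zero]

include hF in
theorem MR_valueStrategy_condExp (h0 : ∫ ω, F (X.M T ω) ∂μ = 0) (t : ℝ≥0) :
    (valueStrategy X T c F).MR t =ᵐ[μ]
      μ[fun ω => F (X.M T ω) | X.filtrationM (min t T)] :=
  (MR_valueStrategy_ae X T c h0 t).trans
    (X.condExp_terminal hF (min_le_right t T) le_rfl (X.measurable_S_filtration _))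

include hF in
theorem MR_valueStrategy_terminal (h0 : ∫ ω, F (X.M T ω) ∂μ = 0) :
    (valueStrategy X T c F).MR T =ᵐ[μ] fun ω => F (X.M T ω) := by
  refine (MR_valueStrategy_condExp X hF T c h0 T).trans ?_
  rw [min_self, condExp_of_stronglyMeasurable (f := fun ω => F (X.M T ω)) (X.filtrationM.le T)
    (hF.continuous.measurable.comp (X.measurable_M_filtration T)).stronglyMeasurable
    (SurplusModel.integrable_comp_lipschitz hF (X.integrable_M T))]

include hF hFm in
theorem measurable_SR_valueStrategy (t : ℝ≥0) :
    Measurable[X.filtrationM (min t T)] ((valueStrategy X T c F).SR t) := by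
  have hk := X.isValueFunction hF hFm T
  refine @measurable_of_tendsto_metrizable _ _ (X.filtrationM (min t T)) _ _ _ _ _ _
    (fun n => ?_) (tendsto_pi_nhds.2 fun ω => hk.tendsto_jumpSum (X.pureJump_S ω) (min t T))
  refine Finset.measurable_fun_sum _ fun i hi => ?_
  have hi' := Finset.mem_range.1 hi
  have hm : ∀ (r : ℝ≥0) {s : ℝ≥0}, s ≤ min t T →
      Measurable[X.filtrationM (min t T)] fun ω => X.valueFunction T F r (X.S s ω) := fun r s hs =>
    (hk.continuous_space r).measurable.comp
      ((X.measurable_S_filtration s).mono (X.filtrationM.mono hs) le_rfl)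
  exact (hm _ (grid_le _ (by omega))).sub (hm _ (grid_le _ (by omega)))

include hF hFm in
theorem measurable_MR_valueStrategy (t : ℝ≥0) :
    Measurable[X.filtrationM (min t T)] ((valueStrategy X T c F).MR t) := by
  have hk := X.isValueFunction hF hFm T
  have hm : ∀ (r : ℝ≥0) {s : ℝ≥0}, s ≤ min t T →
      Measurable[X.filtrationM (min t T)] fun ω => X.valueFunction T F r (X.S s ω) := fun r s hs =>
    (hk.continuous_space r).measurable.comp
      ((X.measurable_S_filtration s).mono (X.filtrationM.mono hs) le_rfl)
  rw [show (valueStrategy X T c F).MR t = _ from funext (MR_valueStrategy X T c t)]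
  exact (hm _ le_rfl).sub (hm _ (zero_le (a := min t T)))

include hF hFm in
theorem martingale_MR_valueStrategy (h0 : ∫ ω, F (X.M T ω) ∂μ = 0) :
    Martingale (valueStrategy X T c F).MR X.filtrationM μ := by
  have hmeas := measurable_MR_valueStrategy X hF hFm T c
  have hle : ∀ t, X.filtrationM (min t T) ≤ X.filtrationM t := fun t =>
    X.filtrationM.mono (min_le_left t T)
  refine ⟨fun t => ((hmeas t).mono (hle t) le_rfl).stronglyMeasurable, fun s t hst => ?_⟩
  have hint : Integrable ((valueStrategy X T c F).MR t) μ :=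
    integrable_condExp.congr (MR_valueStrategy_condExp X hF T c h0 t).symm
  rcases le_total s T with h | h
  · have h1 := condExp_congr_ae (m := X.filtrationM s) (MR_valueStrategy_condExp X hF T c h0 t)
    have h2 := condExp_condExp_of_le (μ := μ) (f := fun ω => F (X.M T ω))
      (X.filtrationM.mono (le_min hst h)) (X.filtrationM.le (min t T))
    have h3 := MR_valueStrategy_condExp X hF T c h0 s
    rw [min_eq_left h] at h3
    exact h1.trans (h2.trans h3.symm)
  · have e : (valueStrategy X T c F).MR t = (valueStrategy X T c F).MR s := by
      ext ω
      rw [MR_valueStrategy, MR_valueStrategy, min_eq_right h, min_eq_right (h.trans hst)]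
    rw [e] at hint ⊢
    rw [condExp_of_stronglyMeasurable (X.filtrationM.le s)
      ((hmeas s).mono (hle s) le_rfl).stronglyMeasurable hint]

include hF hFm in
theorem isAdmissible_valueStrategy (h0 : ∫ ω, F (X.M T ω) ∂μ = 0) (hc : 0 ≤ c) :
    (valueStrategy X T c F).IsAdmissible X T := by
  have hk := X.isValueFunction hF hFm T
  have hle : ∀ t, X.filtrationM (min t T) ≤ X.filtrationM t := fun t =>
    X.filtrationM.mono (min_le_left t T)
  have hcont : ∀ ω, Continuous fun t => (valueStrategy X T c F).AR t ω := fun ω =>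
    (hk.continuous_valueDrift (X.pureJump_S ω)).comp (continuous_id.min continuous_const)
  have hmono : ∀ ω, Monotone fun t => (valueStrategy X T c F).AR t ω := fun ω s t hst =>
    hk.monotone_valueDrift (X.pureJump_S ω) (min_le_min_right T hst)
  refine ⟨hc, fun t => (measurable_SR_valueStrategy X hF hFm T c t).mono (hle t) le_rfl,
    Eventually.of_forall fun ω => (hk.isIncreasingPureJump (X.pureJump_S ω)).stopAt T,
    Eventually.of_forall fun ω => ?_, ⟨?_, Eventually.of_forall fun ω => ?_,
      Eventually.of_forall hmono, Eventually.of_forall fun ω =>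
        isCadlag_of_monotone (hmono ω) fun t => (hcont ω).continuousWithinAt, ?_⟩,
    Eventually.of_forall fun ω t ht => ?_⟩
  · simp [valueStrategy, stopAt, jumpSum_zero]
  -- The drift is the sum of the adapted martingale part and the adapted retained claims; continuity
  -- then makes it predictable.
  · refine isStronglyPredictable_of_continuous (fun t => ?_) hcont
    rw [Strategy.AR_eq]
    exact ((measurable_MR_valueStrategy X hF hFm T c t).add
      (measurable_SR_valueStrategy X hF hFm T c t)).mono (hle t) le_rfl
  · simp [valueStrategy, stopAt, valueDrift, jumpSum_zero]
  · have := (martingale_MR_valueStrategy X hF hFm T c h0).neg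
    refine (congrArg (fun f => Martingale f X.filtrationM μ) ?_).mp this
    ext t ω
    simp [Strategy.MR]
  · have hmem := hk.valueJump_mem (X.pureJump_S ω)
    have e : jump (fun s => (valueStrategy X T c F).SR s ω) t =
        valueJump (X.valueFunction T F) (fun s => X.S s ω) t :=
      (jump_stopAt_of_le _ ht).trans (jump_jumpSum (X.pureJump_S ω) hmem t)
    rw [e]
    exact hmem t

end Bass

/-! ### Comparison of the relaxed problem with the quantile problem. -/

section Problems

variable {Ω : Type*} [MeasurableSpace Ω] {μ : Measure Ω} [IsProbabilityMeasure μ]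
  {X : SurplusModel μ} {T : ℝ≥0} {h : Measure ℝ → ℝ≥0 → ℝ} {C : Set (Measure ℝ)}
  {Q F : ℝ → ℝ} (hF : LipschitzWith 1 F) (hFm : Monotone F)
  (hQF : ∀ u ∈ Ioo (0 : ℝ) 1, Q u = F (quantile (X.lawM T) u))

include hF hQF in
-- Replaces the conditional expectation by an explicit function of `S_t`, which is also the
-- conditional expectation given the whole of `ℱ_t`.
theorem isBassMartingaleOf_iff (hQ : IsDominatedBy (X.lawM T) Q) {N : ℝ≥0 → Ω → ℝ} :
    IsBassMartingaleOf X T Q N ↔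
      ∀ t ≤ T, N t =ᵐ[μ] fun ω => X.valueFunction T F t (X.S t ω) := by
  have h1 : (fun ω => evalLevel Q (cdf (X.lawM T) (X.M T ω))) =ᵐ[μ] fun ω => F (X.M T ω) :=
    ae_of_ae_map (X.measurable_M T).aemeasurable (ae_evalLevel_eq (P := X.lawM T) hQ hQF)
  refine forall₂_congr fun t ht => ?_
  have h2 := (X.condExp_terminal hF ht (X.comap_M_le t) (X.measurable_S_comap t)).trans
    (condExp_congr_ae h1).symm
  exact ⟨fun h => h.trans h2.symm, fun h => h.trans h2⟩

include hF hQF in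
theorem quantileCost_eq : quantileCost X T Q = ∫ ω, (F (X.M T ω) - X.M T ω) ^ 2 ∂μ := by
  have hG : Continuous fun x => (F x - x) ^ 2 := (hF.continuous.sub continuous_id).pow 2
  have h1 : ∫ ω, (F (X.M T ω) - X.M T ω) ^ 2 ∂μ = ∫ x, (F x - x) ^ 2 ∂(X.lawM T) :=
    (integral_map (X.measurable_M T).aemeasurable hG.aestronglyMeasurable).symm
  rw [h1, ← integral_comp_quantile hG, quantileCost]
  refine setIntegral_congr_fun measurableSet_Ioo fun u hu => ?_
  simp only [sq_abs, hQF u hu]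

include hF hQF in
theorem integral_quantile_eq : ∫ u in Ioo (0 : ℝ) 1, Q u = ∫ ω, F (X.M T ω) ∂μ := by
  have h1 : ∫ ω, F (X.M T ω) ∂μ = ∫ x, F x ∂(X.lawM T) :=
    (integral_map (X.measurable_M T).aemeasurable hF.continuous.aestronglyMeasurable).symm
  rw [h1, ← integral_comp_quantile hF.continuous]
  exact setIntegral_congr_fun measurableSet_Ioo hQF

include hF in
omit [IsProbabilityMeasure μ] in
theorem map_lawM : (X.lawM T).map F = μ.map fun ω => F (X.M T ω) :=
  Measure.map_map hF.continuous.measurable (X.measurable_M T)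

include hF in
theorem memLp_comp_M (hL2 : MemLp (X.S T) 2 μ) : MemLp (fun ω => F (X.M T ω)) 2 μ := by
  have hM := Strategy.memLp_M X hL2
  refine ((memLp_const |F 0|).add hM.abs).mono'
    (hF.continuous.comp_aestronglyMeasurable hM.1) (Eventually.of_forall fun ω => ?_)
  have := hF.dist_le_mul (X.M T ω) 0
  rw [Real.dist_eq, Real.dist_eq, sub_zero, NNReal.coe_one, one_mul] at this
  rw [Real.norm_eq_abs, Pi.add_apply]
  have h2 := abs_sub_abs_le_abs_sub (F (X.M T ω)) (F 0)
  simp only [Pi.abs_apply]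
  linarith

include hF in
theorem memLp_lawM (hL2 : MemLp (X.S T) 2 μ) : MemLp F 2 (X.lawM T) :=
  (memLp_map_measure_iff hF.continuous.aestronglyMeasurable
    (X.measurable_M T).aemeasurable).2 (memLp_comp_M hF hL2)

/-- Each feasible quantile function is attained by a strategy at the same cost. -/
theorem exists_strategy_of_quantile (hL2 : MemLp (X.S T) 2 μ)
    (hQ : Q ∈ constrainedQuantiles X h T C) :
    ∃ R, ∃ ν ∈ constrainedLaws X T C, R ∈ strategiesTo X h T ν ∧
      R.cost X T = ENNReal.ofReal (quantileCost X T Q) ∧ IsBassMartingaleOf X T Q R.MR := by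
  obtain ⟨hadm, c, hc, hC⟩ := hQ
  obtain ⟨F, hF, hFm, hQF⟩ := IsDominatedBy.exists_lipschitz (P := X.lawM T) hadm.increments
  have h0 : ∫ ω, F (X.M T ω) ∂μ = 0 := by
    rw [← integral_quantile_eq hF hQF, hadm.mean_zero]
  have hR := isAdmissible_valueStrategy X hF hFm T c h0 hc
  have hterm := MR_valueStrategy_terminal X hF T c h0
  have hlaw : μ.map ((valueStrategy X T c F).MR T) = lawOfQuantile Q := by
    rw [Measure.map_congr hterm, lawOfQuantile_comp hF.continuous hQF, map_lawM hF]
  -- The deterministic part of the terminal surplus; shifting `F` by it transports the law of `Mᴿ_T`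
  -- to that of `Uᴿ_T`.
  let d := c + (X.g T - h (lawOfQuantile Q) T)
  have hG : LipschitzWith 1 fun x => d + F x := by
    refine LipschitzWith.of_dist_le_mul fun x y => ?_
    rw [dist_add_left]
    exact hF.dist_le_mul x y
  have hν : lawOfQuantile (fun u => d + Q u) = (X.lawM T).map fun x => d + F x :=
    lawOfQuantile_comp hG.continuous fun u hu => by rw [hQF u hu]
  refine ⟨valueStrategy X T c F, _, ⟨⟨?_, ?_, _, hG, fun x y hxy => ?_, hν.symm⟩, hC⟩,
    ⟨hR, ?_⟩, ?_, ?_⟩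
  · rw [hν]
    exact Measure.isProbabilityMeasure_map hG.continuous.measurable.aemeasurable
  · rw [hν, memLp_map_measure_iff aestronglyMeasurable_id hG.continuous.measurable.aemeasurable]
    exact memLp_lawM hG hL2
  · exact add_le_add_right (hFm hxy) d
  · rw [hν, map_lawM hG]
    refine Measure.map_congr ?_
    filter_upwards [hterm] with ω hω
    rw [Strategy.UR, hω, hlaw]
    rfl
  · rw [hR.cost_eq hL2 ((memLp_comp_M hF hL2).ae_eq hterm.symm), quantileCost_eq hF hQF]
    congr 1
    refine integral_congr_ae ?_
    filter_upwards [hterm] with ω hω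
    rw [hω]
  · refine (isBassMartingaleOf_iff hF hQF hadm.increments).2 fun t ht => ?_
    have := MR_valueStrategy_ae X T c h0 t
    rwa [min_eq_left ht] at this

/-- Each feasible strategy is dominated by a feasible quantile function, and it is as good as
the latter only if its martingale part is the Bass martingale. -/
theorem exists_quantile_of_strategy (hL2 : MemLp (X.S T) 2 μ) {ν : Measure ℝ}
    (hν : ν ∈ constrainedLaws X T C) {R : Strategy Ω} (hR : R ∈ strategiesTo X h T ν) :
    ∃ Q ∈ constrainedQuantiles X h T C, ENNReal.ofReal (quantileCost X T Q) ≤ R.cost X T ∧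
      (R.cost X T ≤ ENNReal.ofReal (quantileCost X T Q) → IsBassMartingaleOf X T Q R.MR) := by
  obtain ⟨⟨-, hν2, G, hG, hGm, hGν⟩, hC⟩ := hν
  obtain ⟨hadm, hlaw⟩ := hR
  -- Removing the deterministic part of the surplus from `G` gives the `F` for which `Mᴿ_T` has the
  -- law of `F(M_T)`.
  let d := R.u₀R + (X.g T - h (μ.map (R.MR T)) T)
  let F : ℝ → ℝ := fun x => G x - d
  have hF : LipschitzWith 1 F := LipschitzWith.of_dist_le_mul fun x y => by
    rw [dist_sub_right]
    exact hG.dist_le_mul x y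
  have hFm : Monotone F := fun x y hxy => sub_le_sub_right (hGm hxy) d
  let Q : ℝ → ℝ := fun u => F (quantile (X.lawM T) u)
  have hQF : ∀ u ∈ Ioo (0 : ℝ) 1, Q u = F (quantile (X.lawM T) u) := fun _ _ => rfl
  have hFν : (X.lawM T).map F = ν.map fun x => x - d := by
    rw [← hGν, Measure.map_map (measurable_sub_const d) hG.continuous.measurable]
    rfl
  have hUR : R.UR X h T T = fun ω => d + R.MR T ω := rfl
  have hMRlaw : μ.map (R.MR T) = (X.lawM T).map F := by
    rw [hFν, ← hlaw, Measure.map_map (measurable_sub_const d)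
      (f := R.UR X h T T) ((hadm.measurable_MR T).const_add _)]
    congr 1
    ext ω
    simp [hUR]
  have hQlaw : lawOfQuantile Q = μ.map (R.MR T) := by
    rw [hMRlaw, lawOfQuantile_comp hF.continuous hQF]
  have hMRlaw' : μ.map (R.MR T) = μ.map fun ω => F (X.M T ω) := hMRlaw.trans (map_lawM hF)
  have hident : IdentDistrib (R.MR T) (fun ω => F (X.M T ω)) μ μ :=
    ⟨(hadm.measurable_MR T).aemeasurable,
      (hF.continuous.measurable.comp (X.measurable_M T)).aemeasurable, hMRlaw'⟩
  have hFL2 := memLp_comp_M (X := X) hF hL2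
  have hMR2 : MemLp (R.MR T) 2 μ := hident.memLp_iff.2 hFL2
  have h0 : ∫ ω, F (X.M T ω) ∂μ = 0 := by
    rw [← hident.integral_eq, hadm.integral_MR T]
  have hdom : IsDominatedBy (X.lawM T) Q := isDominatedBy_comp hF hFm
  obtain ⟨hopt, huniq⟩ := monotone_coupling_optimal hF.continuous hFm
    (Strategy.memLp_M X hL2) hMR2 hFL2 hMRlaw'
  refine ⟨Q, ⟨⟨(memLp_comp_iff hF.continuous hQF).2 (memLp_lawM hF hL2), ?_, hdom⟩,
    R.u₀R, hadm.capital, ?_⟩, ?_, fun hcost => ?_⟩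
  · rw [integral_quantile_eq hF hQF, h0]
  · rw [hQlaw, lawOfQuantile_comp (P := X.lawM T) (F := G) hG.continuous, hGν]
    · exact hC
    · intro u hu
      change d + (G _ - d) = _
      ring
  · rw [hadm.cost_eq hL2 hMR2, quantileCost_eq hF hQF]
    exact ENNReal.ofReal_le_ofReal hopt
  · rw [hadm.cost_eq hL2 hMR2, quantileCost_eq hF hQF, ENNReal.ofReal_le_ofReal_iff
      (integral_nonneg fun _ => sq_nonneg _)] at hcost
    -- Equality of costs forces `Mᴿ_T = F(M_T)`, and a martingale is determined by its terminal
    -- value.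
    have hY := huniq hcost
    refine (isBassMartingaleOf_iff hF hQF hdom).2 fun t ht => ?_
    exact (hadm.martingale_MR.condExp_ae_eq ht).symm.trans ((condExp_congr_ae hY).trans
      (X.condExp_terminal hF ht le_rfl (X.measurable_S_filtration t)).symm)

omit [IsProbabilityMeasure μ] in
theorem quantileCost_nonneg : 0 ≤ quantileCost X T Q :=
  integral_nonneg fun _ => sq_nonneg _

omit [IsProbabilityMeasure μ] in
theorem relaxedValue_le {ν : Measure ℝ} (hν : ν ∈ constrainedLaws X T C) {R : Strategy Ω}
    (hR : R ∈ strategiesTo X h T ν) : relaxedValue X h T C ≤ R.cost X T :=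
  (iInf₂_le ν hν).trans (iInf₂_le R hR)

theorem relaxedValue_eq (hL2 : MemLp (X.S T) 2 μ) (hQ : IsQuantileOptimizer X h T C Q) :
    relaxedValue X h T C = ENNReal.ofReal (quantileCost X T Q) := by
  refine le_antisymm ?_ (le_iInf₂ fun ν hν => le_iInf₂ fun R hR => ?_)
  · obtain ⟨R, ν, hν, hR, hcost, -⟩ := exists_strategy_of_quantile hL2 hQ.1
    exact (relaxedValue_le hν hR).trans_eq hcost
  · obtain ⟨Q', hQ', hle, -⟩ := exists_quantile_of_strategy hL2 hν hR
    exact (ENNReal.ofReal_le_ofReal (hQ.2 Q' hQ')).trans hle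

theorem exists_isQuantileOptimizer (hL2 : MemLp (X.S T) 2 μ)
    (hex : ∃ Q, IsQuantileOptimizer X h T C Q) {R : Strategy Ω}
    (hR : IsRelaxedOptimizer X h T C R) :
    ∃ Q, IsQuantileOptimizer X h T C Q ∧ IsBassMartingaleOf X T Q R.MR := by
  obtain ⟨Q₀, hQ₀⟩ := hex
  obtain ⟨⟨ν, hν, hRν⟩, hcost⟩ := hR
  obtain ⟨Q, hQ, hle, himp⟩ := exists_quantile_of_strategy hL2 hν hRν
  rw [hcost, relaxedValue_eq hL2 hQ₀] at hle himp
  refine ⟨Q, ⟨hQ, fun Q' hQ' => ?_⟩, himp (ENNReal.ofReal_le_ofReal (hQ₀.2 Q hQ))⟩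
  exact ((ENNReal.ofReal_le_ofReal_iff quantileCost_nonneg).1 hle).trans (hQ₀.2 Q' hQ')

theorem exists_isRelaxedOptimizer (hL2 : MemLp (X.S T) 2 μ)
    (hQ : IsQuantileOptimizer X h T C Q) :
    ∃ R, IsRelaxedOptimizer X h T C R ∧ IsBassMartingaleOf X T Q R.MR := by
  obtain ⟨R, ν, hν, hR, hcost, hbass⟩ := exists_strategy_of_quantile hL2 hQ.1
  exact ⟨R, ⟨⟨ν, hν, hR⟩, hcost.trans (relaxedValue_eq hL2 hQ).symm⟩, hbass⟩

/-- The Bass martingale determines the quantile function on `(0,1)`. -/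
theorem IsBassMartingaleOf.eqOn {Q₁ Q₂ : ℝ → ℝ} (h₁ : IsAdmissibleQuantile X T Q₁)
    (h₂ : IsAdmissibleQuantile X T Q₂) {N₁ N₂ : ℝ≥0 → Ω → ℝ} (hN₁ : IsBassMartingaleOf X T Q₁ N₁)
    (hN₂ : IsBassMartingaleOf X T Q₂ N₂) (heq : N₁ T =ᵐ[μ] N₂ T) : EqOn Q₁ Q₂ (Ioo 0 1) := by
  obtain ⟨F₁, hF₁, -, hQ₁⟩ := IsDominatedBy.exists_lipschitz (P := X.lawM T) h₁.increments
  obtain ⟨F₂, hF₂, -, hQ₂⟩ := IsDominatedBy.exists_lipschitz (P := X.lawM T) h₂.increments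
  have key : ∀ {F : ℝ → ℝ} (ω : Ω), X.valueFunction T F T (X.S T ω) = F (X.M T ω) := by
    intro F ω
    simp [SurplusModel.valueFunction, X.M_eq]
  have e₁ := (isBassMartingaleOf_iff hF₁ hQ₁ h₁.increments).1 hN₁ T le_rfl
  have e₂ := (isBassMartingaleOf_iff hF₂ hQ₂ h₂.increments).1 hN₂ T le_rfl
  simp only [key] at e₁ e₂
  have hae : F₁ =ᵐ[X.lawM T] F₂ := by
    refine (ae_map_iff (X.measurable_M T).aemeasurable
      (measurableSet_eq_fun hF₁.continuous.measurable hF₂.continuous.measurable)).2 ?_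
    exact e₁.symm.trans (heq.trans e₂)
  intro u hu
  rw [hQ₁ u hu, hQ₂ u hu, eq_quantile_of_ae_eq hF₁.continuous hF₂.continuous hae hu]

theorem IsBassMartingaleOf.ae_eq_of_eqOn {Q₁ Q₂ : ℝ → ℝ} (h₁ : IsAdmissibleQuantile X T Q₁)
    (h₂ : IsAdmissibleQuantile X T Q₂) (hQ : EqOn Q₁ Q₂ (Ioo 0 1)) {N₁ N₂ : ℝ≥0 → Ω → ℝ}
    (hN₁ : IsBassMartingaleOf X T Q₁ N₁) (hN₂ : IsBassMartingaleOf X T Q₂ N₂) :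
    ∀ t ≤ T, N₁ t =ᵐ[μ] N₂ t := by
  obtain ⟨F, hF, -, hQF⟩ := IsDominatedBy.exists_lipschitz (P := X.lawM T) h₁.increments
  have hQF₂ : ∀ u ∈ Ioo (0 : ℝ) 1, Q₂ u = F (quantile (X.lawM T) u) := fun u hu =>
    (hQ hu).symm.trans (hQF u hu)
  intro t ht
  exact ((isBassMartingaleOf_iff hF hQF h₁.increments).1 hN₁ t ht).trans
    ((isBassMartingaleOf_iff hF hQF₂ h₂.increments).1 hN₂ t ht).symm

omit [IsProbabilityMeasure μ] in
theorem Strategy.IsAdmissible.continuousWithinAt_MR {R : Strategy Ω} (hR : R.IsAdmissible X T) :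
    ∀ᵐ ω ∂μ, ∀ t, ContinuousWithinAt (fun s => R.MR s ω) (Ici t) t := by
  filter_upwards [hR.compensator.cadlag, hR.pureJump] with ω h1 h2 t
  exact (h1 t).1.sub (h2.cadlag t).1

end Problems

/-- Right-continuous processes that are modifications of each other on `[0,T]` are
indistinguishable there. -/
theorem indistinguishable_of_modification {Ω : Type*} [MeasurableSpace Ω] {μ : Measure Ω}
    {T : ℝ≥0} {N₁ N₂ : ℝ≥0 → Ω → ℝ}
    (h₁ : ∀ᵐ ω ∂μ, ∀ t, ContinuousWithinAt (fun s => N₁ s ω) (Ici t) t)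
    (h₂ : ∀ᵐ ω ∂μ, ∀ t, ContinuousWithinAt (fun s => N₂ s ω) (Ici t) t)
    (heq : ∀ t ≤ T, N₁ t =ᵐ[μ] N₂ t) : ∀ᵐ ω ∂μ, ∀ t ≤ T, N₁ t ω = N₂ t ω := by
  obtain ⟨D, hDc, hDd⟩ := TopologicalSpace.exists_countable_dense ℝ≥0
  have hD : ∀ᵐ ω ∂μ, ∀ s ∈ D, s ≤ T → N₁ s ω = N₂ s ω :=
    (ae_ball_iff hDc).2 fun s _ => by
      by_cases hs : s ≤ T
      · filter_upwards [heq s hs] with ω hω _ using hω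
      · exact Eventually.of_forall fun ω h => absurd h hs
  filter_upwards [h₁, h₂, hD, heq T le_rfl] with ω c₁ c₂ hω hT t ht
  rcases ht.eq_or_lt with rfl | ht
  · exact hT
  -- Before `T`, the times of `D` accumulate at `t` from the right; the endpoint `T` has no such
  -- times inside `[0,T]` and was treated separately.
  have hcl : t ∈ closure (Ioo t T ∩ D) := by
    have h := hDd.open_subset_closure_inter (isOpen_Ioo (a := t) (b := T))
    refine closure_minimal h isClosed_closure ?_
    rw [closure_Ioo ht.ne]
    exact left_mem_Icc.2 ht.le
  have hne : (𝓝[Ioo t T ∩ D] t).NeBot := mem_closure_iff_nhdsWithin_neBot.1 hcl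
  have hsub : Ioo t T ∩ D ⊆ Ici t := fun s hs => hs.1.1.le
  refine tendsto_nhds_unique ((c₁ t).mono hsub) (((c₂ t).mono hsub).congr' ?_)
  filter_upwards [self_mem_nhdsWithin] with s hs
  exact (hω s hs.2 hs.1.2.le).symm

end Reinsurance

end

theorem mainTheorem2 {Ω : Type*} [MeasurableSpace Ω] (μ : Measure Ω) [IsProbabilityMeasure μ]
    (X : Reinsurance.SurplusModel μ) (T : ℝ≥0) (hT : 0 < T) (hL2 : MemLp (X.S T) 2 μ)
    (h : Measure ℝ → ℝ≥0 → ℝ) (C : Set (Measure ℝ))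
    (hex : ∃ Q, Reinsurance.IsQuantileOptimizer X h T C Q) :
    -- the two problems have the same value
    (∀ Q, Reinsurance.IsQuantileOptimizer X h T C Q →
      Reinsurance.relaxedValue X h T C = ENNReal.ofReal (Reinsurance.quantileCost X T Q)) ∧
    -- each optimizer of the relaxed problem comes from an optimizer of the quantile problem
    (∀ R, Reinsurance.IsRelaxedOptimizer X h T C R →
      ∃ Q, Reinsurance.IsQuantileOptimizer X h T C Q ∧
        Reinsurance.IsBassMartingaleOf X T Q R.MR) ∧
    -- each optimizer of the quantile problem yields an optimizer of the relaxed problem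
    (∀ Q, Reinsurance.IsQuantileOptimizer X h T C Q →
      ∃ R, Reinsurance.IsRelaxedOptimizer X h T C R ∧
        Reinsurance.IsBassMartingaleOf X T Q R.MR) ∧
    -- the martingale part is unique iff the optimizer of the quantile problem is
    ((∀ R₁ R₂, Reinsurance.IsRelaxedOptimizer X h T C R₁ →
        Reinsurance.IsRelaxedOptimizer X h T C R₂ →
        ∀ᵐ ω ∂μ, ∀ t ≤ T, R₁.MR t ω = R₂.MR t ω) ↔
      (∀ Q₁ Q₂, Reinsurance.IsQuantileOptimizer X h T C Q₁ →
        Reinsurance.IsQuantileOptimizer X h T C Q₂ → EqOn Q₁ Q₂ (Ioo 0 1))) := by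
  refine ⟨fun Q hQ => Reinsurance.relaxedValue_eq hL2 hQ,
    fun R hR => Reinsurance.exists_isQuantileOptimizer hL2 hex hR,
    fun Q hQ => Reinsurance.exists_isRelaxedOptimizer hL2 hQ, fun huniq Q₁ Q₂ hQ₁ hQ₂ => ?_,
    fun huniq R₁ R₂ hR₁ hR₂ => ?_⟩
  · obtain ⟨R₁, hR₁, hN₁⟩ := Reinsurance.exists_isRelaxedOptimizer hL2 hQ₁
    obtain ⟨R₂, hR₂, hN₂⟩ := Reinsurance.exists_isRelaxedOptimizer hL2 hQ₂
    refine hN₁.eqOn hQ₁.1.1 hQ₂.1.1 hN₂ ?_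
    filter_upwards [huniq R₁ R₂ hR₁ hR₂] with ω hω using hω T le_rfl
  · obtain ⟨Q₁, hQ₁, hN₁⟩ := Reinsurance.exists_isQuantileOptimizer hL2 hex hR₁
    obtain ⟨Q₂, hQ₂, hN₂⟩ := Reinsurance.exists_isQuantileOptimizer hL2 hex hR₂
    obtain ⟨⟨_, _, hS₁⟩, -⟩ := hR₁
    obtain ⟨⟨_, _, hS₂⟩, -⟩ := hR₂
    exact Reinsurance.indistinguishable_of_modification hS₁.1.continuousWithinAt_MR
      hS₂.1.continuousWithinAt_MR
      (hN₁.ae_eq_of_eqOn hQ₁.1.1 hQ₂.1.1 (huniq Q₁ Q₂ hQ₁ hQ₂) hN₂)
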